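/- Let $m\ge 2$ be an integer. A $\mathbb{Z}_m$-code of length $n$ is a $\mathbb{Z}_m$-submodule $C$ of $\mathbb{Z}_m^n$, where $\mathbb{Z}_m=\mathbb{Z}/m\mathbb{Z}$; it is self-dual if $C=C^\perp:=\{x\in\mathbb{Z}_m^n \mid \sum_{i=1}^n x_iy_i=0 \text{ for all } y\in C\}$. Two $\mathbb{Z}_m$-codes of length $n$ are equivalent if one can be obtained from the other by permuting the coordinates and (if necessary) changing the signs of certain coordinates. The Euclidean weight of $v\in\mathbb{Z}_{2k}^n$ is $\sum_{i=1}^n \rho(v_i)^2$, where $\rho(a)\in\{1-k,\ldots,k\}$ is the representative of $a\in\mathbb{Z}_{2k}$ in this set. A Type II $\mathbb{Z}_{2k}$-code is a self-dual $\mathbb{Z}_{2k}$-code all of whose codewords have Euclidean weight divisible by $4k$. A Type II $\mathbb{Z}_{2k}$-code of length $n$ is extremal if the smallest Euclidean weight of its nonzero codewords equals $4k\lfloor n/24\rfloor+4k$. Corollary. Suppose that $k\in\{2,3,\ldots,20\}$. Then there are at least nine inequivalent extremal Type II $\mathbb{Z}_{2k}$-codes of length $24$; that is, there are nine extremal Type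 II $\mathbb{Z}_{2k}$-codes of length $24$, no two of which are equivalent. -/

import Mathlib

/-- A `ℤ_m`-code of length `n`: a `ℤ_m`-submodule of `ℤ_m^n`. -/
abbrev ZCode (m n : ℕ) : Type := Submodule (ZMod m) (Fin n → ZMod m)

namespace ZCode

/-- The dual code of `C` with respect to `⟨x, y⟩ = x₁ y₁ + ⋯ + xₙ yₙ`. -/
def dual {m n : ℕ} (C : ZCode m n) : ZCode m n where
  carrier := {x | ∀ y ∈ C, x ⬝ᵥ y = 0}
  add_mem' := by
    intro a b ha hb y hy
    rw [add_dotProduct, ha y hy, hb y hy, add_zero]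
  zero_mem' := by
    intro y _
    exact zero_dotProduct y
  smul_mem' := by
    intro c x hx y hy
    rw [smul_dotProduct, hx y hy, smul_zero]

/-- `C` is self-dual if it equals its dual code. -/
def IsSelfDual {m n : ℕ} (C : ZCode m n) : Prop := C = C.dual

/-- `C` and `D` are equivalent if `D` is obtained from `C` by permuting the coordinates and
changing the signs of certain coordinates. -/
def Equivalent {m n : ℕ} (C D : ZCode m n) : Prop :=
  ∃ (σ : Equiv.Perm (Fin n)) (ε : Fin n → ℤˣ),
    (D : Set (Fin n → ZMod m)) =
      (fun (v : Fin n → ZMod m) (i : Fin n) => ((ε i : ℤ) : ZMod m) * v (σ i)) '' (C : Set _)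

/-- The Euclidean weight of a vector over `ℤ_{2k}`: the sum of the squares of the representatives
of its entries in `{1 - k, …, k}` (these are the values of `ZMod.valMinAbs` modulo `2k`). -/
def euclideanWeight {k n : ℕ} (v : Fin n → ZMod (2 * k)) : ℕ :=
  ∑ i, (v i).valMinAbs.natAbs ^ 2

/-- Type II: self-dual, with all Euclidean weights divisible by `4k`. -/
def IsTypeII {k n : ℕ} (C : ZCode (2 * k) n) : Prop :=
  C.IsSelfDual ∧ ∀ v ∈ C, 4 * k ∣ euclideanWeight v

/-- `d` is the minimum Euclidean weight of `C`, the smallest Euclidean weight among all nonzero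
codewords. -/
def HasMinEuclideanWeight {k n : ℕ} (C : ZCode (2 * k) n) (d : ℕ) : Prop :=
  IsLeast {w | ∃ v ∈ C, v ≠ 0 ∧ euclideanWeight v = w} d

/-- An extremal Type II code: a Type II code whose minimum Euclidean weight is
`4k ⌊n / 24⌋ + 4k` (here `n / 24` is division of natural numbers). -/
def IsExtremalTypeII {k n : ℕ} (C : ZCode (2 * k) n) : Prop :=
  C.IsTypeII ∧ C.HasMinEuclideanWeight (4 * k * (n / 24) + 4 * k)

end ZCode

/-!
The codes come from the Leech lattice `Λ`. If `f_1, …, f_24` are pairwise orthogonal vectors of `Λ`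
of norm `2 * k` (a `2k`-frame), then sending `v ∈ Λ` to its inner products `(v, f_i)` modulo `2 * k`
identifies `Λ / ⟨f_1, …, f_24⟩` with a code over `ℤ_{2k}`. Unimodularity of `Λ` makes it self-dual,
evenness makes it Type II, and the absence of vectors of norm `2` makes it extremal
(`frameCode_isExtremalTypeII`). That `Λ` has no roots is deduced from the Golay code
(`leechGram_isRootlessUnimodular`).

A frame also determines a binary code, the set of all `x` modulo `2` with `∑ x_i f_i ∈ 2 Λ`. It can
be read off the frame code, since `∑ x_i f_i ∈ 2 Λ` means that `k * x` is a codeword. Counting the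
multiples by `k` of `± e_i ± e_j ± e_l ± e_m` in the frame code, in a suitable way, gives a number
which is invariant under equivalence (`cubeInvariant_eq_of_equivalent`). Hence nine frames whose
binary codes have distinct counts give nine inequivalent codes (`exists_inequivalent`). The nine
doubly even self-dual binary codes of length `24` are separated in this way.

It remains to find, for each `k` and each of the nine binary codes, a `2k`-frame of `Λ`. For the
primes `k ≤ 19` frames with exactly these binary codes are given explicitly. Other values follow by
two constructions: multiplying all vectors by `d` turns a `2k`-frame into a `2 d ^ 2 k`-frame, and
multiplying blocks of four frame vectors by a quaternion of norm `m` turns it into a `2 m k`-frame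
(`HasFrames.mul`), with binary codes that are computed from the given ones and are again separated
by the counts. The dilation changes the binary code, but the original one is still visible in the
frame code (`mem_frameCode_smul_iff`).

The frames are verified by kernel computation. A frame whose binary code is generated by `(1 | G)`
is encoded by short vectors, namely half the sums of frame vectors corresponding to the rows of
`(1 | G)` and the last twelve frame vectors, and orthogonality is tested on a single vector of large
powers of `2` (`Matrix.eq_of_mulVec_powerVector`).
-/

section

open Matrix

/-! ### Codes from frames in unimodular lattices -/

/-- `A` is the Gram matrix of an even unimodular lattice of rank `24` without roots, together with
a witness that its minimum is `4`: two vectors of norm `4` with inner product `1`. Lattice vectors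
are encoded by their coordinate vectors in `ℤ ^ 24`. -/
structure IsRootlessUnimodular (A : Matrix (Fin 24) (Fin 24) ℤ) : Prop where
  isSymm : A.IsSymm
  exists_inv : ∃ A' : Matrix (Fin 24) (Fin 24) ℤ, A * A' = 1
  even : ∀ x : Fin 24 → ℤ, Even (x ⬝ᵥ A *ᵥ x)
  four_le : ∀ x : Fin 24 → ℤ, x ≠ 0 → 4 ≤ x ⬝ᵥ A *ᵥ x
  exists_pair : ∃ u v : Fin 24 → ℤ,
    u ⬝ᵥ A *ᵥ u = 4 ∧ v ⬝ᵥ A *ᵥ v = 4 ∧ u ⬝ᵥ A *ᵥ v = 1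

/-- The rows of `F` are coordinate vectors of a `2k`-frame of the lattice with Gram matrix `A`:
`24` pairwise orthogonal vectors of norm `2 * k`. -/
def IsFrame (A F : Matrix (Fin 24) (Fin 24) ℤ) (k : ℤ) : Prop :=
  F * A * Fᵀ = (2 * k) • (1 : Matrix (Fin 24) (Fin 24) ℤ)

/-- The code of a frame: it consists of the vectors of inner products, modulo `2 * k`, of the
lattice vectors with the frame vectors. -/
def frameCode (A F : Matrix (Fin 24) (Fin 24) ℤ) (k : ℕ) : ZCode (2 * k) 24 where
  carrier := {y | ∃ x : Fin 24 → ℤ, y = fun i => ((((F * A) *ᵥ x) i : ℤ) : ZMod (2 * k))}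
  add_mem' := by
    rintro _ _ ⟨x, rfl⟩ ⟨y, rfl⟩
    exact ⟨x + y, by ext i; simp [mulVec_add]⟩
  zero_mem' := ⟨0, by ext i; simp⟩
  smul_mem' := by
    rintro c _ ⟨x, rfl⟩
    obtain ⟨c, rfl⟩ := ZMod.intCast_surjective c
    exact ⟨c • x, by ext i; rw [mulVec_smul]; simp⟩

/-- Over `ℤ`, a factorization of a nonzero scalar matrix commutes. -/
theorem Matrix.mul_eq_smul_one_comm {n : Type*} [Fintype n] [DecidableEq n]
    {M N : Matrix n n ℤ} {c : ℤ} (hc : c ≠ 0) (h : M * N = c • (1 : Matrix n n ℤ)) :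
    N * M = c • (1 : Matrix n n ℤ) := by
  have hdet : M.det ≠ 0 := by
    intro h0
    have := congrArg Matrix.det h
    rw [det_mul, h0, zero_mul, det_smul, det_one, mul_one] at this
    exact pow_ne_zero _ hc this.symm
  have h1 : M * (N * M) = M * (c • (1 : Matrix n n ℤ)) := by
    rw [← Matrix.mul_assoc, h, Matrix.smul_mul, Matrix.mul_smul, Matrix.one_mul, Matrix.mul_one]
  have h2 := congrArg (fun X => M.adjugate * X) h1
  simp only [← Matrix.mul_assoc, adjugate_mul] at h2
  rw [Matrix.smul_mul, Matrix.smul_mul, Matrix.smul_mul] at h2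
  simp only [Matrix.one_mul] at h2
  exact smul_right_injective _ hdet h2

section Frame
variable {A F : Matrix (Fin 24) (Fin 24) ℤ} {k : ℕ}

theorem IsFrame.gram_mul (hk : k ≠ 0) (hF : IsFrame A F k) :
    A * Fᵀ * F = (2 * k : ℤ) • (1 : Matrix (Fin 24) (Fin 24) ℤ) := by
  apply Matrix.mul_eq_smul_one_comm (by positivity)
  rw [← Matrix.mul_assoc]; exact hF

theorem IsFrame.dotProduct_mulVec (hk : k ≠ 0) (hA : A.IsSymm) (hF : IsFrame A F k)
    (x y : Fin 24 → ℤ) : ((F * A) *ᵥ x) ⬝ᵥ ((F * A) *ᵥ y) = 2 * k * (x ⬝ᵥ A *ᵥ y) := by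
  have h : (F * A)ᵀ * (F * A) = (2 * k : ℤ) • A := by
    rw [transpose_mul, hA.eq, ← Matrix.mul_assoc, hF.gram_mul hk]; simp
  rw [← Matrix.vecMul_transpose, ← Matrix.dotProduct_mulVec, Matrix.mulVec_mulVec, h,
    smul_mulVec, dotProduct_smul, smul_eq_mul]

theorem frameCode_isSelfDual (hk : k ≠ 0) (hA : IsRootlessUnimodular A) (hF : IsFrame A F k) :
    (frameCode A F k).IsSelfDual := by
  have : NeZero (2 * k) := ⟨by omega⟩
  obtain ⟨A', hA'⟩ := hA.exists_inv
  apply le_antisymm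
  · rintro _ ⟨x, rfl⟩ _ ⟨y, rfl⟩
    have h := congrArg (Int.cast : ℤ → ZMod (2 * k)) (hF.dotProduct_mulVec hk hA.isSymm x y)
    simp only [dotProduct] at h ⊢
    push_cast at h
    rw [h]
    have : (2 * (k : ZMod (2 * k))) = 0 := by exact_mod_cast ZMod.natCast_self (2 * k)
    rw [this, zero_mul]
  · intro y hy
    have hlift : ∃ z : Fin 24 → ℤ, ∀ i, (z i : ZMod (2 * k)) = y i :=
      ⟨fun i => (y i).valMinAbs, fun i => ZMod.coe_valMinAbs _⟩
    obtain ⟨z, hz⟩ := hlift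
    have h1 : ∀ x : Fin 24 → ℤ, ((2 * k : ℕ) : ℤ) ∣ z ⬝ᵥ (F * A) *ᵥ x := by
      intro x
      rw [← ZMod.intCast_zmod_eq_zero_iff_dvd]
      have := hy _ ⟨x, rfl⟩
      simp only [dotProduct, ← hz] at this ⊢
      push_cast
      exact this
    have h2 : ∀ l, ((2 * k : ℕ) : ℤ) ∣ (z ᵥ* F) l := by
      intro l
      have := h1 (A' *ᵥ Pi.single l 1)
      rwa [Matrix.mulVec_mulVec, Matrix.mul_assoc, hA', Matrix.mul_one, Matrix.dotProduct_mulVec,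
        dotProduct_single_one] at this
    choose w hw using h2
    refine ⟨w, ?_⟩
    have h3 : (2 * k : ℤ) • ((F * A) *ᵥ w) = (2 * k : ℤ) • z := by
      rw [← Matrix.mulVec_smul]
      have : (2 * k : ℤ) • w = z ᵥ* F := by ext l; simp [hw]
      rw [this, ← Matrix.mulVec_transpose, Matrix.mulVec_mulVec, hF, smul_mulVec, one_mulVec]
    have h4 : (F * A) *ᵥ w = z := smul_right_injective _ (by positivity : (2 * k : ℤ) ≠ 0) h3
    ext i
    rw [h4, hz]

/-- Any integer vector that reduces to a codeword of the frame code comes from a lattice vector: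
the frame vectors themselves have inner products `2 * k * e_i` with the frame. -/
theorem exists_lift_of_mem_frameCode (hF : IsFrame A F k) {y : Fin 24 → ZMod (2 * k)}
    (hy : y ∈ frameCode A F k) (z : Fin 24 → ℤ) (hz : ∀ i, (z i : ZMod (2 * k)) = y i) :
    ∃ w, (F * A) *ᵥ w = z := by
  obtain ⟨x, rfl⟩ := hy
  have : ∀ i, ∃ t, z i = ((F * A) *ᵥ x) i + 2 * k * t := by
    intro i
    have h := (ZMod.intCast_eq_intCast_iff_dvd_sub _ _ _).1 (hz i).symm
    obtain ⟨t, ht⟩ := h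
    exact ⟨t, by push_cast at ht; linarith⟩
  choose t ht using this
  refine ⟨x + Fᵀ *ᵥ t, ?_⟩
  rw [mulVec_add, Matrix.mulVec_mulVec, hF, smul_mulVec, one_mulVec]
  ext i
  simp [ht]

theorem cast_euclideanWeight {k n : ℕ} (v : Fin n → ZMod (2 * k)) :
    ((ZCode.euclideanWeight v : ℕ) : ℤ) =
      (fun i => (v i).valMinAbs) ⬝ᵥ (fun i => (v i).valMinAbs) := by
  simp [ZCode.euclideanWeight, dotProduct, sq]

theorem exists_euclideanWeight_eq (hk : k ≠ 0) (hA : A.IsSymm) (hF : IsFrame A F k)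
    {y : Fin 24 → ZMod (2 * k)} (hy : y ∈ frameCode A F k) :
    ∃ w, (F * A) *ᵥ w = (fun i => (y i).valMinAbs) ∧
      ((ZCode.euclideanWeight y : ℕ) : ℤ) = 2 * k * (w ⬝ᵥ A *ᵥ w) := by
  obtain ⟨w, hw⟩ := exists_lift_of_mem_frameCode hF hy (fun i => (y i).valMinAbs)
    (fun i => ZMod.coe_valMinAbs _)
  exact ⟨w, hw, by rw [cast_euclideanWeight, ← hw, hF.dotProduct_mulVec hk hA]⟩

/-- The Euclidean weight of a codeword is `2 * k` times the norm of some lattice vector, so evenness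
gives Type II and the absence of roots gives minimum weight at least `8 * k`. -/
theorem frameCode_isExtremalTypeII (hk : 2 ≤ k) (hA : IsRootlessUnimodular A)
    (hF : IsFrame A F k) : (frameCode A F k).IsExtremalTypeII := by
  have hk0 : k ≠ 0 := by omega
  have : NeZero (2 * k) := ⟨by omega⟩
  have hlow : ∀ y ∈ frameCode A F k, y ≠ 0 → 8 * k ≤ ZCode.euclideanWeight y := by
    intro y hy hy0
    obtain ⟨w, hw, hwt⟩ := exists_euclideanWeight_eq hk0 hA.isSymm hF hy
    have hw0 : w ≠ 0 := by
      rintro rfl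
      apply hy0
      ext i
      have := congrFun hw i
      rw [mulVec_zero] at this
      rw [← ZMod.coe_valMinAbs (y i), ← this]; simp
    have := hA.four_le w hw0
    zify
    rw [hwt]
    nlinarith
  refine ⟨⟨frameCode_isSelfDual hk0 hA hF, ?_⟩, ?_, ?_⟩
  · intro y hy
    obtain ⟨w, -, hwt⟩ := exists_euclideanWeight_eq hk0 hA.isSymm hF hy
    obtain ⟨t, ht⟩ := hA.even w
    zify
    exact ⟨t, by rw [hwt, ht]; ring⟩
  · obtain ⟨u, v, hu, hv, huv⟩ := hA.exists_pair
    -- a vector of norm `4` whose codeword is nonzero gives a codeword of weight exactly `8k`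
    have key : ∀ x : Fin 24 → ℤ, x ⬝ᵥ A *ᵥ x = 4 →
        (¬ ∀ i, ((((F * A) *ᵥ x) i : ℤ) : ZMod (2 * k)) = 0) →
        4 * k * (24 / 24) + 4 * k ∈
          {w | ∃ v ∈ frameCode A F k, v ≠ 0 ∧ ZCode.euclideanWeight v = w} := by
      intro x hx hne
      refine ⟨fun i => ((((F * A) *ᵥ x) i : ℤ) : ZMod (2 * k)), ⟨x, rfl⟩,
        fun h => hne fun i => congrFun h i, ?_⟩
      have h1 := hlow _ ⟨x, rfl⟩ (fun h => hne fun i => congrFun h i)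
      refine le_antisymm ?_ (le_trans (by omega) h1)
      have h2 := hF.dotProduct_mulVec hk0 hA.isSymm x x
      rw [hx] at h2
      have h3 : ((ZCode.euclideanWeight
          (fun i => ((((F * A) *ᵥ x) i : ℤ) : ZMod (2 * k))) : ℕ) : ℤ) ≤
          ((F * A) *ᵥ x) ⬝ᵥ ((F * A) *ᵥ x) := by
        unfold ZCode.euclideanWeight dotProduct
        push_cast
        refine Finset.sum_le_sum fun i _ => ?_
        rw [sq_abs, ← sq, sq_le_sq]
        have := ZMod.natAbs_min_of_le_div_two (2 * k)
          ((((F * A) *ᵥ x) i : ℤ) : ZMod (2 * k)).valMinAbs (((F * A) *ᵥ x) i)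
          (ZMod.coe_valMinAbs _) (ZMod.natAbs_valMinAbs_le _)
        zify at this
        exact this
      rw [h2] at h3
      have h4 : 4 * k * (24 / 24) + 4 * k = 8 * k := by omega
      rw [h4]
      generalize ZCode.euclideanWeight _ = W at h3 ⊢
      zify
      linarith
    -- If both codewords vanished, all inner products of `u` and `v` with the frame would be
    -- divisible by `2 * k`, and `2 * k * 1 = ∑ (u, f_i) (v, f_i)` by `(2 * k) ^ 2`.
    by_contra hcon
    have hu' := not_not.1 (mt (key u hu) hcon)
    have hv' := not_not.1 (mt (key v hv) hcon)
    have h2 := hF.dotProduct_mulVec hk0 hA.isSymm u v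
    rw [huv] at h2
    have h4 : ((2 * k : ℕ) : ℤ) * ((2 * k : ℕ) : ℤ) ∣ 2 * k * 1 := by
      rw [← h2]
      refine Finset.dvd_sum fun i _ => mul_dvd_mul ?_ ?_
      · exact (ZMod.intCast_zmod_eq_zero_iff_dvd _ _).1 (hu' i)
      · exact (ZMod.intCast_zmod_eq_zero_iff_dvd _ _).1 (hv' i)
    have h5 := Int.le_of_dvd (by positivity) h4
    push_cast at h5
    nlinarith
  · rintro _ ⟨y, hy, hy0, rfl⟩
    have := hlow y hy hy0
    omega

end Frame

/-! ### An invariant of codes under equivalence -/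

section Invariant
variable {m n : ℕ}

/-- `C` contains a vector of the form `c * (± e_i ± e_j ± e_k ± e_l)`, where the sign is a function
of the coordinate (so that repeated indices carry the same sign). -/
def QuadRel (C : ZCode m n) (c : ℤ) (i j k l : Fin n) : Prop :=
  ∃ e : Fin n → ℤˣ, (fun t => ((c * ((e t : ℤ) * (Pi.single i 1 + Pi.single j 1 +
    Pi.single k 1 + Pi.single l 1 : Fin n → ℤ) t) : ℤ) : ZMod m)) ∈ C

open Classical in
/-- The sum over all `i, j` of the cube of the number of pairs `(k, l)` in signed relation with
`(i, j)`. It depends only on the equivalence class of `C`. -/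
noncomputable def cubeInvariant (C : ZCode m n) (c : ℤ) : ℕ :=
  ∑ i, ∑ j, (Finset.univ.filter fun p : Fin n × Fin n => QuadRel C c i j p.1 p.2).card ^ 3

theorem QuadRel.of_image {C D : ZCode m n} {c : ℤ} {σ : Equiv.Perm (Fin n)} {ε : Fin n → ℤˣ}
    (h : (D : Set (Fin n → ZMod m)) =
      (fun (v : Fin n → ZMod m) (i : Fin n) => ((ε i : ℤ) : ZMod m) * v (σ i)) '' (C : Set _))
    {i j k l : Fin n} (hq : QuadRel C c (σ i) (σ j) (σ k) (σ l)) : QuadRel D c i j k l := by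
  obtain ⟨e, he⟩ := hq
  refine ⟨fun t => ε t * e (σ t), ?_⟩
  rw [← SetLike.mem_coe, h]
  refine ⟨_, he, ?_⟩
  ext t
  have : ∀ a : Fin n, (Pi.single (σ a) 1 : Fin n → ℤ) (σ t) = (Pi.single a 1 : Fin n → ℤ) t := by
    intro a; simp [Pi.single_apply]
  simp only [Pi.add_apply, this]
  push_cast
  ring

theorem QuadRel.to_preimage {C D : ZCode m n} {c : ℤ} {σ : Equiv.Perm (Fin n)} {ε : Fin n → ℤˣ}
    (h : (D : Set (Fin n → ZMod m)) =
      (fun (v : Fin n → ZMod m) (i : Fin n) => ((ε i : ℤ) : ZMod m) * v (σ i)) '' (C : Set _))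
    {i j k l : Fin n} (hq : QuadRel D c i j k l) : QuadRel C c (σ i) (σ j) (σ k) (σ l) := by
  obtain ⟨e, he⟩ := hq
  rw [← SetLike.mem_coe, h] at he
  obtain ⟨v, hv, hve⟩ := he
  refine ⟨fun t => ε (σ.symm t) * e (σ.symm t), ?_⟩
  convert (show v ∈ C from hv) using 1
  ext t
  have h1 := congrFun hve (σ.symm t)
  have : ∀ a : Fin n, (Pi.single (σ a) 1 : Fin n → ℤ) t =
      (Pi.single a 1 : Fin n → ℤ) (σ.symm t) := by
    intro a; simp [Pi.single_apply, Equiv.symm_apply_eq]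
  have h2 : (((ε (σ.symm t) : ℤˣ) : ℤ) : ZMod m) * (((ε (σ.symm t) : ℤˣ) : ℤ) : ZMod m) = 1 := by
    rw [← Int.cast_mul, ← Units.val_mul, Int.units_mul_self]; simp
  simp only [Pi.add_apply, this] at h1 ⊢
  simp only [Equiv.apply_symm_apply] at h1
  have h3 : v t = (((ε (σ.symm t) : ℤˣ) : ℤ) : ZMod m) *
      ((((ε (σ.symm t) : ℤˣ) : ℤ) : ZMod m) * v t) := by
    rw [← mul_assoc, h2, one_mul]
  rw [h3, h1]
  push_cast
  ring

theorem cubeInvariant_eq_of_equivalent {C D : ZCode m n} (h : C.Equivalent D) (c : ℤ) :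
    cubeInvariant D c = cubeInvariant C c := by
  classical
  obtain ⟨σ, ε, h⟩ := h
  have hrel : ∀ i j k l, QuadRel D c i j k l ↔ QuadRel C c (σ i) (σ j) (σ k) (σ l) :=
    fun i j k l => ⟨QuadRel.to_preimage h, QuadRel.of_image h⟩
  unfold cubeInvariant
  symm
  rw [← Equiv.sum_comp σ (fun i => ∑ j, _)]
  refine Finset.sum_congr rfl fun i _ => ?_
  rw [← Equiv.sum_comp σ (fun j => _)]
  refine Finset.sum_congr rfl fun j _ => ?_
  congr 1
  symm
  refine Finset.card_equiv (σ.prodCongr σ) fun p => ?_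
  simp [hrel]

end Invariant

/-! ### The binary code of a frame -/

section Half

/-- The twelve lowest binary digits of `w`, as a vector over `ℤ_2`. -/
def bitVector (w : ℕ) : Fin 12 → ZMod 2 := fun c => if w.testBit c then 1 else 0

theorem bitVector_xor (v w : ℕ) : bitVector (v ^^^ w) = bitVector v + bitVector w := by
  ext c
  simp only [bitVector, Nat.testBit_xor, Pi.add_apply]
  cases v.testBit c <;> cases w.testBit c <;> decide

theorem bitVector_eq_zero_iff {w : ℕ} (hw : w < 2 ^ 12) : bitVector w = 0 ↔ w = 0 := by
  refine ⟨fun h => ?_, by rintro rfl; ext; simp [bitVector]⟩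
  refine Nat.eq_of_testBit_eq fun c => ?_
  rw [Nat.zero_testBit]
  by_cases hc : c < 12
  · have := congrFun h ⟨c, hc⟩
    simpa [bitVector] using this
  · exact Nat.testBit_lt_two_pow (hw.trans_le (Nat.pow_le_pow_right (by norm_num) (by omega)))

/-- The syndrome of `x` modulo `2` for the binary code with parity check columns `s i`. -/
def syndrome (s : Fin 24 → Fin 12 → ZMod 2) (x : Fin 24 → ℤ) : Fin 12 → ZMod 2 :=
  ∑ i, (x i : ZMod 2) • s i

/-- The integer combinations of the rows of `F` divisible by `2` are those whose coefficients
reduce to words of the binary code with parity check columns `s i`. -/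
def HalvesAre (F : Matrix (Fin 24) (Fin 24) ℤ) (s : Fin 24 → Fin 12 → ZMod 2) : Prop :=
  ∀ x : Fin 24 → ℤ, (∃ v : Fin 24 → ℤ, x ᵥ* F = (2 : ℤ) • v) ↔ syndrome s x = 0

open Classical in
/-- The value of `cubeInvariant` on the code of a frame whose halves are governed by the binary
words `s i`: the relation becomes equality of bitwise sums. -/
noncomputable def cubeCount (s : Fin 24 → ℕ) : ℕ :=
  ∑ i, ∑ j, (Finset.univ.filter fun p : Fin 24 × Fin 24 => s p.1 ^^^ s p.2 = s i ^^^ s j).card ^ 3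

/-- The dilated frame `d • F` has norm `2 * d ^ 2 * k`, and in its code the vectors `d * k * x` are
the ones with `x ᵥ* F` divisible by `2`: this condition no longer involves `k` or `d`. -/
theorem mem_frameCode_smul_iff {A F : Matrix (Fin 24) (Fin 24) ℤ} {k d : ℕ} (hk : k ≠ 0)
    (hd : d ≠ 0) (hF : IsFrame A F k) (hF' : IsFrame A ((d : ℤ) • F) ((d ^ 2 * k : ℕ)))
    (x : Fin 24 → ℤ) :
    (fun t => (((d * k : ℕ) * x t : ℤ) : ZMod (2 * (d ^ 2 * k)))) ∈
        frameCode A ((d : ℤ) • F) (d ^ 2 * k) ↔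
      ∃ v : Fin 24 → ℤ, x ᵥ* F = (2 : ℤ) • v := by
  have hd' : (d : ℤ) ≠ 0 := by exact_mod_cast hd
  have hk' : (k : ℤ) ≠ 0 := by exact_mod_cast hk
  constructor
  · intro h
    obtain ⟨w, hw⟩ := exists_lift_of_mem_frameCode hF' h (fun t => (d * k : ℕ) * x t)
      (fun _ => rfl)
    refine ⟨w, ?_⟩
    have h1 : (F * A) *ᵥ w = (k : ℤ) • x := by
      apply smul_right_injective _ hd'
      ext t
      have := congrFun hw t
      rw [Matrix.smul_mul, smul_mulVec] at this
      simp only [Pi.smul_apply, smul_eq_mul] at this ⊢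
      rw [this]; push_cast; ring
    have h2 : Fᵀ * (F * A) = (2 * k : ℤ) • 1 := by
      have h3 : F * (A * Fᵀ) = (2 * k : ℤ) • 1 := by rw [← Matrix.mul_assoc]; exact hF
      have h4 := Matrix.mul_eq_smul_one_comm (by positivity) h3
      rw [Matrix.mul_assoc] at h4
      rw [← Matrix.mul_assoc]
      exact Matrix.mul_eq_smul_one_comm (by positivity) h4
    have h5 := congrArg (fun y => Fᵀ *ᵥ y) h1
    simp only [Matrix.mulVec_mulVec, h2, smul_mulVec, one_mulVec, mulVec_smul] at h5
    rw [← Matrix.mulVec_transpose]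
    apply smul_right_injective _ hk'
    simp only
    rw [← h5, smul_smul, mul_comm]
  · rintro ⟨v, hv⟩
    refine ⟨v, ?_⟩
    have h1 : (2 : ℤ) • (((d : ℤ) • F * A) *ᵥ v) =
        (2 : ℤ) • fun t => (((d * k : ℕ) : ℤ) * x t) := by
      rw [← mulVec_smul, ← hv, ← Matrix.mulVec_transpose, Matrix.mulVec_mulVec, Matrix.smul_mul,
        Matrix.smul_mul, hF]
      ext t
      simp only [smul_mulVec, one_mulVec, Pi.smul_apply, smul_eq_mul]
      push_cast; ring
    rw [smul_right_injective _ (two_ne_zero : (2 : ℤ) ≠ 0) h1]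

theorem quadRel_frameCode_iff {A F : Matrix (Fin 24) (Fin 24) ℤ} {k d : ℕ} (hk : k ≠ 0)
    (hd : d ≠ 0) (hF : IsFrame A F k) (hF' : IsFrame A ((d : ℤ) • F) ((d ^ 2 * k : ℕ)))
    {s : Fin 24 → ℕ} (hs : ∀ i, s i < 2 ^ 12) (hH : HalvesAre F fun i => bitVector (s i))
    (i j a b : Fin 24) :
    QuadRel (frameCode A ((d : ℤ) • F) (d ^ 2 * k)) (d * k : ℕ) i j a b ↔
      s a ^^^ s b = s i ^^^ s j := by
  -- Signs disappear modulo `2`.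
  have key : ∀ e : Fin 24 → ℤˣ, syndrome (fun i => bitVector (s i)) (fun t => (e t : ℤ) *
      (Pi.single i 1 + Pi.single j 1 + Pi.single a 1 + Pi.single b 1 : Fin 24 → ℤ) t) =
      bitVector ((s a ^^^ s b) ^^^ (s i ^^^ s j)) := by
    intro e
    have he : ∀ t, (((e t : ℤˣ) : ℤ) : ZMod 2) = 1 := by
      intro t
      rcases Int.units_eq_one_or (e t) with h | h <;> rw [h] <;> decide
    simp only [syndrome, Int.cast_mul, he, one_mul, Pi.add_apply, Int.cast_add, add_smul,
      Finset.sum_add_distrib, bitVector_xor]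
    have h1 : ∀ q : Fin 24, ∑ t, (((Pi.single q 1 : Fin 24 → ℤ) t : ℤ) : ZMod 2) •
        bitVector (s t) = bitVector (s q) := by
      intro q
      rw [Finset.sum_eq_single q]
      · simp
      · intro t _ ht; simp [ht]
      · simp
    rw [h1, h1, h1, h1]
    abel
  have hlt : (s a ^^^ s b) ^^^ (s i ^^^ s j) < 2 ^ 12 :=
    Nat.xor_lt_two_pow (Nat.xor_lt_two_pow (hs a) (hs b)) (Nat.xor_lt_two_pow (hs i) (hs j))
  have h0 : (s a ^^^ s b) ^^^ (s i ^^^ s j) = 0 ↔ s a ^^^ s b = s i ^^^ s j := Nat.xor_eq_zero_iff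
  rw [← h0, ← bitVector_eq_zero_iff hlt]
  constructor
  · rintro ⟨e, he⟩
    rw [mem_frameCode_smul_iff hk hd hF hF' , hH, key] at he
    exact he
  · intro h
    refine ⟨1, ?_⟩
    rw [mem_frameCode_smul_iff hk hd hF hF', hH, key]
    exact h

theorem cubeInvariant_frameCode {A F : Matrix (Fin 24) (Fin 24) ℤ} {k d : ℕ} (hk : k ≠ 0)
    (hd : d ≠ 0) (hF : IsFrame A F k) (hF' : IsFrame A ((d : ℤ) • F) ((d ^ 2 * k : ℕ)))
    {s : Fin 24 → ℕ} (hs : ∀ i, s i < 2 ^ 12) (hH : HalvesAre F fun i => bitVector (s i)) :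
    cubeInvariant (frameCode A ((d : ℤ) • F) (d ^ 2 * k)) (d * k : ℕ) = cubeCount s := by
  simp only [cubeInvariant, cubeCount, quadRel_frameCode_iff hk hd hF hF' hs hH]

theorem IsFrame.smul {A F : Matrix (Fin 24) (Fin 24) ℤ} {k d : ℕ} (hF : IsFrame A F k) :
    IsFrame A ((d : ℤ) • F) ((d ^ 2 * k : ℕ)) := by
  unfold IsFrame at *
  rw [transpose_smul, Matrix.smul_mul, Matrix.smul_mul, Matrix.mul_smul, hF, smul_smul, smul_smul]
  congr 1
  push_cast; ring

theorem exists_inequivalent {A : Matrix (Fin 24) (Fin 24) ℤ} (hA : IsRootlessUnimodular A)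
    {k d : ℕ} (hk : k ≠ 0) (hd : d ≠ 0) (hdk : 2 ≤ d ^ 2 * k) (s : Fin 9 → Fin 24 → ℕ)
    (hs : ∀ c i, s c i < 2 ^ 12) (hinj : Function.Injective fun c => cubeCount (s c))
    (h : ∀ c, ∃ F, IsFrame A F k ∧ HalvesAre F fun i => bitVector (s c i)) :
    ∃ C : Fin 9 → ZCode (2 * (d ^ 2 * k)) 24,
      (∀ i, (C i).IsExtremalTypeII) ∧ ∀ i j, i ≠ j → ¬ (C i).Equivalent (C j) := by
  choose F hF hH using h
  refine ⟨fun c => frameCode A ((d : ℤ) • F c) (d ^ 2 * k),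
    fun c => frameCode_isExtremalTypeII hdk hA (hF c).smul, fun i j hij he => hij ?_⟩
  have := cubeInvariant_eq_of_equivalent he (d * k : ℕ)
  rw [cubeInvariant_frameCode hk hd (hF i) (hF i).smul (hs i) (hH i),
    cubeInvariant_frameCode hk hd (hF j) (hF j).smul (hs j) (hH j)] at this
  exact hinj this.symm

end Half

/-! ### Evaluation of the invariant -/

section Count

/-- `∑ i < n, f i`, by a recursion which the kernel evaluates quickly. -/
def natSum (f : ℕ → ℕ) : ℕ → ℕ
  | 0 => 0
  | n + 1 => Nat.add (natSum f n) (f n)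

theorem natSum_eq (f : ℕ → ℕ) (n : ℕ) : natSum f n = ∑ i : Fin n, f i := by
  induction n with
  | zero => rfl
  | succ n ih => rw [Fin.sum_univ_castSucc]; simp [natSum, ih]

/-- A histogram packed into one natural number: with fewer than `2 ^ r` items, the base `2 ^ r`
digit of `∑ 2 ^ (r * g p)` in position `x` counts the items with `g p = x`. -/
theorem sum_two_pow_div_mod {ι : Type*} [DecidableEq ι] (S : Finset ι) (g : ι → ℕ) (x r : ℕ)
    (hS : S.card < 2 ^ r) :
    (∑ p ∈ S, 2 ^ (r * g p)) / 2 ^ (r * x) % 2 ^ r = (S.filter fun p => g p = x).card := by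
  -- `lo` collects the items below position `x`, `hi` those above it.
  have key : ∀ T : Finset ι, ∃ lo hi, ∑ p ∈ T, 2 ^ (r * g p) =
      lo + 2 ^ (r * x) * ((T.filter fun p => g p = x).card + 2 ^ r * hi) ∧
      lo * 2 ^ r ≤ T.card * 2 ^ (r * x) := by
    intro T
    induction T using Finset.induction_on with
    | empty => exact ⟨0, 0, by simp, by simp⟩
    | insert p T hp ih =>
      obtain ⟨lo, hi, h1, h2⟩ := ih
      rw [Finset.sum_insert hp, Finset.card_insert_of_notMem hp, Finset.filter_insert, h1]
      rcases lt_trichotomy (g p) x with h | h | h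
      · refine ⟨lo + 2 ^ (r * g p), hi, by rw [if_neg h.ne]; ring, ?_⟩
        have : 2 ^ (r * g p) * 2 ^ r ≤ 2 ^ (r * x) := by
          rw [← pow_add, ← Nat.mul_succ]
          exact Nat.pow_le_pow_right (by norm_num) (Nat.mul_le_mul_left r h)
        nlinarith
      · refine ⟨lo, hi, ?_, h2.trans (Nat.mul_le_mul_right _ (Nat.le_succ _))⟩
        rw [if_pos h, Finset.card_insert_of_notMem (by simp [hp]), h]
        ring
      · obtain ⟨q, hq⟩ := Nat.exists_eq_add_of_lt h
        refine ⟨lo, hi + 2 ^ (r * q), ?_, h2.trans (Nat.mul_le_mul_right _ (Nat.le_succ _))⟩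
        rw [if_neg h.ne', hq]
        ring
  obtain ⟨lo, hi, h1, h2⟩ := key S
  have hlo : lo < 2 ^ (r * x) := by
    by_contra hcon
    have h3 : S.card * 2 ^ (r * x) < 2 ^ r * 2 ^ (r * x) :=
      Nat.mul_lt_mul_of_pos_right hS (by positivity)
    nlinarith [Nat.mul_le_mul_right (2 ^ r) (not_lt.1 hcon)]
  rw [h1, Nat.add_mul_div_left _ _ (by positivity), Nat.div_eq_of_lt hlo, zero_add,
    Nat.add_mul_mod_self_left, Nat.mod_eq_of_lt ((Finset.card_filter_le _ _).trans_lt hS)]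

/-- The histogram of the bitwise sums `f i ^^^ f j`, packed in base `2 ^ 10 > 24 ^ 2`. -/
def xorHistogram (f : ℕ → ℕ) : ℕ :=
  natSum (fun i => natSum (fun j => 2 ^ (10 * (f i ^^^ f j))) 24) 24

/-- `cubeCount` in a form which the kernel evaluates quickly. -/
def fastCubeCount (f : ℕ → ℕ) : ℕ :=
  natSum (fun i => natSum (fun j =>
    (xorHistogram f / 2 ^ (10 * (f i ^^^ f j)) % 2 ^ 10) ^ 3) 24) 24

theorem cubeCount_eq_fastCubeCount (f : ℕ → ℕ) :
    cubeCount (fun i => f i) = fastCubeCount f := by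
  classical
  have h : xorHistogram f = ∑ p : Fin 24 × Fin 24, 2 ^ (10 * (f p.1 ^^^ f p.2)) := by
    simp only [xorHistogram, natSum_eq, Fintype.sum_prod_type]
  simp only [cubeCount, fastCubeCount, natSum_eq]
  refine Finset.sum_congr rfl fun i _ => Finset.sum_congr rfl fun j _ => ?_
  rw [h, sum_two_pow_div_mod Finset.univ (fun p : Fin 24 × Fin 24 => f p.1 ^^^ f p.2) _ 10
    (by simp)]

end Count

/-! ### Multiplication of frames by quaternions -/

section Quaternion

theorem IsFrame.mul_left {A F Q : Matrix (Fin 24) (Fin 24) ℤ} {k m : ℕ} (hF : IsFrame A F k)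
    (hQ : Q * Qᵀ = (m : ℤ) • (1 : Matrix (Fin 24) (Fin 24) ℤ)) :
    IsFrame A (Q * F) ((m * k : ℕ)) := by
  unfold IsFrame at *
  have : Q * F * A * (Q * F)ᵀ = Q * (F * A * Fᵀ) * Qᵀ := by
    rw [transpose_mul]; simp only [Matrix.mul_assoc]
  rw [this, hF, Matrix.mul_smul, Matrix.mul_one, Matrix.smul_mul, hQ, smul_smul]
  congr 1
  push_cast; ring

theorem HalvesAre.mul_left {F : Matrix (Fin 24) (Fin 24) ℤ} {s : Fin 24 → Fin 12 → ZMod 2}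
    (hF : HalvesAre F s) (Q : Matrix (Fin 24) (Fin 24) ℤ) :
    HalvesAre (Q * F) fun i => ∑ j, (Q i j : ZMod 2) • s j := by
  intro x
  rw [← Matrix.vecMul_vecMul, hF]
  have : syndrome s (x ᵥ* Q) = syndrome (fun i => ∑ j, (Q i j : ZMod 2) • s j) x := by
    simp only [syndrome, vecMul, dotProduct, Int.cast_sum, Int.cast_mul, Finset.sum_smul,
      Finset.smul_sum, mul_smul]
    exact Finset.sum_comm
  rw [this]

/-- Multiplication by the quaternion with coordinates `a, b, c, d`, as a matrix. -/
def quaternionMatrix (a b c d : ℤ) : Matrix (Fin 4) (Fin 4) ℤ :=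
  !![a, b, c, d; -b, a, -d, c; -c, d, a, -b; -d, -c, b, a]

theorem quaternionMatrix_mul_transpose (a b c d : ℤ) :
    quaternionMatrix a b c d * (quaternionMatrix a b c d)ᵀ =
      (a ^ 2 + b ^ 2 + c ^ 2 + d ^ 2) • (1 : Matrix (Fin 4) (Fin 4) ℤ) := by
  ext i j
  fin_cases i <;> fin_cases j <;>
    simp [quaternionMatrix, Matrix.mul_apply, Fin.sum_univ_four] <;> ring

/-- Six copies of `q`, acting on the indices congruent to `a` modulo `6` for each `a`:
the block matrix `q ⊗ 1`. -/
def blockMatrix (q : Matrix (Fin 4) (Fin 4) ℤ) : Matrix (Fin 24) (Fin 24) ℤ :=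
  (Matrix.kroneckerMap (· * ·) q (1 : Matrix (Fin 6) (Fin 6) ℤ)).submatrix
    (finProdFinEquiv (m := 4) (n := 6)).symm (finProdFinEquiv (m := 4) (n := 6)).symm

theorem blockMatrix_mul_transpose {q : Matrix (Fin 4) (Fin 4) ℤ} {m : ℤ}
    (hq : q * qᵀ = m • (1 : Matrix (Fin 4) (Fin 4) ℤ)) :
    blockMatrix q * (blockMatrix q)ᵀ = m • (1 : Matrix (Fin 24) (Fin 24) ℤ) := by
  unfold blockMatrix
  rw [transpose_submatrix, submatrix_mul_equiv, ← kroneckerMap_transpose,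
    transpose_one]
  have := Matrix.mul_kronecker_mul q qᵀ (1 : Matrix (Fin 6) (Fin 6) ℤ)
    (1 : Matrix (Fin 6) (Fin 6) ℤ)
  rw [hq, Matrix.one_mul, Matrix.smul_kronecker, one_kronecker_one] at this
  rw [← this]
  ext i j
  rw [submatrix_apply, Matrix.smul_apply, Matrix.smul_apply, Matrix.one_apply, Matrix.one_apply]
  simp

theorem sum_blockMatrix_smul (q : Matrix (Fin 4) (Fin 4) ℤ) (s : Fin 24 → Fin 12 → ZMod 2)
    (t : Fin 4) (a : Fin 6) :
    ∑ j, (blockMatrix q (finProdFinEquiv (t, a)) j : ZMod 2) • s j =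
      ∑ u : Fin 4, (q t u : ZMod 2) • s (finProdFinEquiv (u, a)) := by
  rw [← Equiv.sum_comp (finProdFinEquiv (m := 4) (n := 6)), Fintype.sum_prod_type]
  refine Finset.sum_congr rfl fun u _ => ?_
  rw [Finset.sum_eq_single a]
  · simp [blockMatrix]
  · intro b _ hb
    simp [blockMatrix, hb.symm]
  · simp

/-- The parity check words after multiplication by `1 + i`: the rows of this quaternion matrix are
`(1, 1, 0, 0)`, twice, and `(0, 0, 1, 1)`, twice, modulo `2`. -/
def pairXor (f : ℕ → ℕ) (i : ℕ) : ℕ :=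
  f (i % 6 + 6 * (2 * (i / 12))) ^^^ f (i % 6 + 6 * (2 * (i / 12) + 1))

/-- The parity check words after multiplication by an even number plus `i + j + k`: modulo `2` each
row has three ones, so a word is replaced by the sum of the other three in its block. -/
def tripleXor (f : ℕ → ℕ) (i : ℕ) : ℕ :=
  f (i % 6) ^^^ f (i % 6 + 6) ^^^ f (i % 6 + 12) ^^^ f (i % 6 + 18) ^^^ f i

theorem HalvesAre.block_mul {F : Matrix (Fin 24) (Fin 24) ℤ} {f g : ℕ → ℕ}
    (q : Matrix (Fin 4) (Fin 4) ℤ)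
    (hg : ∀ (a : Fin 6) (t : Fin 4), bitVector (g (a + 6 * t)) =
      ∑ u : Fin 4, (q t u : ZMod 2) • bitVector (f (a + 6 * u)))
    (h : HalvesAre F fun i => bitVector (f i)) :
    HalvesAre (blockMatrix q * F) fun i => bitVector (g i) := by
  convert h.mul_left (blockMatrix q) using 2 with i
  obtain ⟨⟨t, a⟩, rfl⟩ := (finProdFinEquiv (m := 4) (n := 6)).surjective i
  rw [sum_blockMatrix_smul]
  exact hg a t

theorem HalvesAre.pairXor {F : Matrix (Fin 24) (Fin 24) ℤ} {f : ℕ → ℕ}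
    (h : HalvesAre F fun i => bitVector (f i)) :
    HalvesAre (blockMatrix (quaternionMatrix 1 1 0 0) * F)
      fun i => bitVector (_root_.pairXor f i) := by
  refine HalvesAre.block_mul _ (fun a t => ?_) h
  have h1 : ((a : ℕ) + 6 * t) % 6 = a := by omega
  have h2 : ((a : ℕ) + 6 * t) / 12 = t / 2 := by omega
  rw [_root_.pairXor, h1, h2, bitVector_xor, Fin.sum_univ_four]
  have h3 : (-1 : ZMod 2) = 1 := by decide
  fin_cases t <;> simp [quaternionMatrix, h3]

theorem HalvesAre.tripleXor {F : Matrix (Fin 24) (Fin 24) ℤ} {f : ℕ → ℕ} {x : ℤ} (hx : Even x)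
    (h : HalvesAre F fun i => bitVector (f i)) :
    HalvesAre (blockMatrix (quaternionMatrix x 1 1 1) * F)
      fun i => bitVector (_root_.tripleXor f i) := by
  refine HalvesAre.block_mul _ (fun a t => ?_) h
  have h1 : ((a : ℕ) + 6 * t) % 6 = a := by omega
  rw [_root_.tripleXor, h1]
  simp only [bitVector_xor, Fin.sum_univ_four]
  have h3 : (-1 : ZMod 2) = 1 := by decide
  have h4 : (x : ZMod 2) = 0 := (ZMod.intCast_zmod_eq_zero_iff_dvd x 2).2 hx.two_dvd
  have h5 : ∀ y0 y1 y2 y3 : ZMod 2, y0 + y1 + y2 + y3 + y0 = y1 + y2 + y3 ∧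
      y0 + y1 + y2 + y3 + y1 = y0 + y2 + y3 ∧ y0 + y1 + y2 + y3 + y2 = y0 + y1 + y3 ∧
      y0 + y1 + y2 + y3 + y3 = y0 + y1 + y2 := by decide
  ext c
  fin_cases t <;> simp [quaternionMatrix, h3, h4, h5]

/-- Multiplication by `1 + 2 i` is trivial modulo `2`. -/
theorem HalvesAre.mul_one_two {F : Matrix (Fin 24) (Fin 24) ℤ} {f : ℕ → ℕ}
    (h : HalvesAre F fun i => bitVector (f i)) :
    HalvesAre (blockMatrix (quaternionMatrix 1 2 0 0) * F) fun i => bitVector (f i) := by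
  refine HalvesAre.block_mul _ (fun a t => ?_) h
  have h3 : (2 : ZMod 2) = 0 := by decide
  fin_cases t <;> simp [quaternionMatrix, h3, Fin.sum_univ_four]

end Quaternion

/-! ### Matrix identities by packed arithmetic -/

section Packed

/-- `∑ i < n, f i`, by a recursion which the kernel evaluates quickly. -/
def intSum (f : ℕ → ℤ) : ℕ → ℤ
  | 0 => 0
  | n + 1 => Int.add (intSum f n) (f n)

theorem intSum_eq (f : ℕ → ℤ) (n : ℕ) : intSum f n = ∑ i : Fin n, f i := by
  induction n with
  | zero => rfl
  | succ n ih => rw [Fin.sum_univ_castSucc, intSum, ih]; simp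

/-- The Boolean test that `f i` is true for all `i < n`. -/
def allBelow (f : ℕ → Bool) : ℕ → Bool
  | 0 => true
  | n + 1 => f n && allBelow f n

theorem allBelow_iff {f : ℕ → Bool} {n : ℕ} : allBelow f n = true ↔ ∀ i : Fin n, f i = true := by
  induction n with
  | zero => simp [allBelow]
  | succ n ih =>
    rw [allBelow, Bool.and_eq_true, ih, Fin.forall_fin_succ']
    simp [and_comm]

/-- An integer matrix with entries in `[-16, 16)` is stored as a list of natural numbers, one for
each row; the entry in column `j` is the base `32` digit in position `j`, minus `16`. -/
def entry (r : List ℕ) (i j : ℕ) : ℤ := Int.subNatNat (r.getD i 0 / 32 ^ j % 32) 16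

theorem abs_entry_le (r : List ℕ) (i j : ℕ) : |entry r i j| ≤ 16 := by
  have := Nat.mod_lt (r.getD i 0 / 32 ^ j) (show 32 > 0 by norm_num)
  rw [entry, Int.subNatNat_eq_coe, abs_le]
  omega

/-- The `24 × 24` matrix stored in `r`. -/
def decodeMatrix (r : List ℕ) : Matrix (Fin 24) (Fin 24) ℤ := Matrix.of fun i j => entry r i j

/-- Uniqueness of expansions in base `B` with signed digits. -/
theorem eq_zero_of_sum_mul_pow_eq_zero {B : ℤ} {n : ℕ} {d : Fin n → ℤ} (hd : ∀ j, |d j| < B)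
    (h : ∑ j, d j * B ^ (j : ℕ) = 0) : d = 0 := by
  induction n with
  | zero => exact Subsingleton.elim _ _
  | succ n ih =>
    rw [Fin.sum_univ_succ] at h
    have hB : B ≠ 0 := ((abs_nonneg _).trans_lt (hd 0)).ne'
    have h1 : ∑ j : Fin n, d j.succ * B ^ ((j.succ : Fin (n + 1)) : ℕ) =
        B * ∑ j : Fin n, d j.succ * B ^ (j : ℕ) := by
      rw [Finset.mul_sum]
      exact Finset.sum_congr rfl fun j _ => by rw [Fin.val_succ, pow_succ]; ring
    rw [h1] at h
    have h0 : d 0 = 0 := by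
      refine Int.eq_zero_of_abs_lt_dvd (m := B) ⟨-∑ j : Fin n, d j.succ * B ^ (j : ℕ), ?_⟩ (hd 0)
      simp at h; linarith
    rw [h0] at h
    have h2 := ih (d := fun j => d j.succ) (fun j => hd _) (by simpa [hB] using h)
    ext j
    refine Fin.cases h0 (fun i => congrFun h2 i) j

/-- The vector of powers of `2 ^ 40`. Multiplying by it packs a row of small integers into a single
one. -/
def powerVector : Fin 24 → ℤ := fun j => (2 ^ 40) ^ (j : ℕ)

/-- Matrices with small entries agree if they agree on one vector. This reduces an identity between
products of matrices to a few products of a matrix with a vector. -/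
theorem Matrix.eq_of_mulVec_powerVector {M N : Matrix (Fin 24) (Fin 24) ℤ}
    (hM : ∀ i j, |M i j| < 2 ^ 39) (hN : ∀ i j, |N i j| < 2 ^ 39)
    (h : M *ᵥ powerVector = N *ᵥ powerVector) : M = N := by
  ext i j
  have h1 : (fun j => M i j - N i j) = 0 := by
    refine eq_zero_of_sum_mul_pow_eq_zero (B := 2 ^ 40) (fun j => ?_) ?_
    · have := abs_sub (M i j) (N i j)
      have := hM i j
      have := hN i j
      linarith
    · have := congrFun h i
      simp only [mulVec, dotProduct, powerVector] at this
      simp only [sub_mul, Finset.sum_sub_distrib]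
      linarith
  exact sub_eq_zero.1 (congrFun h1 j)

theorem Matrix.abs_mul_apply_le {M N : Matrix (Fin 24) (Fin 24) ℤ} {a b : ℤ}
    (hM : ∀ i j, |M i j| ≤ a) (hN : ∀ i j, |N i j| ≤ b) (i j : Fin 24) :
    |(M * N) i j| ≤ 24 * (a * b) := by
  rw [Matrix.mul_apply]
  refine (Finset.abs_sum_le_sum_abs _ _).trans ?_
  refine (Finset.sum_le_card_nsmul _ _ (a * b) fun l _ => ?_).trans (by simp)
  rw [abs_mul]
  exact mul_le_mul (hM i l) (hN l j) (abs_nonneg _) ((abs_nonneg _).trans (hM i l))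

end Packed

/-! ### The Leech lattice -/

section Leech

/-- Representatives of the nine doubly even self-dual binary codes of length `24`, the first being
the Golay code. Such a code has a generator matrix `(1 | G)`, and the list gives the rows of `G`;
the digit of weight `2 ^ c` of row `b` is the entry in column `c`. -/
def codeRows : List (List ℕ) :=
  [[0x85f, 0xec9, 0x7a5, 0x66e, 0x4bb, 0xbc6, 0x753, 0xd36, 0x5dc, 0xb2b, 0xabc, 0x9f1],
   [0x787, 0xcd5, 0x2f3, 0x35d, 0x9cb, 0xdb2, 0x7c6, 0xc57, 0xf61, 0x610, 0xa9e, 0x904],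
   [0x20a, 0xb6c, 0xb17, 0x8cf, 0x130, 0x52f, 0xbac, 0x209, 0xd2b, 0x3e3, 0xc04, 0xa37],
   [0x38f, 0xb66, 0xbe2, 0xdff, 0xa08, 0x78e, 0x248, 0xbe4, 0xae6, 0xe71, 0x228, 0x39e],
   [0x105, 0x63d, 0xb59, 0x4a0, 0x69d, 0x20a, 0xb5c, 0x01a, 0x045, 0x2bd, 0x212, 0x805],
   [0xfbf, 0x1c0, 0xccd, 0xecc, 0x940, 0xcdc, 0x144, 0xcce, 0x373, 0x148, 0xcec, 0x540],
   [0x241, 0x114, 0xc02, 0x248, 0x822, 0x094, 0x209, 0xc20, 0x422, 0x049, 0x184, 0x190],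
   [0x209, 0xdb4, 0xcb6, 0x241, 0xda6, 0xd96, 0x248, 0xd36, 0xdb2, 0x049, 0x9b6, 0x5b6],
   [0x508, 0x40a, 0x448, 0xbff, 0x608, 0xc08, 0x40c, 0x488, 0x409, 0x418, 0xff7, 0x428]]

/-- The parity check columns of the binary code generated by `(1 | G)`, for `G` with rows `a`: they
are the rows of `G`, followed by the unit vectors. -/
def columnWord (a : List ℕ) (i : ℕ) : ℕ := if i < 12 then a.getD i 0 else 2 ^ (i - 12)

/-- The parity check columns of the nine binary codes. -/
def codeWord (c : ℕ) : ℕ → ℕ := columnWord (codeRows.getD c [])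

/-- A basis of the Leech lattice in its standard coordinates, scaled by `√8` to be integral. -/
def leechBasisRows : List ℕ :=
  [
   0x8c62f7bdaf8c6318c5f18bdf17c631, 0x8ce2f8c5ef8c62f8c5ef8c5f18c631, 0x842507421094a528421283a1084210,
   0x7be318be318c5f16be317bdf17bdef, 0x6bdf18c6317bdf18bdef7bdef7bdef, 0x8c6317c5ef9c6317c62f8bdf18c631,
   0x83a0e84210739ce842108425084250, 0x83a12842528420e842528425084210, 0x8c62f7c6717c6317bdef8be2f8be2f,
   0x84212839d2842108421274a10841d0, 0x7b5ef7bdaf7bdf19c5f17bdf17c5f1, 0x8c6318c6317c5ef7bdef7c66f8be2f,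
   0x842127421084a12742128425094210, 0x9421074210842129421293a1084250, 0x841d0739d083a109421284210841d0,
   0x7bdef7bdaf8c5f17c62f7c6318c5f1, 0x8bdef8be317c5ef7c6717c6317c5f1, 0x939d084212741d0842128425084210,
   0x73a107420e84a1284210839d084210, 0x7c6317c6317c6718bdf18bdef8bdef, 0x8420e942108420e94a109421084a12,
   0x84210841d0841d094a1084a5084a12, 0x941d0841d08421084a5084a1284212, 0x8c62f8c62f7c62f9c5ef8bdef7c62f]

/-- The Gram matrix of the basis `leechBasisRows`. -/
def leechGramRows : List ℕ :=
  [
   0x8c631845ef8c65074a0f73e4e7ca54, 0x9463283dcf83e0f83df073e4e74292, 0x83def949ef842527c21183a4f8d212,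
   0x73dce8461183df183e308be11a45cf, 0x839ef8c60f7c1ef84610841d48bdce, 0x84610845cf8be317bdf07ba8e84a52,
   0x8423173e518420f8c5f08d1d07b9ef, 0x7c21083e527c2118be30a45f08c1ce, 0x8b9cf9420f73a31935d4842108460f,
   0x7462f83e318c9f18468e8bdf08c1f0, 0x846517ca3094e2f6da2d7c5f17c1f2, 0x83e0f83a307b9f1a36128c5f083e0e,
   0x7420e8c6308c2348be318be2f8c9f0, 0x8c2108c62f7c6917c5f18422f7ca12, 0x7c630842308d23074e4e841f07c1f1,
   0x74a5074611a45f17ca2e7c22f84211, 0x7ca3173e548c1f08422f945ef8bdef, 0x7c6307be92846318c630949d083dcf,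
   0x83def8d1ef8c231749f07be318c9f1, 0x8b9cfa45ee7423183e1283a1184a10, 0x946547be118420e7c5ef8460f73e51,
   0x84a9273e319461084a2e8460f73e31, 0x7d25173e32946107c62e8422e7be31, 0xa3e128c1ef73e2e841d17c21074251]

/-- The inverse of the Gram matrix `leechGramRows`. -/
def leechInverseRows : List ℕ :=
  [
   0x7be0f84211841f0841f193e117ba14, 0x83e0e7c2308c21074211941f184290, 0x8ca117c62f7c5f083a2f74a118520e,
   0x94a508c20e849f0841f18460fa420f, 0x8c5d1741f18461283e5184a347c631, 0x842118c612749f09423074a91841f0,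
   0x94a11846107c9f183a50752528ca0f, 0x83e0e7be0f93e10745f2a39d083a52, 0x8c610741ef845f17c634942118be31,
   0x8c5d2745f08423183e917ca327c60f, 0x7bdf0839d183e318d1f18ba0f83a10, 0x745f38c9d274a2fb460f74250841d0,
   0x945d1739d0842147c6318461284210, 0x7bdd183dd193a908c62f83df07be0f, 0x8ca3184a10751d093e117ca5194610,
   0x8bdef83a0fa3a507421093dd083e30, 0x739f08c1f47c2309460f7c25173e11, 0x83e4e8c68f841ce739ef8420f84630,
   0x7c63185230749ee93a307c63084610, 0x7be4fa42318420e8c1ce7c22e8bdf0, 0x849d47c5d07c6319c25074631845cf,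
   0x8428e9464f7c5ce7bdd08420e94210, 0x952127c5ee7c9f18be317ca11949ef, 0xa4a107be0e8c5f273e3184a119460f]

/-- The product of a `24 × 24` matrix with a vector, both given as functions on `ℕ`. -/
def mulVecFun (e : ℕ → ℕ → ℤ) (z : ℕ → ℤ) (i : ℕ) : ℤ := intSum (fun j => Int.mul (e i j) (z j)) 24

theorem mulVecFun_eq (e : ℕ → ℕ → ℤ) (z : ℕ → ℤ) :
    (fun i : Fin 24 => mulVecFun e z i) =
      (Matrix.of fun i j : Fin 24 => e i j) *ᵥ fun j : Fin 24 => z j := by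
  ext i
  exact intSum_eq _ 24

/-- The entries of `powerVector`, as a function on `ℕ`. -/
def packedPower (j : ℕ) : ℤ := (2 ^ 40) ^ j

/-- A basis of the Leech lattice, scaled by `√8`. -/
def leechBasis : Matrix (Fin 24) (Fin 24) ℤ := decodeMatrix leechBasisRows

/-- The Gram matrix of the Leech lattice. -/
def leechGram : Matrix (Fin 24) (Fin 24) ℤ := decodeMatrix leechGramRows

theorem leechBasis_mul_transpose_check :
    allBelow (fun i => mulVecFun (entry leechBasisRows)
      (mulVecFun (fun i j => entry leechBasisRows j i) packedPower) i ==
        8 * mulVecFun (entry leechGramRows) packedPower i) 24 = true := by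
  decide +kernel

theorem leechGram_mul_inverse_check :
    allBelow (fun i => mulVecFun (entry leechGramRows)
      (mulVecFun (entry leechInverseRows) packedPower) i == packedPower i) 24 = true := by
  decide +kernel

theorem decodeMatrix_bound (r : List ℕ) (i j : Fin 24) : |decodeMatrix r i j| ≤ 16 :=
  abs_entry_le r i j

theorem leechBasis_mul_transpose : leechBasis * leechBasisᵀ = (8 : ℤ) • leechGram := by
  apply Matrix.eq_of_mulVec_powerVector
  · intro i j
    have := Matrix.abs_mul_apply_le (decodeMatrix_bound leechBasisRows)
      (N := leechBasisᵀ) (fun i j => decodeMatrix_bound leechBasisRows j i) i j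
    exact this.trans_lt (by norm_num)
  · intro i j
    have := decodeMatrix_bound leechGramRows i j
    rw [Matrix.smul_apply, smul_eq_mul, abs_mul, leechGram]
    norm_num
    omega
  · rw [← Matrix.mulVec_mulVec, smul_mulVec]
    ext i
    have h := allBelow_iff.1 leechBasis_mul_transpose_check i
    rw [beq_iff_eq] at h
    have h1 := congrFun (mulVecFun_eq (entry leechBasisRows)
      (mulVecFun (fun i j => entry leechBasisRows j i) packedPower)) i
    have h2 := congrFun (mulVecFun_eq (entry leechGramRows) packedPower) i
    rw [mulVecFun_eq (fun i j => entry leechBasisRows j i)] at h1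
    rw [h1, h2] at h
    exact h

theorem leechGram_mul_inverse : leechGram * decodeMatrix leechInverseRows = 1 := by
  apply Matrix.eq_of_mulVec_powerVector
  · intro i j
    exact (Matrix.abs_mul_apply_le (decodeMatrix_bound leechGramRows)
      (decodeMatrix_bound leechInverseRows) i j).trans_lt (by norm_num)
  · intro i j
    rw [Matrix.one_apply]; split_ifs <;> norm_num
  · rw [← Matrix.mulVec_mulVec, one_mulVec]
    ext i
    have h := allBelow_iff.1 leechGram_mul_inverse_check i
    rw [beq_iff_eq] at h
    have h1 := congrFun (mulVecFun_eq (entry leechGramRows)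
      (mulVecFun (entry leechInverseRows) packedPower)) i
    rw [mulVecFun_eq (entry leechInverseRows)] at h1
    rw [h1] at h
    exact h

/-- `8 A = b bᵀ`, with `b` the matrix of the basis. -/
theorem leechGram_isSymm : leechGram.IsSymm := by
  apply smul_right_injective _ (show (8 : ℤ) ≠ 0 by norm_num)
  simp only
  rw [← transpose_smul, ← leechBasis_mul_transpose, transpose_mul, transpose_transpose]

theorem even_dotProduct_mulVec {n : ℕ} {A : Matrix (Fin n) (Fin n) ℤ} (hA : A.IsSymm)
    (hd : ∀ i, Even (A i i)) (x : Fin n → ℤ) : Even (x ⬝ᵥ A *ᵥ x) := by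
  -- `A = S + Sᵀ` with `S` integral and upper triangular.
  set S : Matrix (Fin n) (Fin n) ℤ :=
    Matrix.of fun i j => if i < j then A i j else if i = j then A i j / 2 else 0
  have hS : A = S + Sᵀ := by
    ext i j
    simp only [S, Matrix.add_apply, Matrix.transpose_apply, Matrix.of_apply]
    rcases lt_trichotomy i j with h | h | h
    · simp [h, h.not_gt, h.ne']
    · subst h
      obtain ⟨t, ht⟩ := hd i
      simp; omega
    · simp [h, h.not_gt, h.ne', hA.apply i j]
  refine ⟨x ⬝ᵥ S *ᵥ x, ?_⟩
  conv_lhs => rw [hS]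
  rw [add_mulVec, dotProduct_add]
  congr 1
  rw [mulVec_transpose, dotProduct_comm, ← dotProduct_mulVec]

/-- The Boolean test that the sum of `w` and of at most `r` words among `f 0, …, f (n - 1)`, with
distinct indices, is never zero. The words are added in decreasing order of their index. -/
def noZeroXor (f : ℕ → ℕ) : ℕ → ℕ → ℕ → Bool
  | 0, w, _ => w % 2 ^ 12 != 0
  | r + 1, w, n => w % 2 ^ 12 != 0 && allBelow (fun i => noZeroXor f r (w ^^^ f i) i) n

theorem bitVector_ne_zero {w : ℕ} (h : w % 2 ^ 12 ≠ 0) : bitVector w ≠ 0 := by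
  intro h0
  apply h
  refine Nat.eq_of_testBit_eq fun c => ?_
  rw [Nat.testBit_mod_two_pow, Nat.zero_testBit]
  by_cases hc : c < 12
  · have := congrFun h0 ⟨c, hc⟩
    simpa [bitVector, hc] using this
  · simp [hc]

theorem noZeroXor_sound (f : ℕ → ℕ) (r : ℕ) : ∀ (w n : ℕ), noZeroXor f r w n = true →
    ∀ S : Finset (Fin 24), (∀ i ∈ S, (i : ℕ) < n) → S.card ≤ r →
      bitVector w + ∑ i ∈ S, bitVector (f i) ≠ 0 := by
  induction r with
  | zero =>
    intro w n h S _ hS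
    rw [Finset.card_eq_zero.1 (Nat.le_zero.1 hS), Finset.sum_empty, add_zero]
    exact bitVector_ne_zero (by simpa [noZeroXor] using h)
  | succ r ih =>
    intro w n h S hn hS
    rw [noZeroXor, Bool.and_eq_true] at h
    rcases S.eq_empty_or_nonempty with rfl | hne
    · rw [Finset.sum_empty, add_zero]
      exact bitVector_ne_zero (by simpa using h.1)
    · have hm := S.max'_mem hne
      have h1 := allBelow_iff.1 h.2 ⟨S.max' hne, hn _ hm⟩
      have h2 := ih _ _ h1 (S.erase (S.max' hne)) (fun i hi =>
        Finset.lt_max'_of_mem_erase_max' S hne hi) (by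
          rw [Finset.card_erase_of_mem hm]; omega)
      rw [bitVector_xor, add_assoc] at h2
      rwa [← Finset.add_sum_erase S _ hm]

/-- The parity check columns of the Golay code. -/
def golayWord : ℕ → ℕ := codeWord 0

theorem golay_check : allBelow (fun i => noZeroXor golayWord 3 (golayWord i) i) 24 = true := by
  decide +kernel

/-- The Golay code has minimum weight greater than `4`. -/
theorem golay_sum_ne_zero {S : Finset (Fin 24)} (hne : S.Nonempty) (hS : S.card ≤ 4) :
    ∑ i ∈ S, bitVector (golayWord i) ≠ 0 := by
  have hm := S.max'_mem hne
  rw [← Finset.add_sum_erase S _ hm]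
  refine noZeroXor_sound golayWord 3 _ _ (allBelow_iff.1 golay_check (S.max' hne)) _
    (fun i hi => Finset.lt_max'_of_mem_erase_max' S hne hi) ?_
  rw [Finset.card_erase_of_mem hm]; omega

theorem leechBasis_check : allBelow (fun i =>
    allBelow (fun j => (entry leechBasisRows i j - entry leechBasisRows i 0) % 2 == 0) 24 &&
    (intSum (fun j => entry leechBasisRows i j) 24 - 4 * entry leechBasisRows i 0) % 8 == 0 &&
    allBelow (fun c => intSum (fun j => bif (golayWord j).testBit c then
      entry leechBasisRows i j else 0) 24 % 4 == 0) 12 &&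
    entry leechGramRows i i % 2 == 0) 24 = true := by
  decide +kernel

theorem leechBasis_spec (i : Fin 24) :
    (∀ j, 2 ∣ leechBasis i j - leechBasis i 0) ∧
    8 ∣ ∑ j, leechBasis i j - 4 * leechBasis i 0 ∧
    (∀ c < 12, 4 ∣ ∑ j : Fin 24, if (golayWord j).testBit c then leechBasis i j else 0) ∧
    2 ∣ leechGram i i := by
  have h := allBelow_iff.1 leechBasis_check i
  simp only [Bool.and_eq_true, allBelow_iff, beq_iff_eq, intSum_eq] at h
  obtain ⟨⟨⟨h1, h2⟩, h3⟩, h4⟩ := h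
  refine ⟨fun j => Int.dvd_of_emod_eq_zero (h1 j), Int.dvd_of_emod_eq_zero h2, fun c hc => ?_,
    Int.dvd_of_emod_eq_zero h4⟩
  have := Int.dvd_of_emod_eq_zero (h3 ⟨c, hc⟩)
  simp only [cond_eq_ite] at this
  exact this

/-- The coordinates of a vector in the Leech lattice have the same parity `m`, their sum is `4 * m`
modulo `8`, and modulo `4` they satisfy the parity checks of the Golay code. -/
theorem leech_coord_spec (x : Fin 24 → ℤ) :
    (∀ j, 2 ∣ (x ᵥ* leechBasis) j - (x ᵥ* leechBasis) 0) ∧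
    8 ∣ ∑ j, (x ᵥ* leechBasis) j - 4 * (x ᵥ* leechBasis) 0 ∧
    (∀ c < 12, 4 ∣ ∑ j : Fin 24, if (golayWord j).testBit c then (x ᵥ* leechBasis) j else 0) := by
  simp only [vecMul, dotProduct]
  refine ⟨fun j => ?_, ?_, fun c hc => ?_⟩
  · rw [← Finset.sum_sub_distrib]
    refine Finset.dvd_sum fun i _ => ?_
    rw [← mul_sub]
    exact ((leechBasis_spec i).1 j).mul_left _
  · rw [Finset.sum_comm, Finset.mul_sum, ← Finset.sum_sub_distrib]
    refine Finset.dvd_sum fun i _ => ?_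
    rw [← Finset.mul_sum, mul_left_comm, ← mul_sub]
    exact (leechBasis_spec i).2.1.mul_left _
  · have : ∀ j : Fin 24, (if (golayWord j).testBit c then ∑ i, x i * leechBasis i j else 0) =
        ∑ i, x i * if (golayWord j).testBit c then leechBasis i j else 0 := by
      intro j; split_ifs <;> simp
    simp only [this]
    rw [Finset.sum_comm]
    refine Finset.dvd_sum fun i _ => ?_
    rw [← Finset.mul_sum]
    exact ((leechBasis_spec i).2.2.1 c hc).mul_left _

/-- A vector of norm `4` that reduces to a Golay codeword modulo `2` has at most four odd
coordinates, hence none. -/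
theorem even_of_syndrome_eq_zero {z : Fin 24 → ℤ} (hz : ∑ i, z i ^ 2 = 4)
    (hs : ∀ c < 12, 2 ∣ ∑ j : Fin 24, if (golayWord j).testBit c then z j else 0) (i : Fin 24) :
    Even (z i) := by
  classical
  by_contra hi
  set S : Finset (Fin 24) := Finset.univ.filter fun j => ¬ Even (z j)
  have hcard : S.card ≤ 4 := by
    have h1 : ∑ j ∈ S, (1 : ℤ) ≤ ∑ j ∈ S, z j ^ 2 := by
      refine Finset.sum_le_sum fun j hj => ?_
      have : z j ≠ 0 := by
        rintro h; simp [S, h] at hj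
      have := sq_pos_of_ne_zero this
      omega
    have h2 : ∑ j ∈ S, z j ^ 2 ≤ ∑ j, z j ^ 2 :=
      Finset.sum_le_sum_of_subset_of_nonneg (Finset.subset_univ _) fun j _ _ => sq_nonneg _
    simp only [Finset.sum_const, nsmul_eq_mul, mul_one] at h1
    zify; omega
  refine golay_sum_ne_zero (S := S) ⟨i, Finset.mem_filter.2 ⟨Finset.mem_univ i, hi⟩⟩ hcard ?_
  ext c
  have h := (ZMod.intCast_zmod_eq_zero_iff_dvd _ 2).2 (hs c c.2)
  refine Eq.trans ?_ h
  rw [Finset.sum_apply, Finset.sum_filter, Int.cast_sum]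
  refine Finset.sum_congr rfl fun j _ => ?_
  by_cases hj : Even (z j)
  · have : (z j : ZMod 2) = 0 := (ZMod.intCast_zmod_eq_zero_iff_dvd _ 2).2 hj.two_dvd
    simp [hj, this]
  · have : (z j : ZMod 2) = 1 := by
      obtain ⟨t, ht⟩ := Int.not_even_iff_odd.1 hj
      rw [ht]; push_cast
      rw [show (2 : ZMod 2) = 0 from rfl]; simp
    rw [if_pos hj, bitVector]
    split_ifs with h5 <;> simp [this]

/-- The Leech lattice has no roots. If the coordinates are odd, the norm is at least `24 / 8`.
Otherwise the halved coordinates reduce to a Golay codeword, so the coordinates of a root would be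
`± 4` at one place and `0` elsewhere, with a sum that violates the congruence modulo `8`. -/
theorem leech_coord_norm_ne (x : Fin 24 → ℤ) : ∑ j, (x ᵥ* leechBasis) j ^ 2 ≠ 16 := by
  intro hX
  obtain ⟨h1, h2, h3⟩ := leech_coord_spec x
  generalize x ᵥ* leechBasis = X at *
  rcases Int.even_or_odd (X 0) with h0 | h0
  · have hev : ∀ j, ∃ z, X j = 2 * z := by
      intro j
      obtain ⟨t, ht⟩ := h1 j
      obtain ⟨u, hu⟩ := h0
      exact ⟨t + u, by omega⟩
    choose z hz using hev
    have hz4 : ∑ j, z j ^ 2 = 4 := by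
      have : ∑ j, X j ^ 2 = 4 * ∑ j, z j ^ 2 := by
        rw [Finset.mul_sum]; exact Finset.sum_congr rfl fun j _ => by rw [hz]; ring
      omega
    have hzev := even_of_syndrome_eq_zero hz4 fun c hc => by
      have h4 : (∑ j : Fin 24, if (golayWord j).testBit c then X j else 0) =
          2 * ∑ j : Fin 24, if (golayWord j).testBit c then z j else 0 := by
        rw [Finset.mul_sum]
        exact Finset.sum_congr rfl fun j _ => by rw [hz]; split_ifs <;> simp
      have := h3 c hc
      rw [h4] at this
      omega
    choose w hw using hzev
    have hw1 : ∑ j, w j ^ 2 = 1 := by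
      have : ∑ j, z j ^ 2 = 4 * ∑ j, w j ^ 2 := by
        rw [Finset.mul_sum]; exact Finset.sum_congr rfl fun j _ => by rw [hw]; ring
      omega
    have hsum : ∑ j, X j = 4 * ∑ j, w j := by
      rw [Finset.mul_sum]; exact Finset.sum_congr rfl fun j _ => by rw [hz, hw]; ring
    have hpar : 2 ∣ ∑ j, w j ^ 2 - ∑ j, w j := by
      rw [← Finset.sum_sub_distrib]
      refine Finset.dvd_sum fun j _ => ?_
      have := (Int.even_mul_succ_self (w j - 1)).two_dvd
      convert this using 1; ring
    rw [hsum, hz 0, hw 0] at h2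
    omega
  · have : ∑ j : Fin 24, (1 : ℤ) ≤ ∑ j, X j ^ 2 := by
      refine Finset.sum_le_sum fun j _ => ?_
      have : X j ≠ 0 := by
        intro h
        obtain ⟨t, ht⟩ := h1 j
        obtain ⟨u, hu⟩ := h0
        omega
      have := sq_pos_of_ne_zero this
      omega
    rw [hX] at this
    simp at this

theorem leechGram_form (x : Fin 24 → ℤ) :
    ∑ j, (x ᵥ* leechBasis) j ^ 2 = 8 * (x ⬝ᵥ leechGram *ᵥ x) := by
  have h : ∑ j, (x ᵥ* leechBasis) j ^ 2 = (x ᵥ* leechBasis) ⬝ᵥ (x ᵥ* leechBasis) := by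
    simp [dotProduct, sq]
  rw [h, ← dotProduct_mulVec, ← mulVec_transpose, mulVec_mulVec, leechBasis_mul_transpose,
    smul_mulVec, dotProduct_smul, smul_eq_mul]

theorem leechGram_isRootlessUnimodular : IsRootlessUnimodular leechGram where
  isSymm := leechGram_isSymm
  exists_inv := ⟨_, leechGram_mul_inverse⟩
  even := even_dotProduct_mulVec leechGram_isSymm fun i =>
    (even_iff_two_dvd).2 (leechBasis_spec i).2.2.2
  four_le x hx := by
    have hform := leechGram_form x
    have hne := leech_coord_norm_ne x
    have hnonneg : 0 ≤ ∑ j, (x ᵥ* leechBasis) j ^ 2 := Finset.sum_nonneg fun j _ => sq_nonneg _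
    obtain ⟨t, ht⟩ := even_dotProduct_mulVec leechGram_isSymm (fun i =>
      (even_iff_two_dvd).2 (leechBasis_spec i).2.2.2) x
    have hpos : ∑ j, (x ᵥ* leechBasis) j ^ 2 ≠ 0 := by
      intro h0
      have h1 : x ᵥ* leechBasis = 0 := by
        ext j
        have := (Finset.sum_eq_zero_iff_of_nonneg fun j _ => sq_nonneg _).1 h0 j (Finset.mem_univ j)
        exact pow_eq_zero_iff (two_ne_zero) |>.1 this
      have h2 : leechGram *ᵥ x = 0 := by
        apply smul_right_injective _ (show (8 : ℤ) ≠ 0 by norm_num)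
        simp only
        rw [← smul_mulVec, ← leechBasis_mul_transpose, ← mulVec_mulVec, mulVec_transpose, h1]
        simp
      apply hx
      have h3 := congrArg (fun y => decodeMatrix leechInverseRows *ᵥ y) h2
      simpa [mulVec_mulVec, mul_eq_one_comm.1 leechGram_mul_inverse] using h3
    rw [hform] at hne hnonneg hpos
    omega
  exists_pair := by
    refine ⟨Pi.single 0 1, Pi.single 14 1, ?_⟩
    simp only [Matrix.mulVec_single_one, single_one_dotProduct]
    decide +kernel

end Leech

/-! ### Frames with a prescribed binary code -/

section Niemeier

/-- The matrix `G` with rows given by the digits of the words in `a`. -/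
def glueMatrix (a : List ℕ) : Matrix (Fin 12) (Fin 12) ℤ :=
  Matrix.of fun b c => if (a.getD b 0).testBit c then 1 else 0

/-- The splitting of the `24` indices into the first and the last `12`. -/
def splitEquiv : Fin 12 ⊕ Fin 12 ≃ Fin 24 := finSumFinEquiv

theorem splitEquiv_inl_val (b : Fin 12) : ((splitEquiv (Sum.inl b) : Fin 24) : ℕ) = b := rfl

theorem splitEquiv_inr_val (c : Fin 12) : ((splitEquiv (Sum.inr c) : Fin 24) : ℕ) = 12 + c := rfl

/-- The block matrix `(2, -G; 0, 1)`. A frame `F` in which the rows of `(1 | G)` give vectors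
divisible by `2` is stored through the vectors `V` with `F = (2, -G; 0, 1) V`: the halves of the
twelve sums, and the last twelve frame vectors. -/
def combinationMatrix (a : List ℕ) : Matrix (Fin 24) (Fin 24) ℤ :=
  (fromBlocks (diagonal fun _ => 2) (-glueMatrix a) 0 1).submatrix splitEquiv.symm splitEquiv.symm

/-- The block matrix `(1, G; 0, 2)`, twice the inverse of `combinationMatrix a`. -/
def pairingMatrix (a : List ℕ) : Matrix (Fin 24) (Fin 24) ℤ :=
  (fromBlocks 1 (glueMatrix a) 0 (diagonal fun _ => 2)).submatrix splitEquiv.symm splitEquiv.symm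

theorem combinationMatrix_mul_pairingMatrix (a : List ℕ) :
    combinationMatrix a * pairingMatrix a = (2 : ℤ) • (1 : Matrix (Fin 24) (Fin 24) ℤ) := by
  rw [combinationMatrix, pairingMatrix, submatrix_mul_equiv, fromBlocks_multiply]
  ext i j
  rw [submatrix_apply, Matrix.smul_apply]
  obtain ⟨i, rfl⟩ := splitEquiv.surjective i
  obtain ⟨j, rfl⟩ := splitEquiv.surjective j
  rcases i with i | i <;> rcases j with j | j
  · simp [Matrix.one_apply, diagonal_apply]
  · simp [mul_comm]
  · simp
  · simp [Matrix.one_apply, diagonal_apply]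

/-- The entries of `combinationMatrix`, as a function on `ℕ`. -/
def combinationEntry (a : List ℕ) (i j : ℕ) : ℤ :=
  if i < 12 then
    if j < 12 then if i = j then 2 else 0 else if (a.getD i 0).testBit (j - 12) then -1 else 0
  else if i = j then 1 else 0

/-- The entries of `pairingMatrix`, as a function on `ℕ`. -/
def pairingEntry (a : List ℕ) (i j : ℕ) : ℤ :=
  if i < 12 then
    if j < 12 then if i = j then 1 else 0 else if (a.getD i 0).testBit (j - 12) then 1 else 0
  else if i = j then 2 else 0

theorem combinationMatrix_apply (a : List ℕ) (i j : Fin 24) :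
    combinationMatrix a i j = combinationEntry a i j := by
  obtain ⟨i, rfl⟩ := splitEquiv.surjective i
  obtain ⟨j, rfl⟩ := splitEquiv.surjective j
  rcases i with i | i <;> rcases j with j | j
  all_goals
    simp only [combinationMatrix, combinationEntry, submatrix_apply, Equiv.symm_apply_apply,
      fromBlocks_apply₁₁, fromBlocks_apply₁₂, fromBlocks_apply₂₁, fromBlocks_apply₂₂,
      splitEquiv_inl_val, splitEquiv_inr_val, glueMatrix, Matrix.one_apply, diagonal_apply,
      Matrix.neg_apply, Matrix.zero_apply, Matrix.of_apply, Fin.ext_iff, add_tsub_cancel_left]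
    have hi := i.isLt
    have hj := j.isLt
    split_ifs <;> omega

theorem pairingMatrix_apply (a : List ℕ) (i j : Fin 24) :
    pairingMatrix a i j = pairingEntry a i j := by
  obtain ⟨i, rfl⟩ := splitEquiv.surjective i
  obtain ⟨j, rfl⟩ := splitEquiv.surjective j
  rcases i with i | i <;> rcases j with j | j
  all_goals
    simp only [pairingMatrix, pairingEntry, submatrix_apply, Equiv.symm_apply_apply,
      fromBlocks_apply₁₁, fromBlocks_apply₁₂, fromBlocks_apply₂₁, fromBlocks_apply₂₂,
      splitEquiv_inl_val, splitEquiv_inr_val, glueMatrix, Matrix.one_apply, diagonal_apply,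
      Matrix.zero_apply, Matrix.of_apply, Fin.ext_iff, add_tsub_cancel_left]
    have hi := i.isLt
    have hj := j.isLt
    split_ifs <;> omega

/-- The Boolean test that the vectors `V` stored in `r` give a frame of norm `2 * p`. With `A` the
Gram matrix, `D = combinationMatrix a` and `T = pairingMatrix a`, it asserts `V A Vᵀ Dᵀ = p • T`,
which is equivalent to `D V A Vᵀ Dᵀ = 2 p • 1`, on the vector of powers. -/
def frameCheck (p : ℤ) (a r : List ℕ) : Bool :=
  allBelow (fun i => mulVecFun (entry r) (mulVecFun (entry leechGramRows)
    (mulVecFun (fun i j => entry r j i) (mulVecFun (fun i j => combinationEntry a j i)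
      packedPower))) i == p * mulVecFun (pairingEntry a) packedPower i) 24

theorem abs_combinationEntry_le (a : List ℕ) (i j : ℕ) : |combinationEntry a i j| ≤ 2 := by
  unfold combinationEntry; split_ifs <;> norm_num

theorem abs_pairingEntry_le (a : List ℕ) (i j : ℕ) : |pairingEntry a i j| ≤ 2 := by
  unfold pairingEntry; split_ifs <;> norm_num

theorem mul_transpose_combinationMatrix_of_frameCheck {p : ℕ} {a r : List ℕ} (hp : p ≤ 19)
    (h : frameCheck p a r = true) :
    decodeMatrix r * leechGram * (decodeMatrix r)ᵀ * (combinationMatrix a)ᵀ =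
      (p : ℤ) • pairingMatrix a := by
  apply Matrix.eq_of_mulVec_powerVector
  · intro i j
    have h1 := Matrix.abs_mul_apply_le (decodeMatrix_bound r) (decodeMatrix_bound leechGramRows)
    have h2 := Matrix.abs_mul_apply_le h1 (N := (decodeMatrix r)ᵀ)
      (fun i j => decodeMatrix_bound r j i)
    have h3 := Matrix.abs_mul_apply_le h2 (N := (combinationMatrix a)ᵀ) (b := 2) (fun i j => by
      rw [transpose_apply, combinationMatrix_apply]; exact abs_combinationEntry_le a j i)
    exact (h3 i j).trans_lt (by norm_num)
  · intro i j
    rw [Matrix.smul_apply, smul_eq_mul, abs_mul, pairingMatrix_apply]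
    have := abs_pairingEntry_le a i j
    have h0 : |(p : ℤ)| ≤ 19 := by rw [abs_of_nonneg (by positivity)]; exact_mod_cast hp
    nlinarith [abs_nonneg (p : ℤ), abs_nonneg (pairingEntry a i j)]
  · have hD : (Matrix.of fun i j : Fin 24 => combinationEntry a j i) = (combinationMatrix a)ᵀ := by
      ext i j; rw [transpose_apply, combinationMatrix_apply]; rfl
    have hT : (Matrix.of fun i j : Fin 24 => pairingEntry a i j) = pairingMatrix a := by
      ext i j; rw [pairingMatrix_apply]; rfl
    rw [← Matrix.mulVec_mulVec, ← Matrix.mulVec_mulVec, ← Matrix.mulVec_mulVec, smul_mulVec]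
    ext i
    have h := allBelow_iff.1 h i
    rw [beq_iff_eq] at h
    have h1 := congrFun (mulVecFun_eq (entry r) (mulVecFun (entry leechGramRows)
      (mulVecFun (fun i j => entry r j i) (mulVecFun (fun i j => combinationEntry a j i)
      packedPower)))) i
    have h2 := congrFun (mulVecFun_eq (pairingEntry a) packedPower) i
    rw [mulVecFun_eq (entry leechGramRows), mulVecFun_eq (fun i j => entry r j i),
      mulVecFun_eq (fun i j => combinationEntry a j i), hD] at h1
    rw [hT] at h2
    rw [h1, h2] at h
    exact h

theorem isFrame_of_frameCheck {p : ℕ} {a r : List ℕ} (hp : p ≤ 19) (h : frameCheck p a r = true) :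
    IsFrame leechGram (combinationMatrix a * decodeMatrix r) p := by
  have h1 := mul_transpose_combinationMatrix_of_frameCheck hp h
  unfold IsFrame
  rw [transpose_mul]
  have : combinationMatrix a * decodeMatrix r * leechGram *
      ((decodeMatrix r)ᵀ * (combinationMatrix a)ᵀ) = combinationMatrix a *
      (decodeMatrix r * leechGram * (decodeMatrix r)ᵀ * (combinationMatrix a)ᵀ) := by
    simp only [Matrix.mul_assoc]
  rw [this, h1, Matrix.mul_smul, combinationMatrix_mul_pairingMatrix, smul_smul, mul_comm]

theorem sum_fin_split {M : Type*} [AddCommMonoid M] (f : Fin 24 → M) :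
    ∑ i, f i = ∑ b, f (splitEquiv (Sum.inl b)) + ∑ c, f (splitEquiv (Sum.inr c)) := by
  rw [← Equiv.sum_comp splitEquiv, Fintype.sum_sum_type]

theorem vecMul_combinationMatrix_inl (a : List ℕ) (x : Fin 24 → ℤ) (b : Fin 12) :
    (x ᵥ* combinationMatrix a) (splitEquiv (Sum.inl b)) = 2 * x (splitEquiv (Sum.inl b)) := by
  rw [vecMul, dotProduct, sum_fin_split]
  simp [combinationMatrix, diagonal_apply, mul_comm]

theorem vecMul_combinationMatrix_inr (a : List ℕ) (x : Fin 24 → ℤ) (c : Fin 12) :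
    (x ᵥ* combinationMatrix a) (splitEquiv (Sum.inr c)) = x (splitEquiv (Sum.inr c)) -
      ∑ b, x (splitEquiv (Sum.inl b)) * glueMatrix a b c := by
  rw [vecMul, dotProduct, sum_fin_split]
  simp [combinationMatrix, Matrix.one_apply]
  ring

theorem syndrome_columnWord (a : List ℕ) (x : Fin 24 → ℤ) (c : Fin 12) :
    syndrome (fun i => bitVector (columnWord a i)) x c =
      (((x ᵥ* combinationMatrix a) (splitEquiv (Sum.inr c)) : ℤ) : ZMod 2) := by
  have h2 : ∀ y z : ZMod 2, y + z = z - y := by decide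
  rw [vecMul_combinationMatrix_inr, syndrome, Finset.sum_apply, sum_fin_split, Int.cast_sub,
    Int.cast_sum, h2]
  congr 1
  · rw [Finset.sum_eq_single c]
    · simp [splitEquiv_inr_val, columnWord, bitVector]
    · intro d _ hd
      simp [splitEquiv_inr_val, columnWord, bitVector, Fin.val_injective.ne hd]
    · simp
  · refine Finset.sum_congr rfl fun b _ => ?_
    simp [splitEquiv_inl_val, columnWord, bitVector, glueMatrix]

/-- If the inner products with the last twelve frame vectors are independent modulo `2`, no
combinations of the frame vectors are divisible by `2` except those forced by the code. The
witnesses `u c` are lattice vectors dual to the last twelve frame vectors modulo `2`. -/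
theorem halvesAre_of_witness {a r : List ℕ} (u : Fin 12 → Fin 24 → ℤ)
    (hu : ∀ c d, (((decodeMatrix r * leechGram) *ᵥ u c) (splitEquiv (Sum.inr d)) : ZMod 2) =
      if c = d then 1 else 0) :
    HalvesAre (combinationMatrix a * decodeMatrix r) fun i => bitVector (columnWord a i) := by
  intro x
  rw [← vecMul_vecMul]
  set y := x ᵥ* combinationMatrix a with hy
  have hy1 : ∀ b, y (splitEquiv (Sum.inl b)) = 2 * x (splitEquiv (Sum.inl b)) :=
    vecMul_combinationMatrix_inl a x
  have hs : syndrome (fun i => bitVector (columnWord a i)) x = 0 ↔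
      ∀ c, (y (splitEquiv (Sum.inr c)) : ZMod 2) = 0 := by
    rw [funext_iff]
    exact forall_congr' fun c => by rw [syndrome_columnWord]; rfl
  rw [hs]
  constructor
  · rintro ⟨v, hv⟩ c
    have h1 : y ⬝ᵥ ((decodeMatrix r * leechGram) *ᵥ u c) = 2 * (v ⬝ᵥ leechGram *ᵥ u c) := by
      rw [← mulVec_mulVec, dotProduct_mulVec, hv, smul_dotProduct, smul_eq_mul]
    have h2 := congrArg (Int.cast : ℤ → ZMod 2) h1
    rw [dotProduct, sum_fin_split] at h2
    push_cast at h2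
    simp only [hy1, hu] at h2
    push_cast at h2
    rw [show (2 : ZMod 2) = 0 from rfl] at h2
    simpa using h2
  · intro h
    have h1 : ∀ i, ∃ t, y i = 2 * t := by
      intro i
      obtain ⟨i, rfl⟩ := splitEquiv.surjective i
      rcases i with b | c
      · exact ⟨_, hy1 b⟩
      · exact (ZMod.intCast_zmod_eq_zero_iff_dvd _ 2).1 (h c)
    choose t ht using h1
    refine ⟨t ᵥ* decodeMatrix r, ?_⟩
    rw [← smul_vecMul]
    congr 1
    ext i; simp [ht]

/-- The Boolean test that `Gᵀ G = 1` modulo `2`, that is, `(1 | G)` generates a self-dual code. -/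
def selfDualCheck (a : List ℕ) : Bool :=
  allBelow (fun c => allBelow (fun d => intSum (fun b =>
    bif (a.getD b 0).testBit c && (a.getD b 0).testBit d then 1 else 0) 12 % 2 ==
      if c = d then 1 else 0) 12) 12

/-- For odd `p` the dual vectors are found among the integral combinations of the halves: the inner
products of the halves with the last frame vectors form the matrix `p • G`, and `Gᵀ G = 1`
modulo `2`. -/
theorem halvesAre_of_odd {p : ℕ} {a r : List ℕ} (hp : p ≤ 19) (hodd : Odd p)
    (ha : selfDualCheck a = true) (h : frameCheck p a r = true) :
    HalvesAre (combinationMatrix a * decodeMatrix r) fun i => bitVector (columnWord a i) := by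
  have h1 := mul_transpose_combinationMatrix_of_frameCheck hp h
  have hsym : (decodeMatrix r * leechGram * (decodeMatrix r)ᵀ).IsSymm := by
    unfold Matrix.IsSymm
    rw [transpose_mul, transpose_mul, transpose_transpose, leechGram_isSymm.eq, Matrix.mul_assoc]
  have h2 : ∀ b c, (decodeMatrix r * leechGram * (decodeMatrix r)ᵀ) (splitEquiv (Sum.inr c))
      (splitEquiv (Sum.inl b)) = p * glueMatrix a b c := by
    intro b c
    rw [← hsym.apply]
    have h3 := congrFun (congrFun h1 (splitEquiv (Sum.inl b))) (splitEquiv (Sum.inr c))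
    rw [Matrix.mul_apply, sum_fin_split] at h3
    simpa [combinationMatrix, pairingMatrix, Matrix.one_apply] using h3
  refine halvesAre_of_witness (fun c => (decodeMatrix r)ᵀ *ᵥ fun i =>
    Sum.elim (fun b => glueMatrix a b c) 0 (splitEquiv.symm i)) fun c d => ?_
  rw [mulVec_mulVec, mulVec, dotProduct, sum_fin_split]
  simp only [h2, Equiv.symm_apply_apply, Sum.elim_inl, Sum.elim_inr, Pi.zero_apply, mul_zero,
    Finset.sum_const_zero, add_zero]
  have h4 := allBelow_iff.1 (allBelow_iff.1 ha c) d
  rw [beq_iff_eq, intSum_eq] at h4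
  have h5 : ∑ b : Fin 12, (p : ℤ) * glueMatrix a b d * glueMatrix a b c =
      p * ∑ b : Fin 12, bif (a.getD b 0).testBit c && (a.getD b 0).testBit d then 1 else 0 := by
    rw [Finset.mul_sum]
    refine Finset.sum_congr rfl fun b _ => ?_
    simp only [glueMatrix, Matrix.of_apply]
    cases (a.getD b 0).testBit c <;> cases (a.getD b 0).testBit d <;> simp
  have h6 : ((p : ℤ) : ZMod 2) = 1 := by
    obtain ⟨t, rfl⟩ := hodd
    push_cast
    rw [show (2 : ZMod 2) = 0 from rfl]; simp
  rw [h5, Int.cast_mul, h6, one_mul]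
  generalize (∑ b : Fin 12, bif (a.getD b 0).testBit c && (a.getD b 0).testBit d then
    (1 : ℤ) else 0) = S at h4
  have h7 := (ZMod.intCast_eq_intCast_iff_dvd_sub (if (c : ℕ) = d then 1 else 0) S 2).2
    (by push_cast; omega)
  rw [← h7]
  simp only [Fin.ext_iff]
  split_ifs <;> simp

/-- The Boolean test that the vectors with coordinates given by the digits of the words in `w` are
dual modulo `2` to the last twelve frame vectors. -/
def witnessCheck (r w : List ℕ) : Bool :=
  allBelow (fun c => allBelow (fun d => mulVecFun (entry r) (mulVecFun (entry leechGramRows)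
    fun j => bif (w.getD c 0).testBit j then 1 else 0) (d + 12) % 2 ==
      if c = d then 1 else 0) 12) 12

theorem halvesAre_of_witnessCheck {a r w : List ℕ} (h : witnessCheck r w = true) :
    HalvesAre (combinationMatrix a * decodeMatrix r) fun i => bitVector (columnWord a i) := by
  refine halvesAre_of_witness
    (fun c j => bif (w.getD c 0).testBit j then 1 else 0) fun c d => ?_
  have h1 := allBelow_iff.1 (allBelow_iff.1 h c) d
  rw [beq_iff_eq] at h1
  have h2 := congrFun (mulVecFun_eq (entry r) (mulVecFun (entry leechGramRows)
    fun j => bif (w.getD c 0).testBit j then 1 else 0)) (splitEquiv (Sum.inr d))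
  rw [mulVecFun_eq (entry leechGramRows)] at h2
  rw [← mulVec_mulVec]
  have h3 : ((splitEquiv (Sum.inr d) : Fin 24) : ℕ) = d + 12 := by rw [splitEquiv_inr_val, add_comm]
  simp only [h3] at h2
  rw [h2] at h1
  change (((decodeMatrix r *ᵥ leechGram *ᵥ _) (splitEquiv (Sum.inr d)) : ℤ) % 2 = _) at h1
  generalize (decodeMatrix r *ᵥ leechGram *ᵥ _) (splitEquiv (Sum.inr d)) = S at h1 ⊢
  have h7 := (ZMod.intCast_eq_intCast_iff_dvd_sub (if (c : ℕ) = d then 1 else 0) S 2).2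
    (by push_cast; omega)
  rw [← h7]
  simp only [Fin.ext_iff]
  split_ifs <;> simp

end Niemeier

/-! ### Frames of prime index -/

section FrameData

/-- Frames of norm `4` for the nine binary codes, stored as in `combinationMatrix`. -/
def frameRowsTwo : List (List ℕ) :=
  [[0x8424f84a2f841ee83a108420f841f1, 0x83e4e8c2118420f841d083e0f83df1, 0x8422f8b9f08ba31741f0841f083df1,
    0x7be4f946117be0f83e0f7c62f7bdd1, 0x8424e8460f8be2f73a108c1d084230, 0x8c22f8be0f8be107c1f08420e8bdd0,
    0x7ba2e8c21283e107bdef842107be12, 0x842108460f8be307ba30845f083e11, 0x7be2f9c21193e4e8bdee7c20f83df0,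
    0x8422f7c610842107be118c61184231, 0x8424e8c22f83e0f7c1f08420f8be10, 0x8424e8422f8c1ef73df28c1f08c231,
    0x846307c6107c5f083e118421184611, 0x8c2308460f842107be308460f8c20f, 0x846118c20f83e108c20f7c20f841d0,
    0x84210846118422f8be2f7c6317c60f, 0x7be0f842108be2f842108bdf083e31, 0x8422f8422f841f073e118c61184231,
    0x7ba2f8c231841ef841f083e2f7bdf1, 0x8422f8be0f8be2f7c5f083dee8c20e, 0x841f083df18c231842108461184230,
    0x7be2f8be117be10845cf83e0f83df1, 0x83e0f8c2118be307be0f841f07be11, 0x8c6107c60f845f0842128c2108be11],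
   [0x9c9f27bdce8c632842517ca31941ee, 0x945f073dee8c212742528c5f18422f, 0x846118c1ef846308c6317c62f93e0e,
    0x9462f8be0d942107c1f08c1ee93def, 0x946118420e849f183e107c60f941ef, 0x8c21183e0f8421173e5074a30845ee,
    0x94611841ef8461183e517ca518bdd0, 0x941f07b5ee93e32746318c1f08be0f, 0x8c2107c20e845f07c6328c22f8be0f,
    0x8421083e0f83e117c610842108420f, 0x8c1f18be0f93e317be2f7c61083def, 0x8c1f07c22f8c2107ba2f846117c610,
    0x8c1f07bdef8c23184a118bdef8be2f, 0x8421183df084231842107c2108bdf0, 0x945f07be0f942117be318c61284211,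
    0x8c22f8c22f8c1f07bdef841ef8c210, 0x7be0f8ba108ba307c5ef83def7c20f, 0x8422f8c230845ef7c211846308c230,
    0x846308460f7c5ef8c2118420f8c1f0, 0x8c9f2845f07c6118be5074a31845ef, 0x8c210842108461083e0f7c630845ef,
    0x842308c62f8420f842108422f8be0f, 0x8c2107bdf07c1f27c6318463184210, 0x83df07c22f8be1073e308c1f07c230],
   [0x84611841f07c5f18c211846318bdf2, 0x846308c5f0846108b9ef845f18c212, 0x849f2841b184a319c211846128c1f2,
    0x7ca128c5cf8460f9c1f0841ef8c1d1, 0x7be108bdf18ba508420f83df07bdf1, 0x7423194a117c60e9be0f7c630841f2,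
    0x74230945f27c60f9bdce7c210841f2, 0x841f1841f184610942108423183df2, 0x8463194610845ef93e107c6308c1d2,
    0x746128c5d174610a45f07be1083dd2, 0x8462f84610845ef83e118c61184631, 0x7c5d27c5b1846319c2318c2127bdf3,
    0x841f18c1f184610946108423083df1, 0x84a12845ef7c610942317c6308c1d0, 0x7c1f0841f1842308c20f846117c630,
    0x842308c22f841ef83def8420f8c1f1, 0x841f17bdd08be51846318bdf083e10, 0x7be10846117be1083e2f7c210741f1,
    0x8ca117c1ee8421184210841d08c60f, 0x742118c6117c20f941ef7be0f7c1f0, 0x7c230942118422f8c1ef7c2108c210,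
    0x841f07c1f1846118c2118c21283e32, 0x8422f84630841ef842118c21084231, 0x8c62f8420f8c5f07bdf18c1f08c211],
   [0x946307c20f7c1d273e317c610845d0, 0x842518c5f07c5f08c2118422f8bdd1, 0x842318c1d07c2118ca1183e0e8b9d0,
    0x83e31845f1745f18c6317424f83dd0, 0x8421183e107c1f1846107c230845ef, 0x9463083def841f2742317ca108c5ef,
    0x842118420f83e308422f7c20f845ee, 0x846328c5d17461194230746308c1d0, 0x8c6518c1d07c6118c6117c22f93dcf,
    0x7be11849f274610946307c2507c20f, 0x7c6318460f741f0842107c20f845ef, 0x9423083e0f83df26c2317c60f8c1ef,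
    0x8421074a307c5f083e31842117c630, 0x8be4e8be2f8c1f0741d08bdee8be10, 0x94a318460f849f083a317ca31945f0,
    0x841f17be0f83e117c2307c2107c5ef, 0x83df08421184211846108423083e30, 0x742318c9f17460f942107c22f83df0,
    0x7be10841f08be4f8c6108b9ef83e10, 0x842108bdf183e31846107c21083df0, 0x841f17c1f083e1184230841f07c1f1,
    0x8c6308420f7c1f17c210846108c60f, 0x84210841f17c6108c6107c6308460f, 0x842118c2117c5f0946107c250841f0],
   [0x845f17c1ef8421184231841f084210, 0x846117c20e842107c211841cf8c62f, 0x7c5f273dee83e1184a128b9d084210,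
    0x8c2118420f8c23083e0f7c1ef8c1ef, 0x841d273dd08423284631841f184230, 0x842107bdef83e317ca118bdef8be2f,
    0x7c1f16c20e83df17c612939d07c231, 0x7c5f27c5f07c230946307c2108460f, 0x845f17c20f7c1f184210841f084610,
    0x841d27420f83e317c2507c1f07c62e, 0x7bdf07bdf08ba5084a108b9cf7c22f, 0x845f17c1f07c5f18c6118421084210,
    0x845f183df07c2118c6107c210841f0, 0x845f17c1d083e518c630841f08420f, 0x8c5f07460f845f17be318c5f184650,
    0x846118420f8421084210842108c210, 0x73df1846118422f9461083e107c230, 0x842308464f8420f7ba0f7c1ef8460f,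
    0x8421083e2f83df17c1ef841f084610, 0x941d27bdf08c232842507c631841ef, 0x846117c1ef842118421183df0841f0,
    0x83e2f7be0f83e10746118bdef8422f, 0x842308c1f084210841f0841ef8bdf1, 0x842107c210841f0846128be1083e11],
   [0x7423194a10745ee945f18422e8b9f1, 0x73e10946127c20f941ee7c22f7bdf1, 0x73e3094a317c20e8c1ef7c20e8420f,
    0x742308ce307c20e8bdef841ef84230, 0x741f18c1f17be30945ee7bdef7c1f0, 0x73e2f94a517c5ee8c1cf8420f84250,
    0x73e109463183e2e8be0e7c20f7c210, 0x73e0f8ca317c20e8c1ef8420f7c230, 0x746128c610745ef941f07c22f841d1,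
    0x73e2f9423083e0e841ce83dee84210, 0x73e109463183e2e8c1ee7c20f7c20f, 0x742118ca307c20e93e0e7c20f7c5f0,
    0x842118420f842108461183e0e8bdef, 0x841f07c2107c1f17c231846317c211, 0x73a2f8c63183e2e8421083e0f7be30,
    0x83e2f8c2308420f7c1ef8420f8c22f, 0x846308c2107c9f08c5f18463094230, 0x8421083e1083e107c210842107c1f0,
    0x742108c6317c20f8bdee7c2107c610, 0x84210846117c5f08c2107c63084210, 0x73df18c1f183e2f9460f83e0f7bdf1,
    0x84a3184a0f7c5ef8be11842108c1f1, 0x8461184a0f8460f8be30846108460f, 0x841f083df08be31845f08bdd083e11],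
   [0x841f1841f1842308c6307c2307c1ef, 0x841f18c2108c2108c2108421083df1, 0x7be108423083e10841ee7bdef7c60f,
    0x8c1f083e11842118420f7c6317c5f0, 0x7be11842107c2108c5ef7be0e841ef, 0x84211942108c22f9420f7c22f8bdd0,
    0x84210842308420f83e0f7c2107c5f0, 0x7be1084210842108c5cf8b9ef83e11, 0x83df17bdf08be318420f83df07c1f0,
    0x83df08be118be508420e7c2107c20f, 0x84631946108460f93def7c20f8c1d0, 0x7c211946118460f93e0f7c630841f1,
    0x7c1f1845f18424f9422f7c2107c20f, 0x83e1083e1083e117c20f7c20f7c1ef, 0x8c2108be108c2108c5f083e0f8bdf0,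
    0x83e0f8be508be0f7bdee842107c610, 0x83e108c6308c20f83e308463083e11, 0x83e1083df08c230845f08bdef8be10,
    0x8c1f083df08c23184610842108420f, 0x7c2118c6118462f93e0f7c230841f0, 0x846118c6107c5f08be0f7c610845f0,
    0x84210842117c1f0842107c2307c1d1, 0x8c5f17c20f8c21183e0f841f184610, 0x73e308c631745ef945cf7be2f84210],
   [0x8c1f17be0f8be317c23084210841ef, 0x8c9f1745f07c9f18c231846118ca2f, 0x84a1274e106cdd093e317c6318ca10,
    0x8c21083e2f8be307c20f7c1ef8c60e, 0x8ca3184a1074dd093e107c630945f0, 0x94df2749ef7cdf193e318461194610,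
    0x841f17be1083e318420f7bdf07c5ef, 0x84a127ce1074def9be307c6308ca0f, 0x8ca117ca1074dd093e107c6308c9f0,
    0x8bdf07be118be317c230842117c210, 0x8c9f27ca107cdf093e307c6318ca0f, 0x8ca1174e2f7cdd08ba31846118ca30,
    0x8be0f83e308c2107c6118c2308be30, 0x842318ca307c9ef93def7c22f8c1f0, 0x7c1f17c5f0842308c6318bdf083e30,
    0x8c1f173df0842127c231842117c1f0, 0x841d1742108421184230842117c630, 0x84230846307c5ef83e307c63084a0f,
    0x8421083e108be30841ef83dd084610, 0x8c6107c1f08461184211842118c210, 0x8c6108c2108c61083e10846108c210,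
    0x842108422f83e307be0e7c1ef8460e, 0x846107c6107c5f08be108461184611, 0x8ca11841f0745f18c6107c6308c5ef],
   [0x842308c6307c5cf8c1f08422f8c1f1, 0x842308c62f7c1ef842108422e8bdf0, 0x8c6308462f7c5d0842118422f8c1f0,
    0x8c2508ca107c6108bdef7c20e93df0, 0x83e2f842307c1d07c5f18be2f83e11, 0x842117c62f7c1f08421083e0f841f0,
    0x8c2108420f841f17c6118c20f8be10, 0x84211846107c5f08c2108422f841f0, 0x846117c5ef7c5f08c6128be0f8bdf1,
    0x8c21083e0f841f1845f08be0f8bdf1, 0x8423194a108422f93dee7be0e8bdd0, 0x842308c2107c1f0845f083e0e8bdf0,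
    0x846117c5d0846308c2328c2118be11, 0x8424f9462f8420e83def8420e8bdf0, 0x83e108c2108c230846108420f8be2f,
    0x8423084210745d1845f18422f8bdf1, 0x841f083df08be318c5ef8bdf083e11, 0x8c6118c1f17c6118c20f746308c1ef,
    0x8c6308420f84210842107c20f8c5ee, 0x84211846108421083a2f7c6107c5f0, 0x7be108c6127c20f9420f7c2307c1f1,
    0x83e2f84230841f07c1f18be1083e31, 0x842108462f841ef842108be0f84210, 0x846117c62f7c21083e0f7c1f084a0f]]

/-- Frames of norm `6` for the nine binary codes, stored as in `combinationMatrix`. -/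
def frameRowsThree : List (List ℕ) :=
  [[0x849f17c1f0846318be3074a128ca2f, 0x841f183a0f93a5083e2f7c1f1845f0, 0x7c20f7c23083a1073a30841d274631,
    0x7c2107ca507c1ef83a507c6327ca50, 0x6be2e8c2318be2d83df08bdf17c252, 0x8c5d1842118be5183a6e6ce137ce2e,
    0x7c1f07461183e2f83a507c5f274e30, 0x84a0f7c20f83e107c211841d184a4f, 0x7c610846507c20f8360e746127ce10,
    0x84a118460f8be0f83a517c5f1845f1, 0x7c24f9424f8be0f7b9ce7c1d08c630, 0x7c611841f183e508be30746127c5f0,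
    0x845f173dd08c231842328c1f284211, 0x7c1f0841f27c2108c6307c6317c630, 0x8c5f07420f8421273e30845f28464f,
    0x846308c62f845ef8b9ef842108c1f2, 0x8424e8c230845ef7bdd0846108c630, 0x742508ca107c20e8c21183e0f83e10,
    0x841f27c6117c63093e4f6c6517c9ee, 0x7be2f93e3183e2f841ee7c21084210, 0x845f07c61083e1083e30841f1745f1,
    0x8be2f8424f8bdf06ba30845f084630, 0x7c1f07c22f83e0f842108bdf07c630, 0x8c5f18b9ef93a518460f7c1ef8c1ee],
   [0x7c2318c9f2751f0a41f07c2508be11, 0x8cdd27c5f084e1293e307ca138ca4f, 0x7c611849f084a30942118c21093e50,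
    0x7c6119c1d184650a45cd7c20f93e0f, 0x8c62f8c21184df18bdcf84a3294651, 0x849f27c9d17ce129be3184a3384212,
    0x7425094e317cdee9b9ef7c6308c231, 0x84e11845d17ce1193e107ca128ca2f, 0x84610845d184a3194611846318be4f,
    0x7c1d27c5d1842519422f7c1f07c20f, 0x84611941f08c6118bdef845f08c211, 0x7c21193df27c611945ef74651841f0,
    0x8c610841f17c6118c6107c2308c20f, 0x7c230845f18460f8be118c21184212, 0x7c631942107c60f941ef7420f8c5ef,
    0x9422f93e0f942307bdee845ef9420f, 0x845b27bdd08be528c22f841f17c1f0, 0x84210841f08c250846328c2108ba30,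
    0x7c22e8422f8c20f7c1d093dd08c270, 0x8421084a507c9d083a108463184232, 0x7c2118c1f17c6109c5ef7c25083dd1,
    0x73a108c61183e2f8c60f83e0e7be2f, 0x8c6117ca1084a108ba307c6118460f, 0x8c5f083df1845f28461184a3284630],
   [0x8c20f7ba0f94211741f1941f28c251, 0x845f2745f184a3193e317c63384611, 0x9cdf26bdcf7c9f47c23384a1394611,
    0x8be1073e317c5f273e317ca537ca30, 0x8c9f17460f845f183e31845f184a30, 0x8c5f16c22f7c5d373e31846137ca31,
    0x7c6117c1f17ca118bdf07c61284a11, 0x8c22f7be10849f17c5f28c21194250, 0x9ca117464e84dd2732307ce138ce30,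
    0x8c5f17c230849f17be527ce538ca50, 0x84211842107c5f18c1f08423083dd2, 0x949f2741f174dd38be317ce548ca12,
    0x946107c2107c9d27c23284a328c630, 0x8bdef7be308be116be308c6127c251, 0x7bdf17bdd17be328ca1083e107bdf1,
    0x83e2f83e308c2107c1cf83df08462f, 0x8c630842107c5d1841f1842108c211, 0x8c61084630845f083a2f7ca3184a10,
    0x83df083e318be30842307c2317c210, 0x7c2308c211745f08421074a508460f, 0x849d2745ef846318c231841f18462f,
    0x8461183dd08c6308c6128c21193e11, 0x842118422f841f17be108421083df1, 0x8c6117c6107c9f08ba107c631845d1],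
   [0x8c22f8c22f7c20f83e0d7460e8ca0d, 0x942109424f8c60f83a0d74a2e8c9ed, 0x83e4f9c64f8c22c8bded7c20c8c5ed,
    0x83a2e942327ca0e941cd7464e8c60e, 0x83e2f93e1083e10841ce83dee83dd1, 0x8c63084a2e749ef8be0f7c60e9460e,
    0x845f183def84210945ef83def845d0, 0x83e4e9c26f841ed7bdcd7c20c8c5ee, 0x8426f9c66f7c9ed8b9cd7462d949ee,
    0x8ba2f936308c210849ae7be0d941ee, 0x8421083df07c211845ef841ef8460f, 0x8422f8ca4f7c5ee8b9ed7c5ee8ca2f,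
    0x83df08b9f283e518ca0e742308420e, 0x8421184a307c60f93e2f7c6508460f, 0x8461184630745f083a2f6ca30849ef,
    0x84610841d1745f1945f084210841f1, 0x7ba0f842318c20f841f08bdf084251, 0x8422f8be10842107c5f08460f8c62e,
    0x841f083e308c20f8c1ef83e107c5f0, 0x8424e8462f8420e7be108c1ef8c230, 0x8c20f8462f8c20f7be0f841ef8462e,
    0x842118be0e8be30841ee83dce8c1ef, 0x83e107c2107c5f1846118423083e10, 0x8be4f9c231845ef83def7c64f8bdd1],
   [0x73e118c5f183e2e9461083a0e7b9d1, 0x73e319c1f28c24e9bdcd7be1083dd1, 0x73df28c5d28c66f9c60f83e1083e2f,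
    0x7c6128462f7c20f8ba0e742107c9cf, 0x73df28bdf193e4f941ee7b9f07c1d0, 0x7c2108bdd1842318c5cf83df083df1,
    0x6be12941d28464fa4dd083a0f8ba10, 0x8423084610849f083df18c2118be12, 0x7be118c2118be4f8c20f7be0f83df0,
    0x7c2519c2108c22e8bdee7420f8c1cf, 0x8422f8be108c60f841d08bdf08c211, 0x84211841f08c2308c21083def83df0,
    0x83df1841f18be5083e4f7c2107bdf0, 0x7c22f846108460f83df18bdf083e12, 0x7c6318c1f08420f945f183e0f8bdd1,
    0x7be30841f17c211845f083e1083e10, 0x8c230942308c9ef83df08463094210, 0x8465194a2f7c60e93a0e7462f8c5cf,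
    0x7c211846108424f8c20f7c1ef8c62e, 0x846117c22e841f07be107c1f084a0f, 0x73df1845f183e2f8c6318be1073e11,
    0x7c1f08bdf284230945ee7c2117c610, 0x73df0842308ba2f83dee8b9d074211, 0x7be1084210846108c5f08be0f83e30],
   [0x8c5cf73e11845f17bdf0942137c632, 0x83dd083e11942308c1ef8bdf17c231, 0x949f07b5ee9c2317c1d093db194610,
    0x94df17be0e8c9f18bdd08c1f1945f1, 0x83df183e308c210841ef83e1084210, 0x8c9d16be0e9421083e1193dd284a11,
    0x8c1d173e108c2127be10841f27c611, 0x8c1cf7360f9be317c5d09b9d184231, 0x83dcf7be3183df273dee8c1f274651,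
    0x83e0f83e508c1f07c1d08b9f084231, 0x949d073a0e9c2117bdf093dd284611, 0x8bdd07ba2f93e11742108bdf07c210,
    0x8421083dd084231845f08bdf08be10, 0x83def7be1183e317c60f842107c64e, 0x8c9f16c1ef846127be328c5f384631,
    0x8461084210845f08c5f18be108c211, 0x7c1f17ca317c20f8ba4f7c63274a10, 0x8422e8464f841cf739ef8c1f07c631,
    0x83df083e2f9be307bdef8bdd084230, 0x845f0841f08c22f945f08bdf084210, 0x8bdf083e31841f17c210842317c211,
    0x846108c211749d18c1f07ca518c211, 0x9420f7ba0f8c1f1742118c210841f0, 0x7c2118be1083e2f8c1ee7be0f841d0],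
   [0x7c65094a116c9cf941f07c6508c1f1, 0x7ba0f93a1193a307c5cf8b9ef83a11, 0x741f27c5f1742109ca107ba0f7c1f0,
    0x8c6508c62f745b083def7c62f8c5d0, 0x73e308ca507c5ee941cf83a0e83e11, 0x83a0f93a318ba307c5ee7be0f83e0f,
    0x8463084a2f7c1ef83a0f841f0845f1, 0x7c2128c6107c60f9c6107be2e8bdd0, 0x7c5f38c5f17c630a420e74230841d0,
    0x7c2508ca10741ef83e108420f83df1, 0x7be0f93a108ba2f845ce839ee83df0, 0x7b9f08b9f093a50849ef8b9ef83a10,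
    0x742308ca307be0e83e30842107c211, 0x74211846117c20f941ef7be107c1f1, 0x8422f93e308be0f841cf83def8c210,
    0x8c2308462f841ef7ba0f841ef845f0, 0x83df183e108be317c61083e1083e0f, 0x8c6118c62f849f08be108463093e11,
    0x842308c1f1745d18c5f184250839d2, 0x7b9ef8ba1183a30849ee83e0f7be10, 0x7be108bdf08be30841ef83def83df1,
    0x8ca308c60f7c5f08c1ef7c60f945ef, 0x7c1d3845d27c250a464f742507c1cf, 0x7be4f8422f7c1ef849d18b5ed8be10],
   [0x845f17460f7be3083e4f7c1f07ca0e, 0x8c1d373dd0842338ca51842318420f, 0x83dd273dd17c2128ce52842507c20f,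
    0x7c2107c21073e108461083e107c210, 0x8bdd16b9d17c2147ce52842317c22f, 0x7bdb373dd27c2329ce517be51741f0,
    0x7c2307c22f7be0f7c21083def8460f, 0x7b9d1739d183e328ce108ba1074210, 0x83db2739d183e338ce3083e107420f,
    0x7c2308461073e0f8c60f7be0e841ef, 0x7bdd27b9d17be338ce307c2307c20f, 0x8c1f273df1745f38c630746517c9ef,
    0x845f07c1d17be318c630842117c210, 0x7b9ef7ba1183a117c9f0839ef74210, 0x8c5f27bdd07c6128c6317c6518c1d0,
    0x7c2117ca107c22f8be2f7c1ef8460f, 0x7c1f1846308420f9420f842307c610, 0x84230841f07c611845f08420f8c22e,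
    0x73e308c23173def845ef7be2f7c1f0, 0x8c2118c2117c2118425074a50841ef, 0x83df07be11842128420f842127c231,
    0x842107422e83e1073e318bdf07c210, 0x8c2107c210845f0842118be1084211, 0x7bdd17bdd093a7084a518bdf07be2f],
   [0x8c2108be108c6108c5d083e0f93df0, 0x8c20f7be10845f17c1f18c1f18c231, 0x8421083df0846108c5f183e0f8bdf0,
    0x8be0f8320e9ba11749b09b18d8b9f1, 0x8c5f183dd084611945f0842108bdd1, 0x8c6118420f8421083e107c1ef8c1d0,
    0x8ca308be0e845f0841d0841ef9c1f0, 0x949f27bdef849f28c2117c611945f0, 0x8c5f183df1846118c2107c6318c1f0,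
    0x9420f8360f93e11741f0841f08c1f0, 0x8bdf08b1efa3a507c9f0935ae8b9f0, 0x9461083def8c5f17c2128c61093df1,
    0x8c2308c2118461083e0f7c6308c20f, 0x7ba2e842517c1cf7c1f08be107c232, 0x8462f93e2f841f07c1cf841ef8c210,
    0x8c63083e0f7c5d1845d18420f941f0, 0x8bdef7b60f936316c60f83dcf7c60e, 0x8421083dd08be117c61293df0839f2,
    0x8421083df0842308c61083e0f841ef, 0x8c5f273def8461284632842118c210, 0x7ba0f93e1193e4f8c9cf8b9ee8ba30,
    0x83dd183df08be318c60f8be107b9f1, 0x8c5f1841f08c6308be307c6118c1f0, 0x7c2118462f8be2e83a0f83dcf7c5f0]]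

/-- Frames of norm `10` for the nine binary codes, stored as in `combinationMatrix`. -/
def frameRowsFive : List (List ℕ) :=
  [[0x935ce83e71ab6706364d845f17466e, 0x93e2d7be8f8bdf064210841ef8ca8e, 0x8be6c94ace845ae6b9ae8c1ee94290,
    0x9422f8bead9ba0f635ee841cf8c62f, 0xa4a118ca6f849f17b66f6d6519ca4d, 0x7b60d83e6fa366e745ce9b18e83eae,
    0x8bdef7caaf9420e7b64f846327ca8f, 0x8c1f08ca7194a0f935ed8461284651, 0x83dcf74a708be2f73a4f8c5d174aaf,
    0x93e4f8ca8e93e0e7ba0e7bded8c20e, 0x9bdef8ba309be517420d7c5ef8c24d, 0x9be2d8c6908c5ee7be0e8462f8ca6d,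
    0x93e2e84650845f073e31846508be30, 0x841f1842308be3183e2f7c2117c20f, 0x839ef7be3093e316bdef93dd17be51,
    0x8be1083e108ba31742307c5ef8420f, 0x8c5b2845f28c65093e6f74e537ca2e, 0x9ca6f9464e849af7b9f084a2f9c1f0,
    0x7ba2e842708be0d73e108be0f7c64f, 0x8c62f8420f7c6117c610845ef9466d, 0x73e2f84e507c20d93dee83def7c630,
    0x7be108be2f8ba2f849ef83a0e83e0f, 0x84610846507c5d083a108461284633, 0x8bdef83a109be30845ef8b9cf84210],
   [0x83e3094651745f17be4f6d2718422f, 0x7be0f9be508ba2e7c20e7ca307c60f, 0x83df19c251845ef9460f74a6f8bdf0,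
    0x7be319ca507c5ee83a2f7ce4f84210, 0x7ca3294a4e7c5ed8be5074a2f8c9ee, 0x845f2845f07be308429174e5183dd0,
    0x8c6509c21084a1083e30756519c22f, 0x7ba0f9425183e0e7be2d74e5074a0e, 0x84651a4a326c9ee93a2e5d28f8458f,
    0x9422f93e307c1d173e0f74e508c1f0, 0x7b64e9be508ba0e6ca118c22e8b64f, 0x7c25094a107c20e8c2308464f83df0,
    0x7c2118ca50745ef93ded7420f7c9ef, 0x7bdf083df18421184a108421083e30, 0x6b62f9461283e4e8c60f8422f7be4f,
    0x7c2107c60f841ef7c23393df07be31, 0x8c1d17be0f83e117c630846308420f, 0x742118c9f27460f9c6117c24f839d1,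
    0x8422f9424f9460d839ef8460f8c610, 0x8c6118422f8c610842328463294230, 0x94e327c9ee749f183e727ce30945ef,
    0x8be4e9c2527c5d07bdef7ca508be31, 0x945f083df08be3273a4f74e127c5ef, 0x7be2f93e1183a2e8460f83e2f7bdd0],
   [0x93e2f7be0e8be116c612939ee8b5f0, 0x73a6f9468e83dcd739cf8360c7b9b1, 0x7321084a717c5cf8421183a4f73612,
    0x83e2f8464e841d07c5d18b60d8b610, 0x83e4f9c2708c1ee83def7c22f841f0, 0x9468f8ce8e7516f7b5f17c64f9c1f0,
    0x842709426d741b073dcf73e0c8bdaf, 0x941f17be10841f37423184231839f1, 0x83a6e9c2707c98f845908ba4d935f1,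
    0x8be6d7c28d8c5905bdd4a39f08ba72, 0x7be108c6308420e8be0f7be0e83df0, 0x7362f8ce917c5ee83df083a2e7b631,
    0x83df07c231845f2841f08be1283e52, 0x8c22f7ca2f7c9cf8461393e2f8be30, 0x842117ca4f7c60f83a4f6c62f84a0d,
    0x9424f8be2f7bdd1741ef7c22e8bdb0, 0x7360f9423383a2f846307c25073a11, 0x8466e9466e845ce7bdd08c1ee94230,
    0x73e2f846108be2e8421193a107ba31, 0x945ef7ba0e8bdf36c2118c5f184230, 0x83e4f93e50845cf7bdcf7c230845f0,
    0x83df17420f8ba316be518bdd073e10, 0x8c230946108c60f83a3084a3093e10, 0x6ba10941f27c20f9c9af8360d7b5d2],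
   [0x8c5d27bdd17c2538ca3173e30839ce, 0xa45f073e317c5d4742527ca5384610, 0xa45f08b6108c1f37c9f18423093dd0,
    0x949946bdb273e358c6716c6537c190, 0x8bdee7be1093a516c231941f17be50, 0x94a12839d083e537c231742118bdaf,
    0x9c9f07420f8c6117ba318c61284610, 0x9c5ef8b9f37c1f47c6107ca5283df1, 0xa41d07b9f193e3474230841f183df0,
    0x8cdb26c5d17c6128c252846137c9f1, 0x949d17c1f08c25183e507c9f284a2e, 0x841b383db38be929ca517be527b5d0,
    0x7c1b16bdd17c21284a3283e1174210, 0x942318420f8c610842327c22f93dcf, 0x7be107c61273e11842307be1073e11,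
    0x8c5d173dcf8ba7184250841f17c1ef, 0x6c1f284df27c22ea423083e31741f1, 0x8c5f083e11842118c1ee745f184e0f,
    0xa4df17420e845d27be5184a318c9ef, 0x8c5f18b9b08c2338c9d08bdf0935f1, 0x8421093e517c1f08420f74671841f0,
    0x8c20f842118c6307c2118c2118424f, 0x84a13845f0746118ba2f6ca31849b0, 0x83a0e83e1183e11746119421083a32],
   [0x94610835cf8c2318c9f083def941ef, 0x7366da3e4f8ba0d8498e8b1ca83a0f, 0x93e2e9b22e9ba306c5cf8b9ec939ee,
    0x8bdf0842108c5f1842108c2107be11, 0x7b20e9b230932107d1ae8b1eb7b5f0, 0x73a109be118ba6f8c9ee7ba0d835ef,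
    0x9426d9b24d93df0645af83dec9c20d, 0x842309bdf093a50845ef83dee8b9ef, 0x8be2f7ba2d9ba2f6c211939ae8c22f,
    0x7b60f936118b6307cdef7b5ec73dee, 0x7be2f9be108be2f84dd08b9ed93a2f, 0x8ba2e836308be11745f08be1084230,
    0x83df07b9f08be3184a12939f083a31, 0x7bdf18bdb193e918ca108bdf08b630, 0x83e4e83a0f83a10745ef83dce8460f,
    0x83e2f9c2318be2f83e0e7462e83def, 0x846509462f7c1cf841f083e0e8c1f0, 0x842108463084610839ee7c1d07ca2f,
    0x9c22f7be4c9be105ba318c1cf9422e, 0x8b9f0839f2841f27ca11842507b9f1, 0x9cdf07b9ce8c612845f18c1f0941f0,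
    0x6b60e93a318ba2e84daf8b1ed7ba10, 0x83def8c22f93e0f8420f942107be31, 0x8c23093a30845f17bdef7ca518c5f0],
   [0xad26f8c24f84db17b1cd752129da0e, 0x94a3193def8c2317be2f74e10945ed, 0x942308be118c2317c1ee745f08ce2c,
    0x9ca317c20e8c21173a0e745d08d1ec, 0x946318c21084a1183a2f6ce31949ee, 0x9ca5093dd08c6308c1ce745ef9c9cd,
    0x8c6518c20f8c22f7ba307c5f0945ef, 0x9ce11845ef9463083a2f7c9d18d20d, 0x9ce4f7c6307cdf17b6307d23494e4f,
    0x946118bdf18ca11842317ca529420f, 0x94630946309422f835ec745d08ce0d, 0x842308bdf1842308420f7c210845ee,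
    0x842307c611749f18c611846318c66f, 0x8cdf17c60f84a108ba3084a1384e30, 0x73e50946308be2d8bdce839ce841f1,
    0x941b17b9d28c21384630846337c211, 0x8c64f8c1f17c5f08c1f1846518bdd2, 0x83e2d8c6518c20f735ee8c5f184271,
    0x84630841f0842307c2317c5f18c62e, 0x9ca10839ed9be32741f08c1af9420e, 0x9463193e108461183e2f74a50941cf,
    0x8ca116c62f745d17ba30746117cdef, 0x8424f8c630745cf841cf83e0e845ef, 0x8c5f2846108463093e2e6ca308cded],
   [0x94a117c5ef849f1946128c23193e11, 0x7c5f283df0842509ca107be108c1ef, 0x7360e8be3193a2f845ce8b9cf74250,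
    0x946108c231849f18bdef7ca528c611, 0x83e0e8360f936316c9f093dd07c24f, 0x845d27c1f18465193e4f746337c60f,
    0x94a307c64e7c9d083df07c61094a2f, 0x7b62e8ba30936306c5f08b9cf7ba31, 0x6ba4e946308ba4d841ce8b9ce7be30,
    0x8c64f8c6316cdb18c5d07c65094230, 0x845f27c1f183e518be4f746127c5ef, 0x8c5f1839b18c2719460f7c1f18c1ef,
    0x8ca517c60e749d08c5f17be0e945ee, 0x6be2f9421183e2e945ae8b9ef7c230, 0x7c1d2742107be328c22f7be11741f0,
    0x83e1094252745f08c1ed6ca708460f, 0x7c5d27bdb184a519ca11842128c230, 0x83e0f83e0f936706c6308bdcf83e4e,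
    0x94a30941f0849f28c1f084a319be11, 0x8c20f83e118be307ba2e7c6127c610, 0x846118bdd183e5094a107420f8c1ce,
    0x9420f7422f946107be12942128c251, 0x73a4f8ca317c20e8be0f7c20f7c211, 0x8b9ee832109ba126c9f193df07ba31],
   [0x7c6117c5f07c21084632846308420f, 0x7c6327ce4e7460d93a4f7420e849ce, 0x7be508464f7c60e8bdce7b9ed841cf,
    0x846307ca0f8422f7be517c6108462d, 0x8c23184a6d8c20e8362e7c1ed845ce, 0x842517d26e749ed93a0f7be0d8c5ee,
    0x845f27c9d27ca30942727ca727c20f, 0x8c63274a2e749f08ba2f7420e8c5ce, 0x84a337ce2d749eea3e0f73e0d8c58f,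
    0x8422f7c2307bdf074632842307c22f, 0x8421174e4e7c60f8be2f83dee8420f, 0x7c23174a0e8422e942108b5ad841ef,
    0x846106c22e83a116be31841d17ca2f, 0x8be1183df0842328c9ef7be0e8bdee, 0x83df07c2308be3073e2f841d07c64e,
    0x8c2107bdf0845f17ca34946518ba31, 0x742107c5f17462f9c5ef83e1084230, 0x945f07b9ef93e317c230841f0841d0,
    0x84210846318460f8c2307c2517c62e, 0x7c6308ca2f8460e941f18bdef8be11, 0x94e3174e2d749b083a5184a108ce0f,
    0x7c6318cdf17ca2e93e3074a2f8c60e, 0x7c2719462f8420d8b9ef7be0e8c1b0, 0x7ba1084a71745cf83a2f74670741f1],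
   [0x845d27ca108423093e4f7c1f07c5f0, 0x8c1b2741ef93e5183e718c1f17bdf1, 0x9cdf16c62d845d273651849d284e10,
    0x6c1b27462e8322f83e6e73dcf64dce, 0x846127ca0f7c21083a507c1ef7c5cf, 0x846117460e8be3083e318bdb084610,
    0x845d27c5f17c6119c2307c2117c5f0, 0x84df374def74a1093e727ca118ca0f, 0x945f17422f841f17be517c610849ef,
    0x845f074a0f8c20f83e3293dd07c211, 0x6c1b25ca0e73a108c2707b9cf649ef, 0x8c5f274e2f84a108b6507c61184a0f,
    0x83e0f7c2517bdd073e517c65174611, 0x83df08bdf093e5083e2f84610839f1, 0x73dd083e127c211949ef83e3174230,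
    0x94dd37c5ef8c2318ba707ca12849cf, 0x7be0e7c1f083df07c9f29b9ef7ba12, 0x83e107ca4f8c60e83a2f8421084a4e,
    0x949d06b9ee8be136be30845b27ce2f, 0x7c5f27c9f0742308c67174a308462d, 0x6bdd2846127be2f9c20d73e106c5d1,
    0x7c6328c60e7c1ef8c2107be0d841af, 0x8421074a2f7c5f083e118bdcf84231, 0x7c2307be0e8ba307c5f18b5af8be10]]

/-- Frames of norm `14` for the nine binary codes, stored as in `combinationMatrix`. -/
def frameRowsSeven : List (List ℕ) :=
  [[0x73a0f7c64f8ba4d83dec7b98e7522e, 0x6ba2f94ecf83e0a935cb739ec7c9f0, 0x8362c84a8f941ec7322f941ef7c252,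
    0x8366a93ecdab62b531cd9418e84a8f, 0x72dad6be909b22e63e2f935d15c272, 0x8364c8466f8be0d73dee83dcb7c62e,
    0x7324c846709ba2b735ce935ce74212, 0x83a0d6c22ea3e4e6be119396f8468e, 0x8be0d7c68ba3e0d739ce9b58d8464f,
    0x7324c8ba6f931ed6c1ae8b58c7c212, 0x8422d6ca8c8b9ec73e319398e7ce6f, 0x8420e74a6f7c5ae7ba107c1ef7d230,
    0x73a1194a327c20d93e2e7424f7c1d1, 0x7b1ee73a11936516461093dd073e70, 0x9c22f8422e9462f7be2f845ef94a4c,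
    0x7ba0e93a4f9322f7c5ad8b5ae7be11, 0x845f06460e8ba3073e518b9b174a2f, 0x8c60e7c230845d073a3184e1384a71,
    0x8ca118c62f8460f8b60d6ce30851ce, 0x83e0f74a6f6c5b07c2318424f7c230, 0x83a2e8bdf094210845d1939ee8b612,
    0x73e6e8c64f83a0c7b9ef8b9cd7c1f1, 0x83e0f8466f9c60e7b5f093df183e32, 0x84a117c1ef7c610949f17bdce945ef],
   [0x7c1f08c5b2741f1a51f18ba2d7adb3, 0x63a0f94df47ca0cb51d39b66f7ae14, 0x7bdf084a12849eea45d19360e7b9f4,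
    0x84211a461284a0eac5ef7c24e839b1, 0x73df084df27c20dac23093e306b9d5, 0x5b5b1852157420db420e7b650539d4,
    0x7c24e8ca10745ce9c990931ec831d3, 0x5ba2f9d2127c60bac9d19362d731f4, 0x7b9d17c9f284a30ac6118ba50731f3,
    0x7bdf18c5f28424f9460f7422e7bdee, 0x6b9d0845b57ba4f9ce318b6105b5f3, 0x741d2845d17be509c63083a10735b2,
    0x8c5d17c1f0849d28c63394a5283e13, 0x7ba0d84250835ef741ee8b9ce6c212, 0x8464f8c5f07c5f0845f28bdef8b9f1,
    0x8c23094612745f08be2f74e5184610, 0x741d3945f38464eac60e6c2507c5cf, 0x941d07461094a1183a318c1f284251,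
    0x7ba6e9424e9420c8c5909b1cc93a11, 0x84a11749f0745cf946338be30841f1, 0x7c5d384a107c230a3e2d742107c1d0,
    0x8c1f0839d18be52845ef83def7bdef, 0x73a2f8ca126c9ef949f07c26e83a2f, 0x639d07c1d383a6f946318ba1263a13],
   [0x83def8323093a11749f08bdf17ca4f, 0x845d172ded7b21464a0f7bdaf7c9ee, 0x8ca1163ded745f36c6748c61284a4e,
    0x8466f8360e6c5927499293df094213, 0x8c9d3741cf83e7284270741f18460d, 0x94a1383a0e7c6137be2f6c9f094dee,
    0x9cdf0731eb8b9f35c6118c18f8ce0e, 0x8cdf17bdf07c5d37be3184e1484e31, 0x9465083a2d83e116ba2f7c5d094e0f,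
    0x84df37b9ae7c632945ef7bdb18cdee, 0x8c24f8426d7b9d063a0f841ee7c5d0, 0x74a136c5ef6421084271746117560d,
    0x84a517c9f06cdd183e3384a1294631, 0x7ba118b9f18c250949ef83e308420f, 0x842117464e745b173e118420f7c610,
    0x8bdee8b21193a126c5f0941f183e52, 0x6c2107c9f17be4f8c6318b9f073e50, 0x84df4845ee7c24f9c22e6c1ee94dcc,
    0x7423193df073df0949cf7ba0e839b1, 0x7c20f8c210845ef8c5b0939f083e13, 0x9c5b16b9ce93e5474271845d28422f,
    0x849d1739ef8be117c231841f274def, 0x8426fa46707c1ee835ed6c62e845b0, 0x8c26d83e4d839ef5be108c5ef8c62f],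
   [0x542128d6527462ba39ee73e0f6ca0f, 0x7ce327d26e6518f9bdd07be2f84e0e, 0x7ce707d24d64d8e841d38be0d9462e,
    0x63e117c6117462ea4d6f82ded7c20d, 0x6c6127c9d06ca0f9c6117be0f7c5ef, 0x645f375a1174a6caba507be107462e,
    0x7ca5384e0f6cdee9c2316c62e94dec, 0x746517ca6c741ce7c1d18b1cc841ee, 0x74e327524c745cd941f28b5ee849ee,
    0x6ba4f7c2506c9cf8cd918322d8c22e, 0x746527ce10645ef93e106be0e7c9af, 0x64a348da107522bbb9cf7ba0e8c1d0,
    0x739d08b6138ba50849ee73e307460e, 0x8d23084a0f84def939f184a1294a30, 0x73db37c62f93a4f93e2e839f06c1f0,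
    0x6be32949d37464ea420f6c22f7c1cf, 0x7be107c1f1849f0945b1935f08ba13, 0x7c24f8c22f739f0845ae7b5cc841cf,
    0x8c26f8424e845cf741f18c20f94a4d, 0x7be2e8464e93a2c741f19b5ad83e30, 0x8461184a316c9f183a0e74a318462f,
    0x7ca327d22f6cdce93a517464f849cf, 0x73a0f7c2127422f94a1083e507be30, 0x845d1739cf7c5f384df393e1183e11],
   [0x8ba2f93e517c1f083dec6c66f7c5ce, 0x6ba318c213645d18c2106c691745f0, 0x8c21293df36d1b2a49f06ceb18c9cf,
    0x83a0f83e318c21073e32942527ba33, 0x8366e93631741b2749d17c26f8bdf1, 0x8421183dd183e328422f7c5f17ca0f,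
    0x839f18b9d3846119cdf07426f7c5ce, 0x845f183dd27ca129463074a5284a0f, 0x739f28c1d36c230a4a0e6be6f73d90,
    0x6b6309b9d3742119d1d083e8f835f1, 0x841b27b9f083a1384a507c210745ef, 0x8be2f8c1f17c210842307c64f83dcf,
    0x7ba2f93e31741f0841cd7c22f841f0, 0x841d18c6118be508ba6d74a1174a0f, 0x7be50946107be0e8c20f73e4d7bd8f,
    0x8422f8b9d284611849f1846328c64f, 0x845d27bdf1745f38ca3174a71845ef, 0x73df1845f1846508c2318c2317ba50,
    0x73dd17c5f374610a49f083a316c1f2, 0x9422e83e0f845d17c5f29c23093a33, 0x8be2f8c270845ee83e0e74a4f84e2d,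
    0x7ba117c21083df1846118b9ef7be11, 0x83e0f7be508bdf06b6318461374613, 0xa4df27c1ce94a318be5284a119c5ee],
   [0xa4db063daea369283e70945b47ca0f, 0x842308c62f9420d8b5ef841f0845d2, 0xa41d07be4f93e1183e0d7c6117cdee,
    0x93e0e8be709b62f7360b7c9f27522e, 0x7c2318c6118422f9bdce7bdf0845f1, 0xa49d07be2e9b6326b62d7cdb27d20e,
    0x8be0f8be0f9ba4f83ded83dae8460f, 0xa49f17422d93e117ba4f84dd28d22e, 0x8ca4f7ce2d9424d832308c1b08ce2e,
    0x94a519ca1084a0e9ba0e6ce4f9c9ce, 0xa45ee83e2fa42117bdef949d38ca70, 0x83e6e9464f8be2d83dce7bdcd9420f,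
    0x8bdf06ca307c5f183e518425174210, 0x7c5f2741ce83e508ca528c1f08c62e, 0x939ce7b1f09b6336c5ee93db07c230,
    0x9ce118c2107c5d18c2506d2718cdce, 0x8ce10741ee83e1173e11841b084a0e, 0x9460f83dd09ca5184212945f293e50,
    0x9426f8c66e8c5ee735ef7c5ef94e2e, 0x83dd07c22fa3a2e7be319bdf173e12, 0x7c6118c5f08c24ea3dee7bdef8c1d1,
    0x73e2e84a327be2d83a2e842116ca30, 0x8be2d8be5083e10741ef846108be50, 0x7c5b47c5d27c252a422e74213745f0],
   [0x7be1074a108c60f83e339c2127be33, 0x7322d8ba509b64e6c1cf9b1af7b652, 0x7be6d8ca5083e2d7b9ef83dee8422f,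
    0x8c62f742107c9f173e128ca1384a50, 0x7c66e8420e83e0e741f293dce94230, 0x73a11846118424f83e0f83e1083a30,
    0x9422e7c231845d16ba328ce5484233, 0x73a2d7be1183a10745b0935af7c251, 0x7c20f7462f83a2f73a30841b07ca50,
    0x8c6507c62f7cdd07b6117ca328c9f1, 0x73e2f7ca4f7c1ef74212939f083a71, 0x7ba4e9c26f9420e73daf93def93a71,
    0x73a4f8ca32749ce941f184270839f4, 0x8ca2f7ca2e8460f7b6318c5f08c231, 0x739f07c1f183a4f7c6318b5ef735f1,
    0x94a307be2f7c1f26ba0f74a1284def, 0x7ba0f939f1a3e8f841ce8bdd08ba50, 0x83def6b9ef8ba316ca3293dd08466f,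
    0x846307ca0e84a0f83a108c5d08ca2f, 0x842318460f745f27c2118463093a30, 0x7ba6c8c6ae8bdad639d09b9cf7c272,
    0x93e0e73e30941f1642349c61283e71, 0x73a2f8ca337be2f83a0e741f074630, 0x8468e8c20e841ee84591935cd9bdf0],
   [0x7ba4e8ba517b9ef6c6107be2f7c20f, 0x8c28db3a4ea3a4c7bd8c83dac9c5ce, 0x83a6ba368eaba0c73d6e9b5ae8c212,
    0x83e0e832117ba1274dcf7be0f8420e, 0x836aaabaaea3a0b6b94b939ac94630, 0x9424d93a6daba2d73dce93dcf94a0f,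
    0x6b5ef8ba1483a4f84a0f7c2516c22f, 0x93a4c9b66dbba4c6bdae9b98d9c22f, 0x8368ba3e8fa3a2c73d8d939ae94250,
    0x73a0f8b1f183a117d5b19360f83611, 0x8b66a9b68ebb24d5398ea356e8be51, 0x8be8caba6db364b7398d939ad9bdf0,
    0x7c22e83a0f7b9f074dd1935ce8be30, 0x93a0d73a6da3a105be11a3dd184290, 0x94a2e8be2e941ef739f0945f08c1f2,
    0x739f18b9f38be508c60f83e3273e11, 0x83dd08b9f0a327084a308b9cf7b9f0, 0x83a6ca3e319460e7c18f8bdee93a50,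
    0x7bdd08ba3183e11849ce7c2307c20f, 0x73e6fa46517c20e8bdce7c24f8bdf1, 0x946508c22f8c20f7bdef7c5ef9ca0e,
    0x83e4e83e317bdf06be3074a307ca0e, 0x746518ca2e7c60ca41ce7b9ed8c9ce, 0x83def7ba108be317420f841d17ca30],
   [0x7c5f08be0e9ba4e8c1ce939af84211, 0x84df28462f7c21093e0e7c61184e0f, 0x7ca11845ef8460f949f29421094250,
    0xac9ad6b60ea3a3264212a45d38c271, 0x7c5d17c210846108c1f0941f284652, 0x7c9b26c9ef8423094251941f27c251,
    0x845d17c1d0842319c9ef93df184231, 0x84db37c9cf8c25093e508c5f27c610, 0x7c5d16c60f8c2108be119bdf374633,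
    0x8cdd27460d8ca30942108c1f194a4e, 0xa55af635ce8c1f37c9f49c1d48c632, 0x7ca117ca2e7c1ee8bdef8bdf084a10,
    0x946106bdef8c21273e339421383df3, 0x8c5f18ba308ba318420e74611849ee, 0x8c20e7bdd08be31849f19b9b08be51,
    0x846108ce4f8c60e8b60e8ca118c651, 0x8c1d07be108c632845f083e118be4f, 0x94a508462e7c9af839d08420f945d0,
    0x84611841ef7c1f08ce138422e93df0, 0x949b183db18c2328427184e537c1f0, 0x8422d8b60e936306c1ae8bd8e84210,
    0x93e0d7ba6f8c1b15c1f29c1f184272, 0x749d3741cf7c2309ca118b9f17c610, 0x8c5b1645f18423183e917ca1374a4f]]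

/-- Frames of norm `22` for the nine binary codes, stored as in `combinationMatrix`. -/
def frameRowsEleven : List (List ℕ) :=
  [[0xa52306c65075172736947dab58d230, 0x745d16d1f37c60d8bad58ca536c233, 0x9460f84671849ae7262e75212755f1,
    0x9cdf07ca5264971736916dab37d60f, 0xa5e127ce2d7d9708ae548d2539c9f3, 0x845d25c212741d27ba71745f36da10,
    0x8c9f0646707c5b162a7384e3674e14, 0xa560f73e10749d37b60f7cdf38d60f, 0x9424c7cab17cd50635f3946118c293,
    0x8ca317ca317cded9325184e738d211, 0x9c22e946538c9ee8326f74e7184a10, 0x8cdb4752318ce0fa2a8f7ce357cdf2,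
    0x84a5084a6c8c5cc7b2318ca108c9f1, 0x955f26bdcf6cdb48c2127ce3495211, 0x83a4c93a917b9b063dcc7460e74e2e,
    0x7c28e9d252751ac941f38c68f93e51, 0xa460f8ba2f9c2136ba318ca1293a12, 0x94a12949f174df09b62d74e718c5b0,
    0x841d164a117bdd273e938c6346c232, 0x845d27c5d094a3093e31841d08c230, 0x7ba0e7be519420f7bd8f9b5b17c652,
    0x839f083e328ba4f6ba9074a3274a2f, 0x8ce107c60f741f07be117c1ef841d0, 0x845d2649d17c2709c2907c21174a0e],
   [0x5ba8cb42547be4b9418b7c1ef7ca70, 0x73a8caca746cd8d9bd6e8be2e7be15, 0x8c20e93633841d17bdce8ce147ce33,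
    0x839ae92e13a3a51845ed93df26be33, 0x5c211b4e347c60abc1cc7be2f745d2, 0x5364fac5f66c60dac16b7bdef7c233,
    0x6b64db463674a0e9c1cc7ce727be73, 0x7c5f08ca156d1d0abdee74a336d251, 0x7ba2aa36538c5af7cd4fa3df08c2d3,
    0x8ba4d83a4f8c5f07c5af93dcf9468f, 0x6362fa39b77ca4eb518f83a507b5f2, 0x5b9d08c9d57c64eb49ce8ba306ba33,
    0x956308c22e7c5cf8be107ca10951ef, 0x7c5d48c5947c690ac26e64e537cded, 0x7be108c6137ca2f93e0f7c67173e11,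
    0x7b9cf83e1193a6e8462f8b5ef73a0f, 0x8ba0f7ba118bdf17be0f841f0745f1, 0x8c20f7be317c9d16b9f084a128ca51,
    0x8bdcf84651945d173a529ca3473e74, 0x73eaeb4a717c1ec8b98d7c20d939d2, 0x639f0941f28364f8ca0d83dee73e30,
    0x8be0d8a9ef9be32751909bdd093e50, 0x7364d8c671741ee845cf839ee84290, 0x63e10945f46cdcfb4d6f8364f7bdf2],
   [0x8c2307b9ce9be90842108b98f9420e, 0x8ca8e8524d7d5ee8b1d0945cfb42b0, 0x7c68d84a0e74a0d83def8c1ed9464c,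
    0x7d1f5755ce84aada32d07521294e4b, 0x9426d7c28e745b15b9f07c60e8ca4d, 0x9ca127424c8ca0f8322e7460f9d1eb,
    0x73e4f7d26b8c22c83a109b58b93e8e, 0x6c2308464f8c22d935cd839b07ca11, 0x8469084e8c84a0c831cd741cda5649,
    0x7c1d06ca0f8beaf7b24c7416f7ce6b, 0x73a308c611749ef945f18c2708b631, 0x7be4f7ce4f74e2e8364e7ca508ca6c,
    0x74df37ca0f7ce0e9ba0f74611851ee, 0x8c23083df083a6f7c26f6c60f8c9eb, 0x842118c1f07ca0f94230846708be10,
    0x94e127420d946118ba31845d294e2f, 0x9be4c8be708c5d15ba30852518466e, 0x9425074e8d749b06ae2f74a0f8ce0f,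
    0x8c5f0845d28ca7093e307ce3293e50, 0x7c1b3841ee932917c26e7c1ae7be0d, 0x8462f8c630745ef945ae7b9ec8c60d,
    0x7362d7c21093e4f7c1d0a2d8f7b253, 0x831ef7b63193e11749d093a1083a50, 0x63e6f952117460d941f19422f8ba51],
   [0x9ba6e84a8c94dee742139ba2da3a6e, 0x8324b8c6b28c9cd7c1d08be517caae, 0x6a60c8c2b48c1ed7c5d09b2515be92,
    0x72a2d7cad094ded7bdd09adf083ef0, 0x83e1073e4e83e107c60f7ba0f749ed, 0x8362e6ca8c9422c6c654a31ed8beac,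
    0x83a1083e307c1f174e327c24f83e0e, 0x8aa2a932b0abe0e6496ea31ce842ae, 0x82aa883ef08456e4bd91a3a107c6d1,
    0x6a9ec8325293231751cf9add16ba92, 0x7b9f17421083e5084a3083e117c64e, 0x7ae6c8caee9460c6c1d19b62d936ce,
    0x941d2839cf9c25383e50846128bdf1, 0x73a6f8d2526c9cd8ba1183e907b9f2, 0xa3e2b73e4d9c1f153df19c1af942ae,
    0x7be327c62e8422e8463173a0d8c1ed, 0x73e2e9c2717c20f841cd7c2308be70, 0x6ba0e8463193e2d83dcf9b9b274673,
    0x83a2f93e717bdb16c1ef7420f7c60f, 0x93e4e83e6d9c5cf63df3abdf093a72, 0x841b284a518ca2ea422f7c25084a2e,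
    0x83e0f83a0f7be11851f18be2f83e0f, 0x7c5d15bdaf83e5284e349b19183e50, 0x7360e83a13842108c9ce83a306c62f],
   [0x7c5f2841ef745d194df083e2f8be0f, 0x841f074210745727da169be508be51, 0x74191839d373dd39520e7ca326ce31,
    0x7b5cf6c2108b2116ca53a39f063632, 0x9c1b2735d073db57da3284250841cf, 0x8c5d283e307c1d3841ee74630845b1,
    0x8d2317c6304d0f38c5f175272855f2, 0x9460f8362e841d1749f08460e949ee, 0x7c5f28c9f06cdd0a4df18422e93e30,
    0x9c1b06b20f7bd7575a14942518c231, 0x73a4e936326b9d174d8e73e0d845ef, 0x751d57c9af6c9f0b4a117c2118c9d0,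
    0x7c192845d2842509ca4f7c6318424e, 0x7c2309426e7b9ef7bdcc6bdcb849ad, 0x8ce918ca4b6cd6f8c5b28be0dac1f0,
    0x9c9b36c1f07cdf4946717ce738ca0f, 0x8ba4c83230841b15c9d28c6108c650, 0x7360f846518bdce7c2339be5073a33,
    0x845f174a0f7c5f083e30845cf7ce4f, 0xa41d07b1cf9b63474a108c1d083def, 0x7bdee83a3183dd2741ce93df26c252,
    0x845f18b9f2739f37ca10746517c1d1, 0x739ef74a117be0f84a119360f63e10, 0x645f38ca127420db420e6c2316cdb1],
   [0x7c5726294f732168e1909b1d073db2, 0x841d37bdb27ba339462f7be3273d91, 0x7bd326a56fa26b586210a31b07360f,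
    0x94db37b16c93273856308c1ee941ab, 0x8c5f17c20d8b9f27c2109b9d083df2, 0x845d26a98c8aa7475e12931ce8b9cd,
    0x94630931cf8b9f37cdb1939ee93592, 0x7c5d2735ad83a128ddd3a320e931d0, 0x7d1f37c5f0545b4a458d742117cdb1,
    0x73e108c1b283a518c9f09ba107b212, 0x741b372d8e82e5475a11939cf83dee, 0x8cdf173daf8ba337c61193db2841f1,
    0x83daf831f193e538c98c8b9b17c250, 0x7ca328cdf15d5b0b49d17c6909b9d3, 0x83e0f92dd0839f27d9d28ba2d835b0,
    0x739d08b9d38be708ca0f8c2717ba30, 0x8c5f163dee7be337423283df17c1f0, 0x7c5f17c211641b37421074a117ca30,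
    0x8c6128c20f8be32846108421093e0e, 0x93df0639f07bdf374651846327c60f, 0x84210841f17b9f183dee8b9f06bd94,
    0x955f47c9ce7cdf0a3e3074e318d5cd, 0x84dd16bdae8ba7084e32939908c62e, 0x73df17c20c9362f845ef9318c83df0],
   [0x83e1083a317c9d283dcf8467283df3, 0x8360d8b60faba6f749b1b318e93272, 0x7bdf18420f93a6f83a4c7c5d07ce4d,
    0x8be117ba0f845f1746328467093def, 0x5add18c6129328e9420c835ef63a11, 0x946118c1b09ce709c1f18c5f0aba30,
    0x83dd17be1274db28c5f08467284213, 0x639d39c1d27ba8faca2c6be2e7b9cf, 0x6b9d1839d183291951ec7b9ce7c22d,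
    0x83e508c6b074dae839ef74a9194a30, 0x94a128c1af94a71941f0941f1a3a10, 0x845b27c1b0a42aea46319b9f18ba11,
    0x8419273e327c9f38be0f7ca5574a52, 0x73a0f7ca2f8ba2e7be0e941cf7466f, 0x83e6e93df084a1084570939cea3a50,
    0x83e2f8c670845ce73e108463094250, 0x83dcf6c60f9c64f8c633a39d08ba91, 0x6b1b18b9d483671a51ed7b6306b5d1,
    0x7be6f9c2517c9ee8c1f07cab09420f, 0x949d48499384a91a3a8f6d2738c1cf, 0x7bdf193a0fa3a6e8c9cf9b1ce839f0,
    0x845f36bdaf745d38c6128be1083d93, 0x74211839b17be718ce307c1f08c24e, 0x83df29462f93e2f8ba4e7c22f83df0],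
   [0x8b9b0635f08b633646928c2316420f, 0x939ef7bdaf9ba536ca339b58d92a51, 0x72e6da3df28b63074df2935ec8a652,
    0x8c6116bdcc93e126c234a3dd0839f1, 0x7320e939919aeb07cdf092d8c7aa11, 0x8ba0f8bdeeaae906ca329b16c8b24f,
    0x9c1b073590a3e73746939ca137ba30, 0x731ec8b5d0aaa716d1d1b294d7aa93, 0x842108c1af93e508ca12935ad9364f,
    0x7b9b163db093a7184a739bdf173e30, 0x8b20c839f0a323164df3ab1ae82a92, 0x839f07bdaf8b653852119318d83250,
    0x83df173a0e8be12746118420f8460e, 0x6362d9465183a0d849d0935ee6be70, 0x7b5ef73dd38b6536c6318bdd26ba52,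
    0x7b971735948b6929527183e31639f0, 0x9ca2f7ca4e849917ba3394a1194253, 0x7b9b1839d283e138c60f83e32735f3,
    0x8ca116c5ad9463084676a41f293a31, 0x8c23394dd174a2fa46506c68d939ad, 0x8c1b06b9cea3e91849f1a31908ba70,
    0x9c20f7b5ef8c1d3642129c2117bdf2, 0x7ca128bdae7ba5184a307c1ad941ee, 0x8366c9ba4fab62c63dd0935ac8ba10],
   [0x73e108c5f374230841ee7c2317420f, 0x6360f9c2346c1f08c9ae83a4f6b612, 0x73e109c5f37c62fa45ad7b62f7b5d1,
    0x6c68eac6ae7c9899392c8b5ce851d2, 0x7c6148ce1264e10a3e2d5c6707c9ad, 0x6b9f28c5d274a109c9f083a4f7b5d1,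
    0x7be4f94e5184def835cf8c21183e51, 0x742128c9f07c610945cf8b9ef83a11, 0x739b27ca327c63093a0d7be3264211,
    0x739f1941f384a4fa49ad83a2f83e2e, 0x5baceb42b06c56a9c0cb7adec7cd92, 0x73a1084a326c5f08c5ef83a107be50,
    0x945d17466e845b08360f84632749d2, 0x73a4d8b6117b9f0749b19b5ef735f4, 0x9464f9c23094df0839d18ca129c232,
    0x739d08ca138464f9422e8c25273a51, 0x83e10932309c22f845ae83e109462e, 0x8364c83e8f839cf641ae8b58d84650,
    0x7c68eac62f7c60c9c18d73e0c9bdcf, 0x7ce317460c7c5d08c9b29b5af94631, 0x83e6d8c6517c1cd6be11846507ca2f,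
    0x6c6148ce307be4ca3e4e63e0e74d8d, 0x7be128c1f1742128c5ce73a0e7bdce, 0x6c232949f16c9cea3def7c24f84193]]

/-- Frames of norm `26` for the nine binary codes, stored as in `combinationMatrix`. -/
def frameRowsThirteen : List (List ℕ) :=
  [[0x9d232759ec7d1f08ae9295a529c212, 0x9e2167d5ec7d1f19aa307d5d3acdd2, 0x6d5d4649eb739f093e108bd507d1b3,
    0x7d1d46664d74dcd8aad38ce127ca13, 0x9da156d1ed659739329485a55949b5, 0x856526d20a849cf7b6349c9d1ac631,
    0x7d23365a0b7c60d836b49cdb294e90, 0x6be517520c7b60f6ba739bdae7b1d4, 0x9e2166d1ca7c63082ed16d9f19556c,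
    0x7d2317d62d6c56f82e539ce1383df8, 0x9d1d27be0b93a136ba519c9f2939b4, 0x952116418e7bdd474656a4df48bdf5,
    0x8ce31845ef64db19c5f17ce309ca11, 0x7c1f16d1f1751f18ba938ce5483e92, 0x7c1f28460e83a4f8c24e7420c845ad,
    0x94e509ce7074daf7a62d6da7284dd1, 0x939f073a0f93a516c271946327be10, 0x741ef745f173dd184a14a35f16b5f6,
    0x9ce2f74dee9ca2e7ba549c9d19c66f, 0xad9f3639cd7c9d67be3174df49d1cf, 0x6c6508c1cf7b60e7c210841cf7c5d0,
    0x845b16be4c9ba106be11a399184671, 0x6c6348520f7462da3e0f739cd841b0, 0x83e4f9c62f8bdf0841af93e0e92df3],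
   [0x8464e7c60e8468e8c6108b9ce9be6e, 0x93def5b5af8bab35d2538b98e942aa, 0x93ded6b22c8b6125d2129b16c8424f,
    0xac1ed6a60ca3a554c5cf9396f8c26d, 0x951b25420d7c63373e3083d937d64e, 0x7ca508c5ed7ce2e84dd3939cbaba2e,
    0x8d20e645cb9427074633a392f9c2ce, 0x9462e6b5cd936915ca128356c8c60b, 0xa464c7b26d8c5d354db28b9ceac28d,
    0x8be0d7be2e9420f7d1d3a35ec9366f, 0x73a4c8be4d92e6d5c9cfa316b7be8e, 0x9464d8b5d09c2516c1b09c1b19be51,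
    0x8b5cf7361283e537c60e7ba317420f, 0x6ca508ca2d83e2b93dd08b18d845d1, 0x8ba6c7b9eea367053e12a3d908b671,
    0x8c6117426c8c1ef73a0e841f07d62c, 0x9c1d18b1ae9ba727d2118bdec935cd, 0x83a2f8ba6d9bdf0641f193dce93e31,
    0x94dd15b5cd7b9f56ca117bd7084e0e, 0x7c5b26c9d16c6318c6b284e537c670, 0x8cdd2839918ce539c9f18c21393a11,
    0x8be6a942af841af6c1af941ee8c2b0, 0x8463074e2e8462d8425283e0d9422c, 0x7ba4d9c2538420e741ae7c20f8464f],
   [0x8c1ef739ef8c9f37c5d08c5d194a8e, 0x73a4e8362f749936d153a31eea2e93, 0x93e2f831cf9c5f36bd919bdb2a3235,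
    0x7324c93eb07c54f6bd2e939ee8be36, 0x84a4f9c1cf8460f8c5d19422fa3211, 0x8ca5184250659518bdb274eb3aca31,
    0x73d91831b3745f6955708b6118ae34, 0x635f08c61484def9c5d18c2527ba73, 0x8c62d7be707cd725b9d394e369c6d3,
    0x73a4c9ae6d9b9ee6490f9318c9ba50, 0x9ca127c210749d473a516d2529c1f1, 0x8364b835f2941f164572a39b09b2b4,
    0x739f08c2519be0d83df0942127c253, 0x9ba4c83a6f941f05b5cd7c5f08ce4d, 0x8c212839d17c9f29cdd17ba4f9b9b2,
    0x7c6108ca326d9919bdd084e738ca72, 0x8c66d9460f8c1cf7b5f0945f08ba14, 0x8426d9be30841ef7cd9293a0da364f,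
    0x7ba6c8b68d8b9ae5c1909b5cc83df2, 0x6b9d0939f183231849ce7b9ee6b9b2, 0x94df27b9ce749d384a128465293df0,
    0x7bdb163daf9c27284a139b59083670, 0x949f27462f7c5f1736d36d6738ca0f, 0x7c2107c61173df26ba0f841b17c232],
   [0x7c291a45f4552109bdee5469093d8f, 0x9be2eac1f674a318be0d652b193def, 0x7ba10ac9d864e119ba2e653137b1d3,
    0x73aafc45f7645ed935ee64eb283975, 0x9c22e8b9b284df28c5d08c23193a11, 0x7c632ab9b55ce11b45ac4c6b184530,
    0x8362e9be52845f07bdcc7c2308464f, 0x8bdefa461774a308b22b656d5741f1, 0x8c28ec45f56ce0f939cc6d2d09b5b2,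
    0x8b64eb3e13b426d831ce94232931f4, 0x9420f8b1d2849f57c9908c2139ba52, 0x84a34949d455210b3e2e4c6b28c570,
    0x7be308460f8c22f83e329bdf18b613, 0x7c2319399173a718ce306c22d939ae, 0x7c66fa46516c5ec9c9ae73e4d945ce,
    0x8c630839cf7c9d27c9d28bdd094230, 0x8be1193e509ba2e83a2f7be1083dd2, 0x83e2c93e1293e316c1d19c5f38b6b3,
    0x73e10a4e528420d8b20b74a0f7ca10, 0x74652952325d5cea320e652b2845d2, 0x949d374a116c1f38368f5ce536cdae,
    0x93dd18b9d48ce539c60e746938be0f, 0x632109b9d39366e9c98d831ee6b992, 0xa3e4c83e108c5b063e139c6508b5f3],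
   [0x845f2745cd94a309c5f2a39f19b632, 0x4b24fa4a51841ea9d171aae2b8aa33, 0x641f37c9b184a4ea46108b9f0839f1,
    0x7ca117c9ef6bdd18ca1193dee83e11, 0x63e719c1ef8460da55519b1eaa2df1, 0x7c5d38b5918c6319cdf283e0f939b1,
    0x745f2756108d5ed9b63294a128c253, 0x749f18bdef7c5d0949b18bdef83db3, 0x7c2ae8ce2e84dee839919b9cea3632,
    0x6ba129c62e93e2d9c5ad935ea8b1b0, 0x84250a3e508498e9418f83e2e93d94, 0x9462e8c20ea462f845d19bdefa364f,
    0x7be10839d093e7094d8f9adcf8b5f0, 0x94e10939d1751b29c5b1846519b9b4, 0x8c26e84a8c8c9ae739d29420ea3a51,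
    0x741b27b5b18423384e11846317c20f, 0x7ca719528d74d8b939cf7c20d8cdcf, 0x7bdd28ce126c1f19464f7c66f7b9f0,
    0x7ca52855f174e0f8ae517ca3283dd3, 0x7ce13945ef7be50a3deb6c5ce8c9ce, 0x7c9b464db074e30b46928465384611,
    0x7322f9b9f29b64d845ef8b9ed835d2, 0x7c24e7c2107c1d074e16abe118b693, 0x9c5ce7be0fa42516c230945b1942ae],
   [0x85e127c9d1655f0832516e2358e64c, 0x9d1f47bdce8c6328be706ce118d1ab, 0x9de137c1af64df39460f6d6129620a,
    0x85e537c5cf655d19c5d27cdf3a5a2e, 0x84d938bdd18c2529c22d74a12749cf, 0x9e1b56455075234a42727d5f695e0e,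
    0x9d2508462c8c5d16ae0e84db18d1ef, 0x85a116c5d06c9f28c212849d57de4e, 0x9d1b15b9ef8c61362a707d5d66da10,
    0x8d1d47b9ae8be5383e4f7c5b284dee, 0x95a51845d16d5f293e3175e559de6d, 0x9d1f3935af9c6538b9ee74df3949af,
    0xac9ef73a0d8c612642318ca109464c, 0x6ca106c9f06c5ef93df1839f16c9f1, 0x8464e74e2e845f06b9f0945908ceae,
    0x849f3741f164db38c6327c65384e30, 0x841926c5b29426f8bab184a146ca11, 0x8c26e94a7274def7ae2e656518ce4f,
    0x9cdf17ba0e9c2318b9ed841b2851ef, 0x9561474e0e6c9f093eb265672955eb, 0x845d38b9ee93a5273a4e749f07c5ae,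
    0x7422f842307c9af841b29c1f18be54, 0x94a4e9adb08c2127cd91845f0a41f0, 0x63dd1945b66c270ace0e7c2716b9f1],
   [0x7c6147d5ef7c64da3a4f7420e8458e, 0x8c2708be4f745d073dee6c62d9c9ec, 0x9c1af639ae9ba145c654abd9183652,
    0x94df57c9af84a709b64e6c5f08c98e, 0x9c5b173991942367c2308cdd48c251, 0x84a8f942107c9cf739d17ca309c1f0,
    0x846117c9d07ce4f9c1f08c1ef93e10, 0xac972735cf9be356c271852138c62e, 0xa51b26bd6e842357ca927d1f19462c,
    0x8c9f4845af942af9c2717c1ef9b9af, 0x94a6f8c210749b073a317d270949d0, 0x6ba6fa421273e2f741ee7462d8be0e,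
    0x739d17c1b37c270a521183a4f831d1, 0x8c5d063d917be1574a528c1b274230, 0x852127c5f0749cf9be107c6318cdd0,
    0x9461093dd19468f8ba2e7c9f19420f, 0x8428e9c24f8460f73d8e73dcca422c, 0xa51b47419084e559429175a759ca4c,
    0x84dd77cdce8ca4fa3a916c6108c98e, 0x84a8f941f06c9b0741f384e519c1f2, 0x8360f7c6717be106368e74e5074a4e,
    0x8ce327d22d6c9d08b1ed7c5ef849b0, 0x9c5af731ebab2515ca319bd8e8c22d, 0x939ef94232945d17bdf0946318b634],
   [0x6b64d8be318362d6be0f83dcf6c212, 0x94611b35b194a8eac9ab6464ba414b, 0xa5671b35ce8ca509458d64a0cb454b,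
    0x846307462d83a2e73a71841ef841d1, 0x9c5f0a29f194251849ac6c66e8c56c, 0xa4e31a360e851d19458d64e6da494d,
    0x9464d6be0e73dd163e31841cf7c5f0, 0x945d09b1d09429284dcc6c60d941ca, 0x9cdf2ab5d08c63094a0e64e8e9412c,
    0x8c9f16420e6c1f173e727c5f17cdf0, 0x8c5d1a31d094270a4d6b7ba0d8b94f, 0x9ce10a2d7184a339518e7ca4fa3d6f,
    0x7421184e2f83e2d7b250841f0741d3, 0x9c9d083a0f8bdf46c2308ce127c211, 0x73a4c93a118422f8cd4f935ed8ba31,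
    0x8be2d7ba2f7b9f06c60f83dcf74e2e, 0x849f2849d17c630a420e6c5f0849af, 0x8be2ea3e138424f845ee7c24f9360f,
    0xa4a1063e2d7c1f3636717ce128c9ef, 0x8ce538c9d0755eeabe117ca9194590, 0x8c1af7b60e9be10745ef941f08462f,
    0x83e2d7b9f09be2f746139b9d083633, 0x8ca709be2f7c9d07bdef6ca2e9cdcd, 0x8b9f28b60e9b6707ca0f735eb8398c],
   [0x73e4fa41f37c60f949ef7ca4f83e2f, 0x7ba4fa321083e118516e835eb931d0, 0x8c630931ce9c2118cd909bdcf9bdf1,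
    0x851b56b9ed8325294a2d5c16e7d9a9, 0x73e0e8be4f939f0741afa39b073a53, 0x73a4d8b60e9320f64db1a356c83a51,
    0x7ba6e8ba2e8ba116c9d093dce93a6f, 0x9463093def8c2127c1ef8c9d09ba31, 0x8466f8c66d849ee7bdcf8c5ce9ca6e,
    0x7324c93a3193e0f74d91a39ce8b272, 0x745d463e0f635f19ca2d63dcf6558d, 0x8426f9c26e8498f841b18c60e9be32,
    0x8ce117c64d7c60f7b24d6d1f08da0c, 0x83e108b21173e138498c639ee7c5ae, 0x7c6707c62d7ba0f7c2317bdef8c1ef,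
    0x8462f939cea4270849b19bd8ea366f, 0x739d16c5f1846108ca128b9f07be30, 0x9c1d27424e941f17ba927ca317c5f0,
    0x94e1173daf845f29c5d08bdd08c9b1, 0xb51f173dee7c5d4742517d2329c60e, 0x745d2841b56c631a4e716ca7374a2e,
    0x742108ca6e8b60d839ed8b5ae6c5ef, 0x7324d9be717bdaf7c9ae93e2e7ba33, 0x6b60f83a3192e4d741ee835ae6c610]]

/-- Frames of norm `34` for the nine binary codes, stored as in `combinationMatrix`. -/
def frameRowsSeventeen : List (List ℕ) :=
  [[0x7de11845ac7ca2f9c9f38ca0fa422e, 0x962127d1d1659b0abe347da748d211, 0x7d1d584dd38526fbc2106ce5394a0d,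
    0x849b2641d083e328ca5374a30749ed, 0x649157cdb584a6ecca9074ab35c60f, 0x9d9d3635ab8c214849f39c9b1a4610,
    0x652158d9b25ce4cd42705d28f8c190, 0x5bd72835b493af1a49ee7bdf173a30, 0x8499174970b42d094696b49d38aeb2,
    0x64a0f6c6707be0b8c1f183df17566f, 0x9cdcf63e0f95dd1845f7a4e54a46d0, 0x6d6118522e84e0c9361194dd18ce51,
    0x6d61485df15d22cc3a2d64a51855ed, 0x7c1937ba0f832518424c6460f6c9cd, 0x9cdd17356f9c675845f18c9d3a424e,
    0x83e4b7ca508c1cd6c214a3e0f7beb0, 0x6bdf18c19284e6fa52338c24f93250, 0x635af7be5383a0f7c9f083a1064630,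
    0x94e2f7c5ed7bdd26c233949ef8b9d3, 0x94d946c5cf94df28ba539ca157c213, 0x6326da4251a328a83dad9b5ad83632,
    0xa5253741ee751d0946346ca4facdad, 0x7c1b28c5d484271b462e6c2316bdd0, 0x94e2e7b64e7c5d26bdf18ca138ce50],
   [0x5aacbcc2b0936079494b8adc98ba31, 0x84eb1a3e2c7c1af8c56e7c1cfb4e0e, 0x8c2d0c520f94a4bab9cc7c64db31cf,
    0xa4a7093a08b362f6c253945aeabe0e, 0x8d695859eb6d1ceb3a30745aeacdcf, 0x8c64f8c24d8c20ea456c931afa4232,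
    0x83f0dbc68d7bdc88c1ae7ba09abdcf, 0xa4ab0a3a4e745b1849ee65270b520b, 0x6be518566e839ea9c65193a2f7c250,
    0x8366d9ba908c5cf741b08c27193672, 0xa4250ab60fabe7083dcc6c9afb422e, 0x841f07360e92a316ca318b170741f1,
    0x6ba7194a0f8420e8c9f18ba0d8be0f, 0x93a8ea46907c20e835c96460c8c9cd, 0x7be2e9b20f92a6f64a0f7c1ae8c20e,
    0x9cdd37b58ca427384a329458fa3e2e, 0xa4a119360f9ca138bdd084a54a3df2, 0x63dd1849b28b6eeace2e8b5ef7b64e,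
    0xa527074ded74db07ba748d2329ca2e, 0x741f3945b184a4eb41cd7b9ef93dd1, 0x8461074a6b8bdcd8c6139adad83df2,
    0x8364da4a919be0c6b24f84a507ba71, 0x73e8d93a8f7c5ac8496f8ba2e94a4f, 0x8c5f16c21173db47c2307c5f37ca32],
   [0x7be8d7ca0f6bdb06be118bdcd83df2, 0x6b9b0555b574a1483eb49ce165bef4, 0xa59b34d60b745b373333859f27d22f,
    0xa45b033dae749976ceb7a49f47ceaf, 0x6b9ef6c64e9aa6f5be72a357063a91, 0x8b58f4ce326b5f56c6f28421253e90,
    0x7b9ce54e337be13636908cdd45cecf, 0x9d231641af64dd6842337ca129c1f1, 0x8b60f749f2736337cab18c60f73650,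
    0x835504bdf18ae755bf3294e1554691, 0x741b27c9d55c9b2a4a517ca9363df3, 0x9c9704498f93e3374317b45d373673,
    0xb51cf6b1ce841f674e538ca129462f, 0x939f16c20e8b6106beb183dee741b0, 0x94972545d1745b57c27284a3464a30,
    0x73e6f749f06c5f1949b08b1ce83e10, 0x7ce127ca0b9ba2d8be53939ae83dd0, 0x7a5cc83a33ab2915c631ab5f06a6b2,
    0x6bdd26c5b174a1195256942517be51, 0x83d9172dd09b29374a4e7c5d27ce4b, 0x742317d6916be0e7b2ae652526d66d,
    0x8462e7c6107c5d1736118ce128be15, 0x5b1f09c21563a0fad1cd6ba4d6b5d2, 0x8ca3084dd17d20f93a518d2128c650],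
   [0x9426f9c2316d2119c5af846b1aadf3, 0x8c26f9420d94e8f945cf8c5edb3a8d, 0x8d2326cdad7d252ac232945d2a3e52,
    0x74e959526f55a0dc39ed4ca909cd8f, 0x8c1f18c2318c25193dea7c61184a2e, 0x83ead8d2724dd8f941d084eb19be72,
    0x8bdf07c63284e309be0e83e3183e50, 0x73a8e9464d9c68c9398d9b56da3a52, 0x8cecd8d28a84a0d7adae9416da4251,
    0x955d484a4b9ce4cb3a4e7c610951ce, 0x8c5f1945f185231abdab7c2118c210, 0x746929d63145dcfc498e6c2acab5b0,
    0x8c1b28ba2fa3a50842518c2537b5d2, 0x94e52851cf64a118c2926d26f9b9ee, 0x942ad9c28e84a0e631ce74e0ea4a2c,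
    0x84233945f4651f1ac1cd6c291841b0, 0x845d48422f6c1f19ca2e5be4c7c94d, 0x7c6519ce2e84a0da31ec7460f849d0,
    0x9c64f6be2c9c60f7c1f39358e9c22f, 0x5ba8c94a336bded94590931ef735f6, 0x6b9d26b9b0742529d9f2936108ba50,
    0x93dae746309ca3183e0fa421283a92, 0x84a107c2116cdaf8be30752737d1f1, 0x7c9d38c1f093a9093e2d7c9b184e2f],
   [0xa424d7b66e945d16c1b283e1094210, 0xacecb8c2ea8c8f04b194a4e32b4274, 0xbce4c7ae4c8c9326c9939c64fa49ef,
    0x7c26eacad07c1cc7b1aa6462e8ce2d, 0xb4a8e9ba8d849526358e75a91ac9ef, 0x94e0f93a0f7c9b2849b18ce31a4211,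
    0xc51af5a64b8c118549d394a138d610, 0x741f2946507c1afa41ae83e4f7bd74, 0x9326b7baae8c191545b29ba0f83e8f,
    0x9caac8b6cb73d114c1718c64f9c1f1, 0x8464f9c26e7b9ae73e107ce4e849b0, 0x9ba4c832517c57363dd1846737bdf4,
    0x8baca8be4f8bdce63d91939ce8ba11, 0x5b1cea42548362d9c9cd83e2f63a13, 0x93a0f7b6507c1b46c9d28be5283a33,
    0x94dd26c5cf6d194949f38c6519b9f2, 0x941f17c26f935f06b26f84a526c9b1, 0x6c66d8d2b07496b7b9d293e317c673,
    0x9420f7466e7c5b084a308422f8526b, 0x73e31aba146be31949ca4ca8e845cb, 0xa4dcf835eea4232845d08bdcf8c1ef,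
    0x9ceac9364b845905c19194dceb4e4f, 0x8c1f09422eabe6e8360d845f19464e, 0x939cf8a9f293dd274a11842517bdd2],
   [0x5ced095df14e1e9d517483a6baba0d, 0x63e2e945d2932ab9460f8b5ce7ba0f, 0x7528e75e504d56da41f57c24f94650,
    0x6da527d9724ddeed49d36ca50a4a0f, 0x645b2651b17ba6e9beb1841f254a0f, 0x6ce306c9b2655edbd5f783a509464f,
    0x73e2e74e327be4d83e4f7c5f1756ab, 0x6cdf3859b45da0dcce556cad09422d, 0x652357d5906c68dc4a118b5ce8c1ed,
    0x7c5f1645ce8362f84a328b58e7c60d, 0x6d6547ddf04d60bcc6524c66c9d1aa, 0x94e0f7460c9ba4d7ba51945af8ce2d,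
    0x842cd9ca8f6c56f7bd8f83e2c8bdf0, 0x6b592945d393eafad6109362e7ae4f, 0x8ca3084a51755d09c2106d2739d68c,
    0x841f15bdce745f37d1f48b5ee93a2e, 0x7bdf1735b374611a55f3936727b9d3, 0x74e748564c74a0b9ba10739ec94d8d,
    0x745b36c9d28b68f9ba6f73dd264def, 0x5be6db39f373a2d9516f7b60c8b5d1, 0x8c62e7c1ed9366e6c250941af8464b,
    0x7d1f2849b26d211abdad7c9f28ca11, 0x94e6f8ce6d7cdac83a338526fa4630, 0x849f16d1926d1f19c29584a5273df2],
   [0x8ba4e8b1f17c5d37d9b393a309b671, 0x83e319ba338463183e0e64a509420e, 0x93dd08c6737c1f183a0b64a316ce0e,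
    0x73a4e8c1f27cdd19557293a0f9b691, 0x72daf836139aa907c9ec7a9ae539cf, 0x73e709ca917c9cba41af8364d93df1,
    0x83e8e94212751917c99593e719ae34, 0x6b9ce83e3583e2f8bdcc7bdf454e51, 0x7b9cd8463483a308422f83df263e71,
    0x7be318ca13751b09ca347c6b283a13, 0x7b9f0742927bdd173a2f7c25374652, 0x6324fbc29383a0c8bdcb7426e835f2,
    0x9421183df26d17384634846b3839d4, 0xa35ed83eaea3a105be2f83dee83e4d, 0x8c5d3642109463183e538bdd38ca50,
    0x84a318c9f184dcf946147ca7193e10, 0x6bacebce7274a0993dcd6c24a9be0d, 0x635cc8b5f3a2e6f7c9afa29705b654,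
    0x639d28c1f374650b59ef73a4f8424e, 0x8421094651845eea3dcd83e718b9d4, 0x7b1ce8ae34832145ca2f7ca726ba31,
    0x8324c839f1942326cd92b35d092ad2, 0x7c9d174e135cdd19be3074e3474a52, 0x845f3842117be318be0b642116d1ac],
   [0x745d18c19384671a4a108c6538b212, 0x749d292dd192ecf945ca73db1759ad, 0x7caae9aa0f8b62f6416f83d909d1ef,
    0x8422e84651849f08b9cf93e3483a35, 0x85e3373a0a8ba4f7b60e7c551965ec, 0x84e8f9b64aab28b741af9394dad20c,
    0x74e53859d25d60eb3a5174eb48c1f1, 0x6ca317360e82e8e7cdcf82d4e8560b, 0x74e70939cf9bacc8c1ae8394e9d20d,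
    0x8462e74e10749f17b9f1a46138ba74, 0x8da518a9cb8ba507d1918b98eacdcd, 0x8d650835ed8364f6c2307c590959cd,
    0x7c1af73e118c5f3845b1a3dd483a76, 0x8c67173e0b93e0f642359b9aea39f1, 0x9c9ef7366d8bdb15c2318ca338564d,
    0x8c5f1741717c693846718523393e6d, 0x6b24d9b5f47c24e959918b24d8b610, 0x9d6137bdd25cdd493e0e552528d58e,
    0x94e707520e751b08b5f29be128c1f3, 0x95212a3dcf946518ba2f7d212a4610, 0x74a128ca2c83a6d941eb7398b84dcb,
    0x63e50ace5474a0babe0e746b17b9f2, 0x6be2e846118b64c8b9ed8b97074e31, 0x741f07ba0fa368f7bdd09359174230],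
   [0x7463074e3155151839f28c65374236, 0x835af731f38bdf36c61293a54631f6, 0x8cdb46c5cf7c5f283a717ca13841f2,
    0x8c5d153e2b82e1273a6e83191545d1, 0x8c5f263d8f7c6137c63593df1831d4, 0x7be0f7d26f841cd73231939ef6b5f5,
    0x8ca3193e2e7c5927bdb0842108b595, 0x745b163dd07b2136be31939935bdd6, 0x73e0f841d2741b0945b1935f0731b8,
    0x94a0e7bdd0745d3746128c6118b614, 0x8bd516b5ef9267373e8b7bdb23c5f0, 0x94dd16bdcc845d27bdf19bdd183db4,
    0x73dd28c9957c650c420d7be326b9b4, 0x935ed7b251a3a105be72946556c252, 0x94670aba6e83dd1731cb5ce2e8c56f,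
    0x9464e6420d7c5735bdf5ab9d18b216, 0x7c26c9bdf17ba4e84dce83e0d8ba2e, 0x9ca1073a0b8c21173dcd8396e8d1ec,
    0x8d1976c9af6c2129c6f15ce717cdab, 0x73d9063e1082a736c24f8b9935c251, 0x63a308c630741ef8c5f093a0f7be72,
    0xa49d2635ce8c23384a338bdf08c1ef, 0x73db28c1f3742109420e746516bdb4, 0x8c22f7d68d9be0c72e508bdcf74630]]

/-- Frames of norm `38` for the nine binary codes, stored as in `combinationMatrix`. -/
def frameRowsNineteen : List (List ℕ) :=
  [[0x8c24f8c6307c24c6b66e6ca717c9ec, 0x8ce149bd536be709c26e5d6b28c56d, 0x73a53945d05b64da562f636a88b50b,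
    0x7cab2a59f075247b4253742aca39ab, 0x5bd9273d53732ae95e9593250635ef, 0x5ae90acdf65c24ba3dec5c2ae73151,
    0x6b26f9d1f66b66b9466f7ba8f6b5d0, 0x83eae8c64d839eb5be149320c93171, 0x6ca91bca125be2aa4e0e4caac9c56b,
    0x835f17b9b17ba2e8d2318ae2d7b190, 0x53e729c1ee73a4a94df08364c935ae, 0x7a5eea21d3a1eef5d62d83a2d731ad,
    0x8b5d083e127ba517426d7464f7462d, 0x73a0f652326c5cf73e5493a125be52, 0x8469095aab7c9ea82e2e6ca2c9c9ec,
    0x7c9f183e108460d9c9f17be318ca2f, 0x6c1f07c61183e4e8463093e127c650, 0x8360d9320ea362e755d3b2e0b8a5f1,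
    0x8c231bc1f39428e9be0c6ce708b9af, 0x6bd947b99463a549529164eb36bdcf, 0x7b66e93e71735cd845ce7360c7c172,
    0x6c2338cdd26c64ebc1ec73a2f841ce, 0x9d6908458e749f184a168c60fb3def, 0x9422f7b1ae9b65253a108c1908b9d1],
   [0x6ad51735b4836b47ce0d73dcf639f0, 0x4b5546ddf37be70aba6e93dd34ba36, 0x532109c1947ba309cd6c835ce6b594,
    0x4ad7093610a9ecd84dca9290c4c1f1, 0x4a60f841d27ba2f7ca129b5ce63215, 0x6bd546495463e1494ed27ca515bdb1,
    0x49d4d5b5d68aa926de12a2db1432b3, 0x3b99465df173e4ca3a309ad904b9d6, 0x5ba0e8ca0e8364d74a309c1cd83651,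
    0x7c5916c5f07b2327c24e7bd916c611, 0x431f28d21363e2db4dac6ad8a6c5ee, 0x6360e852337be6c83e6f841ee6466e,
    0x841f49460f8ca508b62d74a318c1d0, 0x6c2337c5b2645f08c6136c22f7c190, 0x7b9d07ca318be6e9460f8b5ce6be0f,
    0x6b6309b60e9322f855b1925898add1, 0x6cd766cd916be31bc24c6bdd15d190, 0x9ca70941ce8c5ef8ca128c62dab990,
    0x4ae2c93e138b22d84990b31d162e58, 0x835907b9758ca559d1f19423383672, 0x83dce6b1f07b6135ce518c5f06ce4e,
    0x83e2c8b64e9b2505c1ac7bd4e8ca6c, 0x839906462f8b612642729bdf073253, 0x6c66f8e2906558b92e517ce5084a51],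
   [0x739ed73a6f835f16c58e9b1b073a33, 0x4220d8cad482e0b731ea7adaf44613, 0x8b60e7c6916c98e7b22d7429074193,
    0x9b14e6ae91a32145368d8c6165c671, 0x8ce907528c6c58d7aa0d6c1ad85dae, 0x8b24b83af09c5cd7b9ad8b61084a31,
    0x5322c94ed48be09825ca839d264a74, 0x7362f9b61373e129496c7362e8b1b2, 0x7a64aa3b51935cb7358673e2d7522f,
    0x93dd075ad0849cf8266c7ca317ca30, 0x72df0842919ba6c7b66e73e316c230, 0x735b17c6707c1cf93a2c8362f6b9b5,
    0xa39f08b63284d948c1cf7c6b18b9b3, 0x9c9cf73e6a941f0742109c1cf9462f, 0x6b9b1641d38422f9469593a3463a15,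
    0x6b1cd7a5f29aa927516c929706c24f, 0x94dd47bdaf7ba5193e4c63dee7490e, 0x6368d952cf83dca839ae9adab7c252,
    0x8399074a32836327be8e741f15462e, 0x94df384e108ce2f9326f7d23394a4d, 0x8ca6f84e906cd8d7b22f5d2708ddec,
    0x6c2318d2116c5ef9bdcf83a108b1d5, 0x7be3294e727ca4dab62b5ca927cdee, 0x7ae0d9ba928ba0f5b60b74a1074670],
   [0x6d1d3651f1639f17bad0652144da0d, 0x7457493a318b6727be494d230659e9, 0x8d132639f093e346be8f7d63765e6d,
    0x749154bdb4439f884eac4ce943de0a, 0x74591839ce92e2f8d20f8b9ad6c5cf, 0x7521084e52445327ba4e5de93655f1,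
    0x94e0f7c1ed841f063e307cdae8d22b, 0x645526c2137be328c22b6c9d35668c, 0x6c5336c2327c2137be4d6d21655eae,
    0x9c5525364f841d373e4d64e525e60a, 0x841cf8ba2f9362f73a4b74df16d62c, 0x6d6126ca2e4b9b27c22d54df16e1eb,
    0x7b5b054630936306ba71931d14be11, 0x7bdb18be147b6527426f6ce9463df0, 0x4c2549d2334cdaeb41ad5be4e749b0,
    0x84df17c5ad73a1184a508c5ce8420d, 0x94e1274a2f5cdd1a460e5466f8d5ca, 0x8bdaf82e509be517460d842127ce8c,
    0x9c1b273db18ce347c6307ce319464c, 0x8d1914bd71749f784654949d874a74, 0x9ce508466d839d16364e749ef8d1ed,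
    0x7c60f8466e93dec7365074df07d62e, 0x8ba6b936536c5526c59084a9083e33, 0x6b9917bdf08b2508ce0f935ee5c1f1],
   [0x83d90741f4846147be30746136c250, 0x8b22b7ba5174dd37c58e7c20d8c28e, 0x729ed92df673e546d1ec6466d7ba6c,
    0x9be4e835ef8ba31741d0835ac8b991, 0x92e2b936775d1947c1ad5d2f17be31, 0x842307ba506c6117c20e5ca319566b,
    0x6258c632366b615645eb7ba1244292, 0x6b9f194e726462d9ba2a5ca4e7ce2d, 0x839cf8359484e348c98f8be3283631,
    0xab58f6ba348523583a4d652b37ca6d, 0x8c26d942b164990735cb652508de4d, 0x6c1af83db584a71a49af83e1273e51,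
    0x9c1cf931f19ca337cdb08460f9be6c, 0x7c68f94eaf74dec831ad741cfa526e, 0x6b5af745f684a30a39ee83e355c234,
    0x6bdd46c9f254df0ace516428f7c60e, 0x6aa4bacad37b9ec735ea7c66d64250, 0x93dd053dcd9ba926c674a358f83e4e,
    0x83e307b9b084233639ef8c5d183e11, 0xac22e83e508c1f06b60f74a508c1b1, 0x7b9af73dd3832346ca518bdd173672,
    0xaca0f7aa2e845b664210752539ce0f, 0x73a8fa3e116bdf19494d735cb8b592, 0x6c610841f173a6f949ed735ed741cd],
   [0x9b5b15d2138c615623127d6545ba53, 0x73eae752ce6456f631f28bdf07c254, 0x8c2508526e7b5b06264f8c9cf73df4,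
    0x841f17561173a326aad1852135ba32, 0x8c2cb8cecf6d14e62db084def94a91, 0xaba0e6c26b9b5f43ae51ac18f7b252,
    0x7c6505ce4d6c9af73614941d084a32, 0x93a308be6e92e514aa6e749ce73def, 0x8320d5c9f4649d363eb58ce7273295,
    0x9464e7468c7bd924b23284db08c632, 0x8ca12749ec83e13736539418f8b232, 0x6322e74eaf7b9cd6365193daf64692,
    0x8c6528561074dae8ae70752718c5d2, 0x7b1ef93a5473e107c20d5c28e6c1cf, 0x9ce12745ed849f093a538ca518c5b1,
    0x9cdf293dce93e146ba3184dd0939b2, 0x931af73e10a3e517ca31a360e7aa12, 0x845ef6bd70942728c6139b5718b653,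
    0x73e6d7c26e6b9af5b9f193dcf7ba14, 0x7b68d8466f8b5ef5c1f39b1ee7b251, 0x8ca6f656ad6d16f6b2537cdf08da8e,
    0x739d084dd774a7193eb17d6d673a91, 0x735b47c5f27b6719428d6bdef645ed, 0xa49cf7c250949f27320e851f484eaf],
   [0x94a1494a307cdd38b22d6d2538cdef, 0x746147c5ae8426fa49cf82dcc9396f, 0x5b66d9567363dab7b1ed83e0e5c1f3,
    0x7c2107c1d17cdd483dd18c1f37c233, 0x74a6f74e2f5c96f7b9b1941b08ce53, 0x83def746118c210846119ba107be13,
    0x9422f8b9b284e14841ef8ce539424f, 0x9524f7cdf064db17b20f7cdd28ca12, 0x5c651951b45c9edac5f07c6107c5f2,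
    0x84250949f26cdb2a45cf7c25093e11, 0x84a5074a2d74d907cdf59ba2e9ba30, 0x73dd36bdd3742128ca5173e72741d1,
    0xace33941b0749d48c271756b1a3d8f, 0x5be1185213645ada41cf84250649f2, 0x94e106c20b8bdf17c9d19b16c8c5ce,
    0x7c68d941f26d5afa457083e5094611, 0x7b9f0839d2ab68f83def935d27b9d4, 0x8d691849ae74df08bdf28498faca30,
    0x6bdf1846107b612845ee835b06c231, 0x839ef746156cdd27ce54846b27be90, 0x74a35651ed64def9c2737be508c1cf,
    0x9360f836309c9f3639cf945f284251, 0x63a2f9c9f66420f9c1ee7be51631b5, 0x8c5cf6c62e841d06b6309bdb17c652],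
   [0xa46309ba1274db3841ee756d29c210, 0x841f06da146c1f26b2cf6de346528d, 0x8462d645b3741f3646738d5f4756ec,
    0x93e2d8bdf56c9b18c5f074ab27bdf3, 0xb5611545b16c9d7636b26e1f68de4c, 0xa5630555cf5d19473ab37e2558da6c,
    0x9c26f8c6317597083a127d6b19c213, 0x7ce51755f24c9719420f6d2107de0d, 0x8d1d2455d24cd94736f26de366e68c,
    0x9cdf47c1926d5949ca557ced48b9b3, 0xa4df15cdb07c212746f37d6118d669, 0x8ce6f55e314cd7273a937d2327d68d,
    0xa45ee7b210839955c9f2942337be13, 0x8c5d05318f73df585a139b9d184630, 0x8c62e949f28ca10949f39ca319b672,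
    0x9d1b67c5b07d613a3e70756938c9cf, 0x6c68e95a2f6c5cb8be0f8c1ed8464f, 0x7c611741d07ba31746117bd8d8462d,
    0x7b66e845f46d1ae8c9f58be90831f4, 0xa3dcf5c1f19ca5463a928ca15846cd, 0xa52127ce8e6cd708324e5d2708d58d,
    0x9be6c94690849ae7b1ed7d25094a70, 0x6c65175272549b08322f652556da50, 0x93dd18b9b283a337428f6d651749cd],
   [0x52e8c8c2af72e0b6c58d8a98b6c250, 0x4aa2b94eb37320c7c1cd8b5ee53e92, 0x52a4d84a707b20c645f19a9ab63632,
    0x7be2c9beed7394e545b1935aa73e50, 0x6b22f8c26f7b61063def8bdcf7ba52, 0x62a4a73e90731b04c5b0a31ae63a92,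
    0x5320f7ca535c20f84e117ba2f73a90, 0x5ba2f7d26f73a2d7320e835af63e31, 0x73aac84e6f63dcd642338be0e83e6f,
    0x62a0e842936bdef7c5ce832505be31, 0x5b1eca367372daf6cdb09a9ad5ae36, 0x6322f7c6125b9f17c60f739ee5bdf1,
    0xa4a4d9360f83a11542717523094a2b, 0x739cf94a918360d93e4d7c24e641f1, 0x7be3094272749b0849f26c26f93a30,
    0x7328c84ecf741ec635ce7bdcc7ca6d, 0x735f0942557cdce93e10846d464213, 0x7c270abdb16c9f1a4d8e73e0b93590,
    0x7ba0f841f18b6306ca13a31cd72df3, 0x6cdb5851d07424eaba2d6bdef745ae, 0x8c66d8c6ad7c18d739ad8bdae8ce51,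
    0x949f0831ed8c1d3745b39c1d19b9f5, 0x4b6107c6126321084a108b1f15ba14, 0x8bded5b62e8bdb4545f3ab9917c6d0]]

/-- Vectors dual modulo `2` to the last twelve vectors of the frames in `frameRowsTwo`, as tested by
`witnessCheck`. -/
def oddPairingWords : List (List ℕ) :=
  [[0x000ceb, 0x0006b5, 0x000db2, 0x000d2e, 0x000228, 0x0008fa,
    0x000d78, 0x0009df, 0x000f1d, 0x00033e, 0x000de5, 0x000240],
   [0x00445a, 0x000175, 0x004296, 0x00432c, 0x00411d, 0x000779,
    0x0043c7, 0x004647, 0x00021f, 0x000645, 0x0001c8, 0x00047a],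
   [0x01120c, 0x0006e4, 0x0010cc, 0x0104e1, 0x011680, 0x0004e3,
    0x00007e, 0x0012a3, 0x000089, 0x0002eb, 0x001696, 0x011214],
   [0x004388, 0x000992, 0x000965, 0x000360, 0x0041b5, 0x004393,
    0x000845, 0x000940, 0x0048a8, 0x004a57, 0x004270, 0x004128],
   [0x000cd0, 0x00074b, 0x00010e, 0x000594, 0x00039a, 0x000104,
    0x0002c5, 0x100109, 0x000e4a, 0x000c83, 0x00019a, 0x0000c4],
   [0x000253, 0x000004, 0x800bec, 0x0001bc, 0x800b8f, 0x000957,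
    0x80091f, 0x8000b5, 0x0000e2, 0x00035d, 0x800a9b, 0x000209],
   [0x000824, 0x00084f, 0x04026e, 0x0403dd, 0x00099c, 0x04083d,
    0x040982, 0x040a25, 0x04013b, 0x040af5, 0x0001f0, 0x000341],
   [0x0041a1, 0x000398, 0x00001a, 0x00451c, 0x00003e, 0x0004c3,
    0x00456b, 0x00000a, 0x000198, 0x000031, 0x00005d, 0x000124],
   [0x000af2, 0x00028c, 0x000a50, 0x000607, 0x0004a3, 0x0005f9,
    0x000389, 0x000662, 0x0002b4, 0x000849, 0x000167, 0x0001eb]]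

end FrameData

/-! ### Frames for all indices -/

section Conclusion

/-- For each of the nine indices `c` there is a frame of norm `2 * k` in the Leech lattice whose
halves are governed by the binary code with parity check columns `g c 0, …, g c 23`. -/
def HasFrames (k : ℕ) (g : ℕ → ℕ → ℕ) : Prop :=
  ∀ c : Fin 9, ∃ F, IsFrame leechGram F k ∧ HalvesAre F fun i => bitVector (g c i)

theorem HasFrames.mul {k m : ℕ} {g h : ℕ → ℕ → ℕ} (hk : HasFrames k g)
    {q : Matrix (Fin 4) (Fin 4) ℤ} (hq : q * qᵀ = (m : ℤ) • (1 : Matrix (Fin 4) (Fin 4) ℤ))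
    (hgh : ∀ c F, (HalvesAre F fun i => bitVector (g c i)) →
      HalvesAre (blockMatrix q * F) fun i => bitVector (h c i)) : HasFrames (m * k) h := by
  intro c
  obtain ⟨F, hF, hg⟩ := hk c
  exact ⟨_, hF.mul_left (blockMatrix_mul_transpose hq), hgh c F hg⟩

theorem HasFrames.two_mul {k : ℕ} {g : ℕ → ℕ → ℕ} (hk : HasFrames k g) :
    HasFrames (2 * k) fun c => pairXor (g c) :=
  hk.mul (q := quaternionMatrix 1 1 0 0) (quaternionMatrix_mul_transpose 1 1 0 0)
    fun _ _ h => h.pairXor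

theorem HasFrames.three_mul {k : ℕ} {g : ℕ → ℕ → ℕ} (hk : HasFrames k g) :
    HasFrames (3 * k) fun c => tripleXor (g c) :=
  hk.mul (q := quaternionMatrix 0 1 1 1) (quaternionMatrix_mul_transpose 0 1 1 1)
    fun _ _ h => h.tripleXor (by decide)

theorem HasFrames.five_mul {k : ℕ} {g : ℕ → ℕ → ℕ} (hk : HasFrames k g) : HasFrames (5 * k) g :=
  hk.mul (q := quaternionMatrix 1 2 0 0) (quaternionMatrix_mul_transpose 1 2 0 0)
    fun _ _ h => h.mul_one_two

theorem HasFrames.seven_mul {k : ℕ} {g : ℕ → ℕ → ℕ} (hk : HasFrames k g) :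
    HasFrames (7 * k) fun c => tripleXor (g c) :=
  hk.mul (q := quaternionMatrix 2 1 1 1) (quaternionMatrix_mul_transpose 2 1 1 1)
    fun _ _ h => h.tripleXor (by decide)

theorem selfDualCheck_codeRows (c : Fin 9) : selfDualCheck (codeRows.getD c []) = true :=
  allBelow_iff (f := fun c => selfDualCheck (codeRows.getD c [])).1 (by decide +kernel) c

theorem hasFrames_of_odd {p : ℕ} (hp : p ≤ 19) (hodd : Odd p) {r : List (List ℕ)}
    (h : allBelow (fun c => frameCheck p (codeRows.getD c []) (r.getD c [])) 9 = true) :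
    HasFrames p codeWord := fun c =>
  ⟨_, isFrame_of_frameCheck hp (allBelow_iff.1 h c),
    halvesAre_of_odd hp hodd (selfDualCheck_codeRows c) (allBelow_iff.1 h c)⟩

theorem hasFrames_two : HasFrames 2 codeWord := fun c =>
  ⟨_, isFrame_of_frameCheck (by norm_num) (allBelow_iff
    (f := fun c => frameCheck 2 (codeRows.getD c []) (frameRowsTwo.getD c [])).1
      (by decide +kernel) c),
    halvesAre_of_witnessCheck (allBelow_iff
      (f := fun c => witnessCheck (frameRowsTwo.getD c []) (oddPairingWords.getD c [])).1
        (by decide +kernel) c)⟩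

theorem hasFrames_three : HasFrames 3 codeWord :=
  hasFrames_of_odd (r := frameRowsThree) (by norm_num) (by decide) (by decide +kernel)

theorem hasFrames_five : HasFrames 5 codeWord :=
  hasFrames_of_odd (r := frameRowsFive) (by norm_num) (by decide) (by decide +kernel)

theorem hasFrames_seven : HasFrames 7 codeWord :=
  hasFrames_of_odd (r := frameRowsSeven) (by norm_num) (by decide) (by decide +kernel)

theorem hasFrames_eleven : HasFrames 11 codeWord :=
  hasFrames_of_odd (r := frameRowsEleven) (by norm_num) (by decide) (by decide +kernel)

theorem hasFrames_thirteen : HasFrames 13 codeWord :=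
  hasFrames_of_odd (r := frameRowsThirteen) (by norm_num) (by decide) (by decide +kernel)

theorem hasFrames_seventeen : HasFrames 17 codeWord :=
  hasFrames_of_odd (r := frameRowsSeventeen) (by norm_num) (by decide) (by decide +kernel)

theorem hasFrames_nineteen : HasFrames 19 codeWord :=
  hasFrames_of_odd (r := frameRowsNineteen) (by norm_num) (by decide) (by decide +kernel)

/-- A Boolean test that nine families of words have at most `12` bits and have distinct cube
counts. -/
def separationCheck (g : ℕ → ℕ → ℕ) : Bool :=
  allBelow (fun c => allBelow (fun i => decide (g c i < 2 ^ 12)) 24) 9 &&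
    decide ((List.range 9).map fun c => fastCubeCount (g c)).Nodup

/-- The factor `d` stands for a dilation of the given frames. -/
theorem HasFrames.exists_codes {k : ℕ} {g : ℕ → ℕ → ℕ} (h : HasFrames k g)
    (hg : separationCheck g = true) {d : ℕ} (hk : k ≠ 0) (hd : d ≠ 0) (hdk : 2 ≤ d ^ 2 * k) :
    ∃ C : Fin 9 → ZCode (2 * (d ^ 2 * k)) 24,
      (∀ i, (C i).IsExtremalTypeII) ∧ ∀ i j, i ≠ j → ¬ (C i).Equivalent (C j) := by
  rw [separationCheck, Bool.and_eq_true, decide_eq_true_iff] at hg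
  refine exists_inequivalent leechGram_isRootlessUnimodular hk hd hdk (fun c i => g c i)
    (fun c i => of_decide_eq_true (allBelow_iff.1 (allBelow_iff.1 hg.1 c) i)) ?_ h
  intro c c' hcc
  simp only [cubeCount_eq_fastCubeCount] at hcc
  exact Fin.ext (List.inj_on_of_nodup_map hg.2 (List.mem_range.2 c.isLt)
    (List.mem_range.2 c'.isLt) hcc)

theorem separationCheck_codeWord : separationCheck codeWord = true := by decide +kernel

theorem separationCheck_pairXor :
    separationCheck (fun c => pairXor (codeWord c)) = true := by decide +kernel

theorem separationCheck_tripleXor :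
    separationCheck (fun c => tripleXor (codeWord c)) = true := by decide +kernel

end Conclusion

end

theorem mainTheorem5 (k : ℕ) (hk₂ : 2 ≤ k) (hk₂₀ : k ≤ 20) :
    ∃ C : Fin 9 → ZCode (2 * k) 24,
      (∀ i, (C i).IsExtremalTypeII) ∧
      ∀ i j, i ≠ j → ¬ (C i).Equivalent (C j) := by
  have plain {p : ℕ} (h : HasFrames p codeWord) (d : ℕ) (hp : p ≠ 0) (hd : d ≠ 0) :=
    h.exists_codes (d := d) separationCheck_codeWord hp hd
  have pair {p : ℕ} (h : HasFrames p codeWord) (d : ℕ) (hp : 2 * p ≠ 0) (hd : d ≠ 0) :=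
    h.two_mul.exists_codes (d := d) separationCheck_pairXor hp hd
  have triple {p : ℕ} (h : HasFrames p fun c => tripleXor (codeWord c)) (hp : p ≠ 0) :=
    h.exists_codes (d := 1) separationCheck_tripleXor hp one_ne_zero
  -- Each `k` is `d ^ 2 * m * p` with `p` prime and `m` the norm of a quaternion, or `1`.
  interval_cases k
  · exact plain hasFrames_two 1 (by simp) (by simp) (by simp)
  · exact plain hasFrames_three 1 (by simp) (by simp) (by simp)
  · exact pair hasFrames_two 1 (by simp) (by simp) (by simp)
  · exact plain hasFrames_five 1 (by simp) (by simp) (by simp)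
  · exact triple hasFrames_two.three_mul (by simp) (by simp)
  · exact plain hasFrames_seven 1 (by simp) (by simp) (by simp)
  · exact plain hasFrames_two 2 (by simp) (by simp) (by simp)
  · exact triple hasFrames_three.three_mul (by simp) (by simp)
  · exact plain hasFrames_two.five_mul 1 (by simp) (by simp) (by simp)
  · exact plain hasFrames_eleven 1 (by simp) (by simp) (by simp)
  · exact plain hasFrames_three 2 (by simp) (by simp) (by simp)
  · exact plain hasFrames_thirteen 1 (by simp) (by simp) (by simp)
  · exact triple hasFrames_two.seven_mul (by simp) (by simp)
  · exact triple hasFrames_five.three_mul (by simp) (by simp)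
  · exact pair hasFrames_two 2 (by simp) (by simp) (by simp)
  · exact plain hasFrames_seventeen 1 (by simp) (by simp) (by simp)
  · exact plain hasFrames_two 3 (by simp) (by simp) (by simp)
  · exact plain hasFrames_nineteen 1 (by simp) (by simp) (by simp)
  · exact plain hasFrames_five 2 (by simp) (by simp) (by simp)
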